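/- Let $d,n\ge 1$ and $D\ge 0$ be integers, $0\le s<1$, $\Omega=(0,1)^d$, let $\Gamma\in\mathbb R^{D\times D}$ be symmetric positive definite, and let $B\ge 0$. For $y\in\mathbb R^D$ and a map $\mathcal G:\Omega\to\mathbb R^D$ put $$\Phi_{\mathcal G}(\theta)=\tfrac12\,(y-\mathcal G(\theta))^{\top}\Gamma^{-1}(y-\mathcal G(\theta)).$$ For $f:\Omega\to\mathbb R$ let $\|f\|_{n,\infty}=\max_{|\alpha|\le n}\|D^\alpha f\|_{L^\infty(\Omega)}$ (weak derivatives) be the norm of the Sobolev space $W^{n,\infty}(\Omega)$; let $\|f\|_{0,\infty}=\|f\|_{L^\infty(\Omega)}$ and, for $0<s<1$, $$\|f\|_{s,\infty}=\max\Big\{\|f\|_{L^\infty(\Omega)},\ \operatorname*{ess\,sup}_{x,x'\in\Omega}\frac{|f(x)-f(x')|}{|x-x'|^s}\Big\}.$$ A ReLU network is a composition of affine layers with the ReLU applied componentwise after every layer but the last (no skip connections); its depth is the number of layers, its number of weights is the number of nonzero entries of its weight matrices and bias vectors, and its number of units is the sum of the dimensions of all layers, input and output included. For a nondegenerate Gaussian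 density $\pi_0$ on $\mathbb R^d$ (any mean, any positive definite covariance), the posterior density on $\Omega$ with potential $\Phi$ is $$\hat\pi_\Phi(\theta)=\frac1Z\,e^{-\Phi(\theta)}\pi_0(\theta),\qquad Z=\int_\Omega e^{-\Phi(\theta)}\pi_0(\theta)\,d\theta,$$ and the Hellinger distance of densities on $\Omega$ is $d_H(f,g)=\big(\tfrac12\int_\Omega(\sqrt f-\sqrt g)^2\,d\theta\big)^{1/2}$. Then there are constants $c,C>0$, depending only on $d,D,n,s,\Gamma,B$, such that the following holds for all $y\in\mathbb R^D$ with $|y_j|\le B$ for all $j$, all $\mathcal G=(\mathcal G_1,\dots,\mathcal G_D)$ with $\mathcal G_j\in W^{n,\infty}(\Omega)$ and $\|\mathcal G_j\|_{n,\infty}\le B$ for all $j$, and all $\epsilon\in(0,1/2)$. 1. There is a ReLU network $\mathcal G^e:\mathbb R^d\to\mathbb R^D$ with $$\|\Phi_{\mathcal G}-\Phi_{\mathcal G^e}\|_{s,\infty}\le\epsilon,$$ with depth at most $c\log(\epsilon^{-n/(n-s)})$, and with at most $c\,\epsilon^{-d/(n-s)}\log^2(\epsilon^{-n/(n-s)})$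 weights and at most as many units. 2. For every ReLU network $\mathcal G^e:\mathbb R^d\to\mathbb R^D$ with $\|\Phi_{\mathcal G}-\Phi_{\mathcal G^e}\|_{s,\infty}\le\epsilon$, in particular for the one in 1, and for every nondegenerate Gaussian prior $\pi_0$, the posterior with the true likelihood and the posterior with the emulated likelihood satisfy $$d_H(\hat\pi_{\Phi_{\mathcal G}},\hat\pi_{\Phi_{\mathcal G^e}})\le C\epsilon .$$ -/

import Mathlib

open MeasureTheory Matrix
open scoped ENNReal ContDiff

noncomputable section

namespace Emulation

/-- The open unit cube `(0,1)^d`. -/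
def cube (d : ℕ) : Set (EuclideanSpace ℝ (Fin d)) :=
  {θ | ∀ i, 0 < θ i ∧ θ i < 1}

/-- Lebesgue measure on the open unit cube. -/
def cubeMeasure (d : ℕ) : Measure (EuclideanSpace ℝ (Fin d)) :=
  volume.restrict (cube d)

/-! ### Sobolev spaces on the cube, through weak derivatives -/

/-- The classical partial derivative `∂_i φ`. -/
def partialDeriv {d : ℕ} (i : Fin d) (φ : EuclideanSpace ℝ (Fin d) → ℝ) :
    EuclideanSpace ℝ (Fin d) → ℝ :=
  fun x => fderiv ℝ φ x (EuclideanSpace.single i 1)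

/-- The classical derivative `D^α φ = ∂_0^{α 0} ∂_1^{α 1} ⋯ φ` for a multi-index `α`. -/
def multiDeriv {d : ℕ} (α : Fin d → ℕ) (φ : EuclideanSpace ℝ (Fin d) → ℝ) :
    EuclideanSpace ℝ (Fin d) → ℝ :=
  (List.finRange d).foldr (fun i ψ => (partialDeriv i)^[α i] ψ) φ

/-- `g` is a weak derivative `D^α f` on the cube. -/
def IsWeakDeriv {d : ℕ} (α : Fin d → ℕ) (f g : EuclideanSpace ℝ (Fin d) → ℝ) : Prop :=
  ∀ φ : EuclideanSpace ℝ (Fin d) → ℝ,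
    ContDiff ℝ ∞ φ → HasCompactSupport φ → tsupport φ ⊆ cube d →
      ∫ x, f x * multiDeriv α φ x ∂(cubeMeasure d) =
        (-1) ^ (∑ i, α i) * ∫ x, g x * φ x ∂(cubeMeasure d)

/-- `f ∈ W^{n,p}((0,1)^d)`. -/
def MemSobolev {d : ℕ} (n : ℕ) (p : ℝ≥0∞) (f : EuclideanSpace ℝ (Fin d) → ℝ) : Prop :=
  MemLp f p (cubeMeasure d) ∧
    ∀ α : Fin d → ℕ, ∑ i, α i ≤ n → ∃ g, MemLp g p (cubeMeasure d) ∧ IsWeakDeriv α f g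

open Classical in
/-- The weak derivative `D^α f` in `L^∞`: it is determined almost everywhere; the value is `0` if
there is none. -/
def weakDeriv {d : ℕ} (α : Fin d → ℕ) (f : EuclideanSpace ℝ (Fin d) → ℝ) :
    EuclideanSpace ℝ (Fin d) → ℝ :=
  if h : ∃ g, MemLp g ∞ (cubeMeasure d) ∧ IsWeakDeriv α f g then h.choose else 0

/-- The norm `‖f‖_{n,∞} = max_{|α| ≤ n} ‖D^α f‖_∞` of `f ∈ W^{n,∞}((0,1)^d)`. -/
def sobolevNorm {d : ℕ} (n : ℕ) (f : EuclideanSpace ℝ (Fin d) → ℝ) : ℝ≥0∞ :=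
  ⨆ (α : Fin d → ℕ) (_ : ∑ i, α i ≤ n), eLpNorm (weakDeriv α f) ∞ (cubeMeasure d)

/-- The norm `‖f‖_{s,∞}` for `0 ≤ s < 1`: the `L^∞` norm if `s = 0`, and the Sobolev–Slobodeckij
norm `max {‖f‖_∞, ess sup |f x - f y| / |x - y|^s}` if `0 < s < 1`. -/
def slobodeckijNorm {d : ℕ} (s : ℝ) (f : EuclideanSpace ℝ (Fin d) → ℝ) : ℝ≥0∞ :=
  if s = 0 then eLpNorm f ∞ (cubeMeasure d)
  else max (eLpNorm f ∞ (cubeMeasure d))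
    (eLpNorm (fun z : EuclideanSpace ℝ (Fin d) × EuclideanSpace ℝ (Fin d) =>
      (f z.1 - f z.2) / ‖z.1 - z.2‖ ^ s) ∞ ((cubeMeasure d).prod (cubeMeasure d)))

/-! ### ReLU networks -/

/-- A standard feed-forward network with input dimension `k` and output dimension `m`: a finite
sequence of affine layers `x ↦ A x + b`. -/
inductive Net : ℕ → ℕ → Type
  | out {k m : ℕ} (A : Matrix (Fin m) (Fin k) ℝ) (b : Fin m → ℝ) : Net k m
  | hidden {k l m : ℕ} (A : Matrix (Fin l) (Fin k) ℝ) (b : Fin l → ℝ) (rest : Net l m) : Net k m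

/-- The function computed by the network: ReLU after every layer but the last. -/
def Net.eval : {k m : ℕ} → Net k m → (Fin k → ℝ) → (Fin m → ℝ)
  | _, _, .out A b, x => A *ᵥ x + b
  | _, _, .hidden A b rest, x => rest.eval fun i => max ((A *ᵥ x + b) i) 0

/-- The number of layers. -/
def Net.depth : {k m : ℕ} → Net k m → ℕ
  | _, _, .out _ _ => 1
  | _, _, .hidden _ _ rest => rest.depth + 1

/-- The number of nonzero entries of a weight matrix and a bias vector. -/
def layerWeights {k l : ℕ} (A : Matrix (Fin l) (Fin k) ℝ) (b : Fin l → ℝ) : ℕ :=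
  {q : Fin l × Fin k | A q.1 q.2 ≠ 0}.ncard + {i : Fin l | b i ≠ 0}.ncard

/-- The number of (nonzero) weights. -/
def Net.numWeights : {k m : ℕ} → Net k m → ℕ
  | _, _, .out A b => layerWeights A b
  | _, _, .hidden A b rest => layerWeights A b + rest.numWeights

/-- The number of units, those of the input and the output layer included. -/
def Net.numUnits : {k m : ℕ} → Net k m → ℕ
  | k, m, .out _ _ => k + m
  | k, _, .hidden _ _ rest => k + rest.numUnits

/-- The map `θ ↦ 𝒢ᵉ(θ)` given by a network. -/
def Net.emulator {d D : ℕ} (N : Net d D) (θ : EuclideanSpace ℝ (Fin d)) : Fin D → ℝ :=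
  N.eval fun i => θ i

/-! ### Potentials, posteriors, Hellinger distance -/

/-- The potential `Φ(y;θ) = ½ ‖y - G θ‖_Γ²` with `‖v‖_Γ² = vᵀ Γ⁻¹ v`, that is, the negative
log-likelihood, up to a constant, of `y = G θ + ε`, `ε ∼ N(0, Γ)`. -/
def potential {d D : ℕ} (Γ : Matrix (Fin D) (Fin D) ℝ) (y : Fin D → ℝ)
    (G : EuclideanSpace ℝ (Fin d) → Fin D → ℝ) (θ : EuclideanSpace ℝ (Fin d)) : ℝ :=
  1 / 2 * ((y - G θ) ⬝ᵥ (Γ⁻¹ *ᵥ (y - G θ)))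

/-- The Lebesgue density of the Gaussian distribution `N(m, S)` on `ℝ^d`. -/
def gaussianDensity {d : ℕ} (m : Fin d → ℝ) (S : Matrix (Fin d) (Fin d) ℝ)
    (θ : EuclideanSpace ℝ (Fin d)) : ℝ :=
  (√((2 * Real.pi) ^ d * S.det))⁻¹ *
    Real.exp (-(1 / 2) * ((fun i => θ i - m i) ⬝ᵥ (S⁻¹ *ᵥ fun i => θ i - m i)))

/-- The normalizing constant `Z = ∫ exp(-Φ) π₀` over the cube. -/
def normalizer {d : ℕ} (Φ π₀ : EuclideanSpace ℝ (Fin d) → ℝ) : ℝ :=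
  ∫ θ, Real.exp (-Φ θ) * π₀ θ ∂(cubeMeasure d)

/-- The posterior density `Z⁻¹ exp(-Φ(θ)) π₀(θ)` on the cube. -/
def posterior {d : ℕ} (Φ π₀ : EuclideanSpace ℝ (Fin d) → ℝ) (θ : EuclideanSpace ℝ (Fin d)) : ℝ :=
  (normalizer Φ π₀)⁻¹ * (Real.exp (-Φ θ) * π₀ θ)

/-- The Hellinger distance of densities on the cube:
`d_H(f, g)² = ½ ∫ (√f - √g)²`. -/
def hellinger {d : ℕ} (f g : EuclideanSpace ℝ (Fin d) → ℝ) : ℝ≥0∞ :=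
  (2⁻¹ * ∫⁻ θ, ENNReal.ofReal ((√(f θ) - √(g θ)) ^ 2) ∂(cubeMeasure d)) ^ (1 / 2 : ℝ)

end Emulation

end

/-! Emulation. After one of its bounded weak derivatives is used to pass to a Lipschitz
representative (`WeakDerivBdd.exists_lipschitz`), each component of the forward map is uniformly
close on the closed cube to a smooth function with the same derivative bounds
(`WeakDerivBdd.exists_smooth_approx`). All later constants depend on these bounds only, so classical
calculus applies and the smoothing error can be made as small as desired.

A smooth function is replaced by Taylor polynomials of degree below `n` at the points of a grid of
mesh `1/N`, glued by products of hat functions. The error is of order `N^(-n)` in the uniform norm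
and `N^(-(n-1))` in the Lipschitz seminorm (`quasiInterp_error`); interpolating between the two
gives `N^(-(n-s))` in the Hölder norm. The glued function is a combination of about `N^d` products
with a fixed number of factors, each computed exactly by a small network. Squares are approximated
by iterating the tent map, with error `4^(-M)` at depth proportional to `M`, and products follow by
polarisation. The Lipschitz constant of an approximate product does not depend on `M`, and of its
distance to the exact product only a crude Lipschitz bound is needed: since `s < 1`, interpolation
with the exponentially small uniform error absorbs any power of `N` once `M` is a large multiple of
`log N` (`holderBdd_prodApprox`). The terms have constant width and depth of order `log N`, so their
sum has of the order of `N^d log N` weights and units. Choosing `N` of order `ε^(-1/(n-s))` gives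
the stated sizes, in fact with a single logarithm. The difference of two potentials is bilinear in
the emulation error and the residuals, so the rate carries over (`holderBdd_potential_sub`).

Posteriors. If the potentials differ by at most `ε` almost everywhere, the likelihoods and the
normalizers each change by a factor in `[e^(-ε), e^ε]`, hence the densities by at most `e^(2ε)` and
their square roots by at most `e^ε`. So `(√p - √q)^2 ≤ (e^ε - 1)^2 p`, and integrating the
probability density `p` bounds the Hellinger distance by `2ε`, whatever the prior
(`hellinger_posterior_le`). -/

noncomputable section

namespace Emulation

/-! ### Calculus of ReLU networks -/

namespace Net

/-- The largest dimension of a layer. -/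
def width : {k m : ℕ} → Net k m → ℕ
  | k, m, .out _ _ => max k m
  | k, _, .hidden _ _ rest => max k rest.width

theorem in_le_width : {k m : ℕ} → (N : Net k m) → k ≤ N.width
  | _, _, .out _ _ => le_max_left _ _
  | _, _, .hidden _ _ _ => le_max_left _ _

theorem out_le_width : {k m : ℕ} → (N : Net k m) → m ≤ N.width
  | _, _, .out _ _ => le_max_right _ _
  | _, _, .hidden _ _ rest => rest.out_le_width.trans (le_max_right _ _)

theorem one_le_depth {k m : ℕ} (N : Net k m) : 1 ≤ N.depth := by
  cases N <;> simp [depth]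

theorem layerWeights_le {k l : ℕ} (A : Matrix (Fin l) (Fin k) ℝ) (b : Fin l → ℝ) :
    layerWeights A b ≤ l * k + l := by
  unfold layerWeights
  refine add_le_add ?_ ?_
  · refine (Set.ncard_le_ncard (Set.subset_univ _)).trans ?_
    simp [Set.ncard_univ]
  · refine (Set.ncard_le_ncard (Set.subset_univ _)).trans ?_
    simp [Set.ncard_univ]

theorem numUnits_le : {k m : ℕ} → (N : Net k m) → N.numUnits ≤ (N.depth + 1) * N.width
  | k, m, .out _ _ => by
      simp only [numUnits, depth, width]
      have := le_max_left k m
      have := le_max_right k m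
      omega
  | k, m, .hidden _ _ rest => by
      simp only [numUnits, depth, width]
      have h := numUnits_le rest
      calc k + rest.numUnits ≤ max k rest.width + (rest.depth + 1) * max k rest.width :=
            add_le_add (le_max_left _ _) (h.trans (Nat.mul_le_mul_left _ (le_max_right _ _)))
        _ = _ := by ring

/-- Meant for the single summands, whose width is constant, so that their size is linear in the
depth. For the whole sum this bound would be quadratic in the number of summands; there the weights
are added up instead. -/
theorem numWeights_le : {k m : ℕ} → (N : Net k m) →
    N.numWeights ≤ N.depth * (N.width * N.width + N.width)
  | k, m, .out A b => by
      simp only [numWeights, depth, width]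
      refine (layerWeights_le A b).trans ?_
      rw [one_mul]
      gcongr <;> simp
  | k, m, .hidden (l := l) A b rest => by
      simp only [numWeights, depth, width]
      have h := numWeights_le rest
      have h1 : l ≤ max k rest.width := rest.in_le_width.trans (le_max_right _ _)
      have h2 : k ≤ max k rest.width := le_max_left _ _
      have h3 : rest.width ≤ max k rest.width := le_max_right _ _
      generalize max k rest.width = w at *
      calc layerWeights A b + rest.numWeights
          ≤ (w * w + w) + rest.depth * (w * w + w) := by
            refine add_le_add ((layerWeights_le A b).trans (by gcongr)) (h.trans (by gcongr))
        _ = _ := by ring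

/-- Precomposition with an affine map. -/
def precomp {k' : ℕ} : {k m : ℕ} → Net k m → Matrix (Fin k) (Fin k') ℝ → (Fin k → ℝ) → Net k' m
  | _, _, .out A b, M, v => .out (A * M) (A *ᵥ v + b)
  | _, _, .hidden A b rest, M, v => .hidden (A * M) (A *ᵥ v + b) rest

theorem eval_precomp {k' k m : ℕ} (N : Net k m) (M : Matrix (Fin k) (Fin k') ℝ) (v : Fin k → ℝ)
    (x : Fin k' → ℝ) : (N.precomp M v).eval x = N.eval (M *ᵥ x + v) := by
  cases N <;> simp [precomp, eval, Matrix.mulVec_add, add_assoc]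

theorem depth_precomp {k' k m : ℕ} (N : Net k m) (M : Matrix (Fin k) (Fin k') ℝ) (v : Fin k → ℝ) :
    (N.precomp M v).depth = N.depth := by
  cases N <;> simp [precomp, depth]

theorem width_precomp_le {k' k m : ℕ} (N : Net k m) (M : Matrix (Fin k) (Fin k') ℝ)
    (v : Fin k → ℝ) : (N.precomp M v).width ≤ max k' N.width := by
  cases N <;> simp only [precomp, width] <;> omega

/-- The composition of `N₁` and then `N₂`, the last layer of `N₁` merged with the first one of
`N₂`. -/
def comp : {k l m : ℕ} → Net k l → Net l m → Net k m
  | _, _, _, .out A b, N => N.precomp A b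
  | _, _, _, .hidden A b rest, N => .hidden A b (rest.comp N)

theorem eval_comp : {k l m : ℕ} → (N₁ : Net k l) → (N₂ : Net l m) → (x : Fin k → ℝ) →
    (N₁.comp N₂).eval x = N₂.eval (N₁.eval x)
  | _, _, _, .out A b, N, x => by simp [comp, eval_precomp, eval]
  | _, _, _, .hidden A b rest, N, x => by simp [comp, eval, eval_comp rest N]

theorem depth_comp : {k l m : ℕ} → (N₁ : Net k l) → (N₂ : Net l m) →
    (N₁.comp N₂).depth + 1 = N₁.depth + N₂.depth
  | _, _, _, .out A b, N => by simp [comp, depth_precomp, depth, add_comm]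
  | _, _, _, .hidden A b rest, N => by
      simp only [comp, depth, depth_comp rest N]; omega

theorem width_comp_le : {k l m : ℕ} → (N₁ : Net k l) → (N₂ : Net l m) →
    (N₁.comp N₂).width ≤ max N₁.width N₂.width
  | _, _, _, .out A b, N => by
      refine (width_precomp_le _ _ _).trans (max_le_max ?_ le_rfl)
      simp [width]
  | _, _, _, .hidden A b rest, N => by
      have := width_comp_le rest N
      simp only [comp, width]
      omega

/-- The block diagonal matrix of two matrices. -/
def blockDiag {a b c e : ℕ} (A : Matrix (Fin a) (Fin b) ℝ) (A' : Matrix (Fin c) (Fin e) ℝ) :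
    Matrix (Fin (a + c)) (Fin (b + e)) ℝ :=
  Fin.append (fun i => Fin.append (A i) 0) (fun i => Fin.append 0 (A' i))

/-- Two matrices above each other. -/
def vStack {a b c : ℕ} (A : Matrix (Fin a) (Fin b) ℝ) (A' : Matrix (Fin c) (Fin b) ℝ) :
    Matrix (Fin (a + c)) (Fin b) ℝ :=
  Fin.append A A'

/-- Two matrices beside each other. -/
def hStack {a b c : ℕ} (A : Matrix (Fin a) (Fin b) ℝ) (A' : Matrix (Fin a) (Fin c) ℝ) :
    Matrix (Fin a) (Fin (b + c)) ℝ :=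
  fun i => Fin.append (A i) (A' i)

theorem blockDiag_mulVec {a b c e : ℕ} (A : Matrix (Fin a) (Fin b) ℝ)
    (A' : Matrix (Fin c) (Fin e) ℝ) (x : Fin b → ℝ) (x' : Fin e → ℝ) :
    blockDiag A A' *ᵥ Fin.append x x' = Fin.append (A *ᵥ x) (A' *ᵥ x') := by
  ext i
  refine Fin.addCases (fun i => ?_) (fun i => ?_) i <;>
    simp [blockDiag, Matrix.mulVec, dotProduct, Fin.sum_univ_add]

theorem vStack_castAdd {a b c : ℕ} (A : Matrix (Fin a) (Fin b) ℝ)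
    (A' : Matrix (Fin c) (Fin b) ℝ) (i : Fin a) (j : Fin b) :
    vStack A A' (Fin.castAdd c i) j = A i j := congrFun (Fin.append_left A A' i) j

theorem vStack_natAdd {a b c : ℕ} (A : Matrix (Fin a) (Fin b) ℝ)
    (A' : Matrix (Fin c) (Fin b) ℝ) (i : Fin c) (j : Fin b) :
    vStack A A' (Fin.natAdd a i) j = A' i j := congrFun (Fin.append_right A A' i) j

theorem vStack_mulVec {a b c : ℕ} (A : Matrix (Fin a) (Fin b) ℝ)
    (A' : Matrix (Fin c) (Fin b) ℝ) (x : Fin b → ℝ) :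
    vStack A A' *ᵥ x = Fin.append (A *ᵥ x) (A' *ᵥ x) := by
  ext i
  refine Fin.addCases (fun i => ?_) (fun i => ?_) i <;>
    simp [vStack_castAdd, vStack_natAdd, Matrix.mulVec, dotProduct]

theorem hStack_mulVec {a b c : ℕ} (A : Matrix (Fin a) (Fin b) ℝ)
    (A' : Matrix (Fin a) (Fin c) ℝ) (x : Fin b → ℝ) (x' : Fin c → ℝ) :
    hStack A A' *ᵥ Fin.append x x' = A *ᵥ x + A' *ᵥ x' := by
  ext i
  simp [hStack, Matrix.mulVec, dotProduct, Fin.sum_univ_add]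

theorem ncard_fin_add {a b : ℕ} (p : Fin (a + b) → Prop) :
    {i | p i}.ncard = {i | p (Fin.castAdd b i)}.ncard + {i | p (Fin.natAdd a i)}.ncard := by
  classical
  simp only [Set.ncard_eq_toFinset_card', Set.toFinset_ofPred, Finset.card_filter]
  exact Fin.sum_univ_add _

theorem ncard_prod_fin {l k : ℕ} (p : Fin l → Fin k → Prop) :
    {q : Fin l × Fin k | p q.1 q.2}.ncard = ∑ i, {j | p i j}.ncard := by
  classical
  simp only [Set.ncard_eq_toFinset_card', Set.toFinset_ofPred, Finset.card_filter]
  exact Fintype.sum_prod_type _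

theorem layerWeights_eq_sum {k l : ℕ} (A : Matrix (Fin l) (Fin k) ℝ) (b : Fin l → ℝ) :
    layerWeights A b = ∑ i, {j | A i j ≠ 0}.ncard + {i | b i ≠ 0}.ncard := by
  rw [layerWeights, ncard_prod_fin (fun i j => A i j ≠ 0)]

theorem layerWeights_blockDiag {a b c e : ℕ} (A : Matrix (Fin a) (Fin b) ℝ)
    (A' : Matrix (Fin c) (Fin e) ℝ) (v : Fin a → ℝ) (v' : Fin c → ℝ) :
    layerWeights (blockDiag A A') (Fin.append v v') = layerWeights A v + layerWeights A' v' := by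
  simp only [layerWeights_eq_sum, Fin.sum_univ_add, ncard_fin_add]
  simp [blockDiag]
  ring

theorem layerWeights_vStack {a b c : ℕ} (A : Matrix (Fin a) (Fin b) ℝ)
    (A' : Matrix (Fin c) (Fin b) ℝ) (v : Fin a → ℝ) (v' : Fin c → ℝ) :
    layerWeights (vStack A A') (Fin.append v v') = layerWeights A v + layerWeights A' v' := by
  simp only [layerWeights_eq_sum, Fin.sum_univ_add, ncard_fin_add, vStack_castAdd, vStack_natAdd,
    Fin.append_left, Fin.append_right]
  ring

theorem ncard_add_ne_zero_le {ι : Type*} [Finite ι] (f g : ι → ℝ) :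
    {i | f i + g i ≠ 0}.ncard ≤ {i | f i ≠ 0}.ncard + {i | g i ≠ 0}.ncard := by
  refine (Set.ncard_le_ncard ?_).trans (Set.ncard_union_le _ _)
  intro i hi
  by_contra h
  simp only [Set.mem_union, Set.mem_ofPred_eq, not_or, not_not] at h
  exact hi (by rw [h.1, h.2, add_zero])

theorem layerWeights_hStack_le {a b c : ℕ} (A : Matrix (Fin a) (Fin b) ℝ)
    (A' : Matrix (Fin a) (Fin c) ℝ) (v v' : Fin a → ℝ) :
    layerWeights (hStack A A') (v + v') ≤ layerWeights A v + layerWeights A' v' := by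
  simp only [layerWeights_eq_sum, ncard_fin_add, hStack, Fin.append_left,
    Fin.append_right, Finset.sum_add_distrib]
  have := ncard_add_ne_zero_le v v'
  simp only [Pi.add_apply]
  omega

theorem layerWeights_add_le {a b : ℕ} (A A' : Matrix (Fin a) (Fin b) ℝ) (v v' : Fin a → ℝ) :
    layerWeights (A + A') (v + v') ≤ layerWeights A v + layerWeights A' v' := by
  have h1 := ncard_add_ne_zero_le v v'
  have h2 := ncard_add_ne_zero_le (fun q : Fin a × Fin b => A q.1 q.2) (fun q => A' q.1 q.2)
  simp only [layerWeights, Pi.add_apply, Matrix.add_apply]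
  omega

/-- Two networks of the same depth on separate inputs, with their outputs added. -/
def sumPar : {k k' m : ℕ} → Net k m → Net k' m → Net (k + k') m
  | _, _, _, .out A b, .out A' b' => .out (hStack A A') (b + b')
  | _, _, _, .hidden A b rest, .hidden A' b' rest' =>
      .hidden (blockDiag A A') (Fin.append b b') (rest.sumPar rest')
  -- Default value for unequal depths; the evaluation lemma assumes equal ones.
  | _, _, _, _, _ => .out 0 0

theorem append_relu {a b : ℕ} (u u' : Fin a → ℝ) (v v' : Fin b → ℝ) :
    (fun i => max ((Fin.append u v + Fin.append u' v') i) 0) =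
      Fin.append (fun i => max ((u + u') i) 0) (fun i => max ((v + v') i) 0) := by
  ext i
  refine Fin.addCases (fun i => ?_) (fun i => ?_) i <;> simp

theorem eval_sumPar : {k k' m : ℕ} → (N : Net k m) → (N' : Net k' m) → N.depth = N'.depth →
    (x : Fin k → ℝ) → (x' : Fin k' → ℝ) →
    (N.sumPar N').eval (Fin.append x x') = N.eval x + N'.eval x'
  | _, _, _, .out A b, .out A' b', _, x, x' => by
      simp only [sumPar, eval, hStack_mulVec]; abel
  | _, _, _, .hidden A b rest, .hidden A' b' rest', h, x, x' => by
      simp only [sumPar, eval, blockDiag_mulVec, append_relu]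
      exact eval_sumPar rest rest' (by simpa [depth] using h) _ _
  | _, _, _, .out A b, .hidden A' b' rest', h, x, x' => by
      have := rest'.one_le_depth
      simp only [depth] at h; omega
  | _, _, _, .hidden A b rest, .out A' b', h, x, x' => by
      have := rest.one_le_depth
      simp only [depth] at h; omega

theorem depth_sumPar : {k k' m : ℕ} → (N : Net k m) → (N' : Net k' m) → N.depth = N'.depth →
    (N.sumPar N').depth = N.depth
  | _, _, _, .out A b, .out A' b', _ => by simp only [sumPar, depth]
  | _, _, _, .hidden A b rest, .hidden A' b' rest', h => by
      simp only [sumPar, depth]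
      rw [depth_sumPar rest rest' (by simpa [depth] using h)]
  | _, _, _, .out A b, .hidden A' b' rest', h => by
      have := rest'.one_le_depth
      simp only [depth] at h; omega
  | _, _, _, .hidden A b rest, .out A' b', h => by
      have := rest.one_le_depth
      simp only [depth] at h; omega

theorem layerWeights_zero {k l : ℕ} :
    layerWeights (0 : Matrix (Fin l) (Fin k) ℝ) (0 : Fin l → ℝ) = 0 := by
  simp [layerWeights]

theorem numWeights_sumPar_le : {k k' m : ℕ} → (N : Net k m) → (N' : Net k' m) →
    (N.sumPar N').numWeights ≤ N.numWeights + N'.numWeights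
  | _, _, _, .out A b, .out A' b' => by
      simpa only [sumPar, numWeights] using layerWeights_hStack_le A A' b b'
  | _, _, _, .hidden A b rest, .hidden A' b' rest' => by
      have := numWeights_sumPar_le rest rest'
      simp only [sumPar, numWeights, layerWeights_blockDiag]
      omega
  | _, _, _, .out A b, .hidden A' b' rest' => by
      simp [sumPar, numWeights, layerWeights_zero]
  | _, _, _, .hidden A b rest, .out A' b' => by
      simp [sumPar, numWeights, layerWeights_zero]

theorem out_le_numUnits : {k m : ℕ} → (N : Net k m) → k + m ≤ N.numUnits
  | _, _, .out _ _ => le_rfl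
  | _, _, .hidden _ _ rest => by
      have := rest.out_le_numUnits
      simp only [numUnits]; omega

theorem numUnits_sumPar_le : {k k' m : ℕ} → (N : Net k m) → (N' : Net k' m) →
    (N.sumPar N').numUnits ≤ N.numUnits + N'.numUnits
  | _, _, _, .out A b, .out A' b' => by
      simp only [sumPar, numUnits]; omega
  | _, _, _, .hidden A b rest, .hidden A' b' rest' => by
      have := numUnits_sumPar_le rest rest'
      simp only [sumPar, numUnits]; omega
  | _, _, _, .out A b, .hidden A' b' rest' => by
      have := rest'.out_le_numUnits
      simp only [sumPar, numUnits]; omega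
  | _, _, _, .hidden A b rest, .out A' b' => by
      have := rest.out_le_numUnits
      simp only [sumPar, numUnits]; omega

theorem width_sumPar_le : {k k' m : ℕ} → (N : Net k m) → (N' : Net k' m) →
    (N.sumPar N').width ≤ N.width + N'.width
  | _, _, _, .out A b, .out A' b' => by
      simp only [sumPar, width]; omega
  | _, _, _, .hidden A b rest, .hidden A' b' rest' => by
      have := width_sumPar_le rest rest'
      simp only [sumPar, width]; omega
  | _, _, _, .out A b, .hidden A' b' rest' => by
      simp only [sumPar, width]; omega
  | _, _, _, .hidden A b rest, .out A' b' => by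
      have := rest.out_le_width
      simp only [sumPar, width]; omega

/-- The sum of two networks of the same depth. -/
def add : {k m : ℕ} → Net k m → Net k m → Net k m
  | _, _, .out A b, .out A' b' => .out (A + A') (b + b')
  | _, _, .hidden A b rest, .hidden A' b' rest' =>
      .hidden (vStack A A') (Fin.append b b') (rest.sumPar rest')
  | _, _, _, _ => .out 0 0

/-- The sum of two networks of the same depth computes the sum; depth is kept, and the widths, the
numbers of weights and the numbers of units at most add up. -/
theorem add_spec {k m : ℕ} (N N' : Net k m) (h : N.depth = N'.depth) :
    (∀ x, (N.add N').eval x = N.eval x + N'.eval x) ∧ (N.add N').depth = N.depth ∧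
    (N.add N').width ≤ N.width + N'.width ∧
    (N.add N').numWeights ≤ N.numWeights + N'.numWeights ∧
    (N.add N').numUnits ≤ N.numUnits + N'.numUnits := by
  cases N with
  | out A b =>
    cases N' with
    | out A' b' =>
      refine ⟨fun x => ?_, rfl, ?_, layerWeights_add_le A A' b b', ?_⟩
      · simp only [add, eval, Matrix.add_mulVec]; abel
      · simp only [add, width]; omega
      · simp only [add, numUnits]; omega
    | hidden A' b' rest' =>
      have := rest'.one_le_depth
      simp only [depth] at h; omega
  | hidden A b rest =>
    cases N' with
    | out A' b' =>
      have := rest.one_le_depth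
      simp only [depth] at h; omega
    | hidden A' b' rest' =>
      have h' : rest.depth = rest'.depth := by simpa [depth] using h
      refine ⟨fun x => ?_, ?_, ?_, ?_, ?_⟩
      · simp only [add, eval, vStack_mulVec, append_relu]
        exact eval_sumPar rest rest' h' _ _
      · simp only [add, depth, depth_sumPar rest rest' h']
      · have := width_sumPar_le rest rest'
        simp only [add, width]; omega
      · have := numWeights_sumPar_le rest rest'
        simp only [add, numWeights, layerWeights_vStack]; omega
      · have := numUnits_sumPar_le rest rest'
        simp only [add, numUnits]; omega

/-- A network of any depth that computes zero. -/
def zero : (L k m : ℕ) → Net k m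
  | 0, _, _ => .out 0 0
  -- Hidden layers of dimension 0 cost neither weights nor units.
  | L + 1, _, m => .hidden (l := 0) 0 0 (zero L 0 m)

theorem zero_spec : (L k m : ℕ) → (∀ x, (zero L k m).eval x = 0) ∧ (zero L k m).depth = L + 1 ∧
    (zero L k m).numWeights = 0 ∧ (zero L k m).numUnits = k + m
  | 0, k, m => ⟨fun x => by simp [zero, eval], rfl, by simp [zero, numWeights, layerWeights_zero],
      rfl⟩
  | L + 1, k, m => by
      obtain ⟨h1, h2, h3, h4⟩ := zero_spec L 0 m
      refine ⟨fun x => by simp only [zero, eval, h1], by simp only [zero, depth, h2], ?_, ?_⟩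
      · simp only [zero, numWeights, h3, layerWeights_zero]
      · simp [zero, numUnits, h4]

/-- A finite sum of networks of the same depth. -/
theorem exists_sum {ι : Type*} (t : Finset ι) {k m L W U : ℕ} (hL : 1 ≤ L) (N : ι → Net k m)
    (hN : ∀ i ∈ t, (N i).depth = L ∧ (N i).numWeights ≤ W ∧ (N i).numUnits ≤ U) :
    ∃ N' : Net k m, (∀ x, N'.eval x = ∑ i ∈ t, (N i).eval x) ∧ N'.depth = L ∧
      N'.numWeights ≤ t.card * W ∧ N'.numUnits ≤ t.card * U + (k + m) := by
  classical
  induction t using Finset.induction_on with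
  | empty =>
    -- The empty sum still has input and output units, whence the additive `k + m`; `zero (L - 1)`
    -- has depth `L`.
    obtain ⟨h1, h2, h3, h4⟩ := zero_spec (L - 1) k m
    exact ⟨zero (L - 1) k m, by simpa using h1, by omega, by simp [h3], by simp [h4]⟩
  | insert i t hi ih =>
    obtain ⟨N', h1, h2, h3, h4⟩ := ih fun j hj => hN j (Finset.mem_insert_of_mem hj)
    obtain ⟨g1, g2, g3⟩ := hN i (Finset.mem_insert_self _ _)
    obtain ⟨f1, f2, -, f4, f5⟩ := add_spec (N i) N' (g1.trans h2.symm)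
    refine ⟨(N i).add N', fun x => ?_, f2.trans g1, ?_, ?_⟩
    · rw [f1, h1, Finset.sum_insert hi]
    · rw [Finset.card_insert_of_notMem hi, add_mul]; omega
    · rw [Finset.card_insert_of_notMem hi, add_mul]; omega

end Net

/-! ### Scalar functions computed by networks of bounded width -/

/-- `f` is computed by a network of depth `L` and width at most `w`. -/
def IsNet (k L w : ℕ) (f : (Fin k → ℝ) → ℝ) : Prop :=
  ∃ N : Net k 1, N.depth = L ∧ N.width ≤ w ∧ ∀ x, N.eval x 0 = f x

namespace IsNet

variable {k L L' w w' : ℕ} {f g : (Fin k → ℝ) → ℝ}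

theorem mono (hf : IsNet k L w f) (h : w ≤ w') : IsNet k L w' f := by
  obtain ⟨N, h1, h2, h3⟩ := hf
  exact ⟨N, h1, h2.trans h, h3⟩

theorem one_le (hf : IsNet k L w f) : 1 ≤ w := by
  obtain ⟨N, -, h2, -⟩ := hf
  exact N.out_le_width.trans h2

/-- Composition merges the two adjacent affine layers, so one layer of the outer network is not
counted. -/
theorem postcomp {h : ℝ → ℝ} (hh : IsNet 1 (L' + 1) w' fun z => h (z 0)) (hf : IsNet k L w f) :
    IsNet k (L + L') (max w w') fun x => h (f x) := by
  obtain ⟨N, h1, h2, h3⟩ := hf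
  obtain ⟨N', h1', h2', h3'⟩ := hh
  refine ⟨N.comp N', ?_, (N.width_comp_le N').trans (max_le_max h2 h2'), fun x => ?_⟩
  · have := N.depth_comp N'
    omega
  · rw [Net.eval_comp, h3']
    simp only [h3]

theorem affine (a b : ℝ) (hf : IsNet k L w f) : IsNet k L w fun x => a * f x + b := by
  have h : IsNet 1 (0 + 1) 1 fun z => a * z 0 + b :=
    ⟨.out !![a] ![b], rfl, by simp [Net.width],
      fun x => by simp [Net.eval, Matrix.vecHead]⟩
  exact (postcomp (h := fun z => a * z + b) h hf).mono (max_le le_rfl hf.one_le)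

theorem add (hf : IsNet k L w f) (hg : IsNet k L w' g) :
    IsNet k L (w + w') fun x => f x + g x := by
  obtain ⟨N, h1, h2, h3⟩ := hf
  obtain ⟨N', h1', h2', h3'⟩ := hg
  obtain ⟨g1, g2, g3, -⟩ := N.add_spec N' (h1.trans h1'.symm)
  refine ⟨N.add N', g2.trans h1, g3.trans (add_le_add h2 h2'), fun x => ?_⟩
  rw [g1, Pi.add_apply, h3, h3']

theorem coord (i : Fin k) : IsNet k 1 k fun x => x i := by
  refine ⟨.out (Matrix.of fun _ => Pi.single i 1) 0, rfl, ?_, fun x => ?_⟩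
  · have := i.pos
    simp only [Net.width]; omega
  · simp [Net.eval, Matrix.mulVec]

theorem const (k : ℕ) (c : ℝ) : IsNet k 1 (k + 1) fun _ => c :=
  ⟨.out 0 ![c], rfl, by simp [Net.width], fun x => by simp [Net.eval]⟩

theorem relu_real : IsNet 1 2 1 fun z => max (z 0) 0 :=
  ⟨.hidden !![1] 0 (.out !![1] 0), rfl, by simp [Net.width],
    fun x => by simp [Net.eval, Matrix.vecHead]⟩

theorem relu (hf : IsNet k L w f) : IsNet k (L + 1) w fun x => max (f x) 0 :=
  (postcomp (h := fun z => max z 0) relu_real hf).mono (max_le le_rfl hf.one_le)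

/-- The identity is the difference of the rectified positive and negative parts, a network of width
2 that can be appended repeatedly. This equalises depths, as addition of networks requires. -/
theorem pad (hf : IsNet k L w f) (j : ℕ) : IsNet k (L + j) (max w 2) f := by
  have h : IsNet 1 2 2 fun z => z 0 := by
    have h0 : IsNet 1 1 1 fun z => z 0 := coord 0
    have h1 := (h0.relu).add (((h0.affine (-1) 0).relu).affine (-1) 0)
    convert h1 using 2 with z
    rcases le_total (z 0) 0 with h | h
    · rw [max_eq_right h, max_eq_left (by linarith)]; ring
    · rw [max_eq_left h, max_eq_right (by linarith)]; ring
  induction j with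
  | zero => exact hf.mono (le_max_left _ _)
  | succ j ih => exact (postcomp (h := fun z => z) h ih).mono (by omega)

end IsNet

/-! ### Approximate squaring -/

/-- The tent map. -/
def tent (t : ℝ) : ℝ := 2 * max t 0 - 4 * max (t - 1 / 2) 0

/-- The absolute value, cut off at `1`. -/
def clip (x : ℝ) : ℝ := 1 - max (1 - |x|) 0

/-- Partial sums of the expansion `t ^ 2 = t - ∑ tent^[r] t / 4 ^ r` on `[0,1]`. -/
def sqAcc : ℕ → ℝ → ℝ
  | 0, t => t
  | M + 1, t => sqAcc M t - tent^[M + 1] t / 4 ^ (M + 1)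

/-- An approximation of `x ^ 2` on `[-1,1]`. -/
def sqApprox (M : ℕ) (x : ℝ) : ℝ := sqAcc M (clip x)

theorem abs_relu_sub_le (a b : ℝ) : |max a 0 - max b 0| ≤ |a - b| := by
  simpa using abs_max_sub_max_le_max a 0 b 0

theorem abs_tent_sub_le (a b : ℝ) : |tent a - tent b| ≤ 2 * |a - b| := by
  unfold tent
  rw [abs_le]
  rcases le_total a b with h | h <;> rcases le_total a 0 with h1 | h1 <;>
  rcases le_total b 0 with h2 | h2 <;> rcases le_total (a - 1 / 2) 0 with h3 | h3 <;>
  rcases le_total (b - 1 / 2) 0 with h4 | h4 <;>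
  simp only [max_eq_left, max_eq_right, abs_of_nonneg, abs_of_nonpos, sub_nonneg, sub_nonpos, h,
    h1, h2, h3, h4] <;>
  constructor <;> linarith

theorem tent_of_le {t : ℝ} (h0 : 0 ≤ t) (h : t ≤ 1 / 2) : tent t = 2 * t := by
  rw [tent, max_eq_left h0, max_eq_right (by linarith)]; ring

theorem tent_of_ge {t : ℝ} (h : 1 / 2 ≤ t) : tent t = 2 - 2 * t := by
  rw [tent, max_eq_left (by linarith), max_eq_left (by linarith)]; ring

theorem tent_mem {t : ℝ} (ht : t ∈ Set.Icc (0 : ℝ) 1) : tent t ∈ Set.Icc (0 : ℝ) 1 := by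
  obtain ⟨h0, h1⟩ := ht
  rcases le_total t (1 / 2) with h | h
  · rw [tent_of_le h0 h]; constructor <;> linarith
  · rw [tent_of_ge h]; constructor <;> linarith

theorem tent_iterate_mem {t : ℝ} (ht : t ∈ Set.Icc (0 : ℝ) 1) (r : ℕ) :
    tent^[r] t ∈ Set.Icc (0 : ℝ) 1 := by
  induction r with
  | zero => exact ht
  | succ r ih => rw [Function.iterate_succ_apply']; exact tent_mem ih

theorem abs_tent_iterate_sub_le (r : ℕ) (a b : ℝ) :
    |tent^[r] a - tent^[r] b| ≤ 2 ^ r * |a - b| := by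
  induction r with
  | zero => simp
  | succ r ih =>
    rw [Function.iterate_succ_apply', Function.iterate_succ_apply']
    refine (abs_tent_sub_le _ _).trans ?_
    rw [pow_succ]; linarith

/-- The functional equation behind the expansion: `t - t ^ 2` reproduces itself along the orbit of
the tent map with factor `1/4`, so iteration leaves a remainder of order `4^(-M)`. -/
theorem tent_identity {t : ℝ} (ht : t ∈ Set.Icc (0 : ℝ) 1) :
    t - t ^ 2 = tent t / 4 + (tent t - tent t ^ 2) / 4 := by
  rcases le_total t (1 / 2) with h | h
  · rw [tent_of_le ht.1 h]; ring
  · rw [tent_of_ge h]; ring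

theorem sqAcc_sub_sq {t : ℝ} (ht : t ∈ Set.Icc (0 : ℝ) 1) (M : ℕ) :
    sqAcc M t - t ^ 2 = (tent^[M] t - tent^[M] t ^ 2) / 4 ^ M := by
  induction M with
  | zero => simp [sqAcc]
  | succ M ih =>
    have h := tent_identity (tent_iterate_mem ht M)
    rw [sqAcc, sub_right_comm, ih, h, Function.iterate_succ_apply', pow_succ (4 : ℝ)]
    field_simp
    ring

/-- The `r`-th term has Lipschitz constant `2^r / 4^r`, and these sum geometrically; the bound stays
below 2 for every `M`. -/
theorem abs_sqAcc_sub_le (M : ℕ) (a b : ℝ) :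
    |sqAcc M a - sqAcc M b| ≤ (2 - 1 / 2 ^ M) * |a - b| := by
  induction M with
  | zero => simp [sqAcc]; norm_num
  | succ M ih =>
    have h := abs_tent_iterate_sub_le (M + 1) a b
    have h4 : (4 : ℝ) ^ (M + 1) = 2 ^ (M + 1) * 2 ^ (M + 1) := by
      rw [← mul_pow]; norm_num
    have h' : |(tent^[M + 1] a - tent^[M + 1] b) / 4 ^ (M + 1)| ≤ 1 / 2 ^ (M + 1) * |a - b| := by
      rw [abs_div, abs_of_pos (by positivity : (0 : ℝ) < 4 ^ (M + 1)), div_le_iff₀ (by positivity),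
        h4]
      refine h.trans (le_of_eq ?_)
      field_simp
    have e : sqAcc (M + 1) a - sqAcc (M + 1) b = (sqAcc M a - sqAcc M b) -
        (tent^[M + 1] a - tent^[M + 1] b) / 4 ^ (M + 1) := by
      simp only [sqAcc]; ring
    rw [e]
    refine (abs_sub _ _).trans ((add_le_add ih h').trans (le_of_eq ?_))
    rw [pow_succ]; field_simp; ring

theorem clip_mem (x : ℝ) : clip x ∈ Set.Icc (0 : ℝ) 1 := by
  have h := abs_nonneg x
  refine ⟨?_, ?_⟩
  · have : max (1 - |x|) 0 ≤ 1 := max_le (by linarith) zero_le_one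
    unfold clip; linarith
  · have := le_max_right (1 - |x|) 0
    unfold clip; linarith

theorem clip_of_abs_le {x : ℝ} (hx : |x| ≤ 1) : clip x = |x| := by
  rw [clip, max_eq_left (by linarith)]; ring

theorem abs_clip_sub_le (a b : ℝ) : |clip a - clip b| ≤ |a - b| := by
  have e : clip a - clip b = -(max (1 - |a|) 0 - max (1 - |b|) 0) := by unfold clip; ring
  rw [e, abs_neg]
  refine (abs_relu_sub_le _ _).trans ?_
  rw [show 1 - |a| - (1 - |b|) = -(|a| - |b|) by ring, abs_neg]
  exact abs_abs_sub_abs_le_abs_sub a b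

/-- Clipping is 1-Lipschitz on all of `ℝ`. The global bound matters because approximate products may
leave `[-1,1]`. -/
theorem abs_sqApprox_sub_le (M : ℕ) (a b : ℝ) :
    |sqApprox M a - sqApprox M b| ≤ 2 * |a - b| := by
  refine (abs_sqAcc_sub_le M _ _).trans ?_
  have h : (0 : ℝ) ≤ 1 / 2 ^ M := by positivity
  exact mul_le_mul (by linarith) (abs_clip_sub_le a b) (abs_nonneg _) (by norm_num)

theorem abs_sqApprox_sub_sq_le (M : ℕ) {x : ℝ} (hx : |x| ≤ 1) :
    |sqApprox M x - x ^ 2| ≤ 1 / 4 ^ M := by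
  obtain ⟨h0, h1⟩ := tent_iterate_mem (clip_mem x) M
  rw [← sq_abs x, ← clip_of_abs_le hx, sqApprox, sqAcc_sub_sq (clip_mem x),
    abs_div, abs_of_pos (by positivity : (0 : ℝ) < 4 ^ M)]
  gcongr
  rw [abs_le]
  constructor <;> nlinarith

theorem isNet_clip : IsNet 1 3 2 fun z => clip (z 0) := by
  have h0 : IsNet 1 1 1 fun z => z 0 := IsNet.coord 0
  have h1 := ((((h0.relu).add ((h0.affine (-1) 0).relu)).affine (-1) 1).relu).affine (-1) 1
  convert h1 using 2 with z
  have : |z 0| = max (z 0) 0 + max (-1 * z 0 + 0) 0 := by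
    rcases le_total (z 0) 0 with h | h
    · rw [max_eq_right h, max_eq_left (by linarith), abs_of_nonpos h]; ring
    · rw [max_eq_left h, max_eq_right (by linarith), abs_of_nonneg h]; ring
  rw [clip, this]
  ring_nf

/-- Without skip connections the partial sum has to travel alongside the tent iterate; each further
term costs one layer and the width stays 4. -/
theorem exists_net_sqAcc (M : ℕ) : ∃ N : Net 1 2, N.depth = M + 3 ∧ N.width ≤ 4 ∧
    ∀ x, N.eval x = ![tent^[M] (clip (x 0)), sqAcc M (clip (x 0))] := by
  induction M with
  | zero =>
    obtain ⟨N, h1, h2, h3⟩ := isNet_clip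
    refine ⟨N.comp (.out !![1; 1] 0), ?_, (N.width_comp_le _).trans ?_, fun x => ?_⟩
    · have := N.depth_comp (.out !![1; 1] 0 : Net 1 2)
      simp only [Net.depth] at this
      omega
    · simp only [Net.width]; omega
    · rw [Net.eval_comp]
      ext i
      fin_cases i <;> simp [Net.eval, h3, sqAcc, dotProduct]
  | succ M ih =>
    obtain ⟨N, h1, h2, h3⟩ := ih
    let c : ℝ := 1 / 4 ^ (M + 1)
    -- The first two hidden units produce the tent map; the last two carry the partial sum as
    -- positive minus negative part.
    let T : Net 2 2 := .hidden !![1, 0; 1, 0; 0, 1; 0, -1] ![0, -(1 / 2), 0, 0]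
      (.out !![2, -4, 0, 0; -(2 * c), 4 * c, 1, -1] 0)
    refine ⟨N.comp T, ?_, (N.width_comp_le _).trans ?_, fun x => ?_⟩
    · have := N.depth_comp T
      simp only [T, Net.depth] at this ⊢
      omega
    · simp only [T, Net.width]; omega
    · have hs : ∀ a : ℝ, max a 0 - max (-a) 0 = a := fun a => by
        rcases le_total a 0 with h | h
        · rw [max_eq_right h, max_eq_left (by linarith)]; ring
        · rw [max_eq_left h, max_eq_right (by linarith)]; ring
      rw [Net.eval_comp, h3]
      have e : tent^[M + 1] (clip (x 0)) = tent (tent^[M] (clip (x 0))) :=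
        Function.iterate_succ_apply' _ _ _
      rw [sqAcc, e]
      generalize tent^[M] (clip (x 0)) = t
      have := hs (sqAcc M (clip (x 0)))
      generalize sqAcc M (clip (x 0)) = q at *
      ext i
      fin_cases i
      · simp [T, Net.eval, dotProduct, Fin.sum_univ_four, tent]
        ring_nf
      · simp [T, Net.eval, dotProduct, Fin.sum_univ_four, tent, c]
        simp only [← sub_eq_add_neg]
        linear_combination this

theorem isNet_sqApprox (M : ℕ) : IsNet 1 (M + 2 + 1) 4 fun z => sqApprox M (z 0) := by
  obtain ⟨N, h1, h2, h3⟩ := exists_net_sqAcc M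
  refine ⟨N.comp (.out !![0, 1] 0), ?_, (N.width_comp_le _).trans ?_, fun x => ?_⟩
  · have := N.depth_comp (.out !![0, 1] 0 : Net 2 1)
    simp only [Net.depth] at this
    omega
  · simp only [Net.width]; omega
  · rw [Net.eval_comp, h3]
    simp [Net.eval, sqApprox]

/-! ### Approximate products -/

/-- An approximation of the product of a list of numbers in `[-1,1]`. -/
def prodApprox (M : ℕ) : List ℝ → ℝ
  | [] => 1
  | u :: l => sqApprox M ((u + prodApprox M l) / 2) - sqApprox M ((u - prodApprox M l) / 2)

theorem abs_list_prod_le {l : List ℝ} (hl : ∀ u ∈ l, |u| ≤ 1) : |l.prod| ≤ 1 := by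
  induction l with
  | nil => simp
  | cons u l ih =>
    rw [List.prod_cons, abs_mul]
    exact mul_le_one₀ (hl u List.mem_cons_self) (abs_nonneg _)
      (ih fun v hv => hl v (List.mem_cons_of_mem _ hv))

/-- Polarisation: `u p = ((u + p)/2)^2 - ((u - p)/2)^2`. The squares are compared at the exact
product `p`, where the arguments lie in `[-1,1]`, and the Lipschitz bound covers the passage to the
approximate one. The errors thus obey `e ↦ 2 e + 2 / 4^M`, starting from 0. -/
theorem abs_prodApprox_sub_prod_le (M : ℕ) {l : List ℝ} (hl : ∀ u ∈ l, |u| ≤ 1) :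
    |prodApprox M l - l.prod| ≤ (2 ^ (l.length + 1) - 2) / 4 ^ M := by
  induction l with
  | nil => simp [prodApprox]
  | cons u l ih =>
    have hl' : ∀ v ∈ l, |v| ≤ 1 := fun v hv => hl v (List.mem_cons_of_mem _ hv)
    have hu := abs_le.1 (hl u List.mem_cons_self)
    have hp := abs_le.1 (abs_list_prod_le hl')
    have ih := ih hl'
    rw [List.prod_cons, prodApprox, List.length_cons]
    generalize prodApprox M l = P at *
    generalize l.prod = p at *
    have h1 := abs_sqApprox_sub_sq_le M (x := (u + p) / 2) (abs_le.2 ⟨by linarith, by linarith⟩)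
    have h2 := abs_sqApprox_sub_sq_le M (x := (u - p) / 2) (abs_le.2 ⟨by linarith, by linarith⟩)
    have h3 := abs_sqApprox_sub_le M ((u + P) / 2) ((u + p) / 2)
    have h4 := abs_sqApprox_sub_le M ((u - P) / 2) ((u - p) / 2)
    rw [show (u + P) / 2 - (u + p) / 2 = (P - p) / 2 by ring, abs_div, abs_two] at h3
    rw [show (u - P) / 2 - (u - p) / 2 = -((P - p) / 2) by ring, abs_neg, abs_div, abs_two] at h4
    have e : (2 ^ (l.length + 1 + 1) - 2 : ℝ) / 4 ^ M =
        2 * ((2 ^ (l.length + 1) - 2) / 4 ^ M) + 2 * (1 / 4 ^ M) := by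
      rw [pow_succ]; ring
    rw [e]
    rw [abs_le] at h1 h2 h3 h4 ⊢
    constructor <;> nlinarith

/-- Each factor adds two applications of a 2-Lipschitz function to half-sums. Neither `M` nor the
size of the factors enters. -/
theorem abs_prodApprox_sub_le {X : Type*} (M : ℕ) (l : List (X → ℝ)) (x x' : X) {r : ℝ}
    (hr : 0 ≤ r) (hl : ∀ u ∈ l, |u x - u x'| ≤ r) :
    |prodApprox M (l.map fun u => u x) - prodApprox M (l.map fun u => u x')| ≤
      4 ^ l.length * r := by
  suffices h : |prodApprox M (l.map fun u => u x) - prodApprox M (l.map fun u => u x')| ≤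
      (4 ^ l.length - 1) * r from h.trans (by nlinarith)
  induction l with
  | nil => simp [prodApprox]
  | cons u l ih =>
    have ih := ih fun v hv => hl v (List.mem_cons_of_mem _ hv)
    have hu := hl u List.mem_cons_self
    rw [List.map_cons, List.map_cons, prodApprox, prodApprox, List.length_cons]
    generalize prodApprox M (l.map fun u => u x) = P at *
    generalize prodApprox M (l.map fun u => u x') = P' at *
    have h3 := abs_sqApprox_sub_le M ((u x + P) / 2) ((u x' + P') / 2)
    have h4 := abs_sqApprox_sub_le M ((u x - P) / 2) ((u x' - P') / 2)
    have g3 : |(u x + P) / 2 - (u x' + P') / 2| ≤ (|u x - u x'| + |P - P'|) / 2 := by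
      rw [show (u x + P) / 2 - (u x' + P') / 2 = ((u x - u x') + (P - P')) / 2 by ring, abs_div,
        abs_two]
      gcongr
      exact abs_add_le _ _
    have g4 : |(u x - P) / 2 - (u x' - P') / 2| ≤ (|u x - u x'| + |P - P'|) / 2 := by
      rw [show (u x - P) / 2 - (u x' - P') / 2 = ((u x - u x') - (P - P')) / 2 by ring, abs_div,
        abs_two]
      gcongr
      exact abs_sub _ _
    have e1 : (1 : ℝ) ≤ 4 ^ l.length := one_le_pow₀ (by norm_num)
    calc _ ≤ |sqApprox M ((u x + P) / 2) - sqApprox M ((u x' + P') / 2)| +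
          |sqApprox M ((u x - P) / 2) - sqApprox M ((u x' - P') / 2)| := by
          refine le_trans (le_of_eq ?_) (abs_sub _ _)
          congr 1; ring
      _ ≤ 2 * (r + (4 ^ l.length - 1) * r) := by linarith
      _ ≤ _ := by rw [pow_succ]; nlinarith

theorem abs_list_prod_sub_le {X : Type*} (l : List (X → ℝ)) (x x' : X) {r : ℝ}
    (hx : ∀ u ∈ l, |u x| ≤ 1) (hx' : ∀ u ∈ l, |u x'| ≤ 1) (hl : ∀ u ∈ l, |u x - u x'| ≤ r) :
    |(l.map fun u => u x).prod - (l.map fun u => u x').prod| ≤ l.length * r := by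
  induction l with
  | nil => simp
  | cons u l ih =>
    have ih := ih (fun v hv => hx v (List.mem_cons_of_mem _ hv))
      (fun v hv => hx' v (List.mem_cons_of_mem _ hv)) fun v hv => hl v (List.mem_cons_of_mem _ hv)
    have hp : |(l.map fun u => u x).prod| ≤ 1 := abs_list_prod_le (by
      intro v hv
      obtain ⟨f, hf, rfl⟩ := List.mem_map.1 hv
      exact hx f (List.mem_cons_of_mem _ hf))
    have h1 := hl u List.mem_cons_self
    have h2 := hx' u List.mem_cons_self
    simp only [List.map_cons, List.prod_cons, List.length_cons]
    generalize (l.map fun u => u x).prod = p at *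
    generalize (l.map fun u => u x').prod = p' at *
    rw [show u x * p - u x' * p' = (u x - u x') * p + u x' * (p - p') by ring]
    refine (abs_add_le _ _).trans ?_
    rw [abs_mul, abs_mul]
    push_cast
    nlinarith [abs_nonneg (u x - u x'), abs_nonneg (p - p')]

/-- The factors are multiplied in one after another, each padded until the product of the rest is
ready. Only the depth grows with `M`; the width is fixed before `M` and the list are chosen. -/
theorem exists_isNet_prodApprox (k w j : ℕ) : ∃ W : ℕ, ∀ (M : ℕ) (l : List ((Fin k → ℝ) → ℝ)),
    l.length = j → (∀ u ∈ l, IsNet k 2 w u) →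
      IsNet k (2 + j * (M + 2)) W fun x => prodApprox M (l.map fun u => u x) := by
  induction j with
  | zero =>
    refine ⟨max (k + 1) 2, fun M l hl _ => ?_⟩
    rw [List.length_eq_zero_iff] at hl
    subst hl
    simpa [prodApprox] using (IsNet.const k 1).pad 1
  | succ j ih =>
    obtain ⟨W, hW⟩ := ih
    refine ⟨max (max w 2 + W) 4 + max (max w 2 + W) 4, fun M l hl h => ?_⟩
    obtain ⟨u, l, rfl⟩ := List.exists_cons_of_length_eq_add_one hl
    have hP := hW M l (by simpa using hl) fun v hv => h v (List.mem_cons_of_mem _ hv)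
    have hu := (h u List.mem_cons_self).pad (j * (M + 2))
    have h1 := IsNet.postcomp (isNet_sqApprox M) ((hu.add hP).affine (1 / 2) 0)
    have h2 := IsNet.postcomp (isNet_sqApprox M) ((hu.add (hP.affine (-1) 0)).affine (1 / 2) 0)
    have h3 := h1.add (h2.affine (-1) 0)
    rw [show 2 + (j + 1) * (M + 2) = 2 + j * (M + 2) + (M + 2) by ring]
    convert h3 using 2 with x
    simp only [List.map_cons, prodApprox]
    ring_nf

/-! ### Iterated partial derivatives of smooth functions -/

/-- The space `ℝ^d` with the Euclidean norm. -/
abbrev Pt (d : ℕ) : Type := EuclideanSpace ℝ (Fin d)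

section Smooth

variable {d : ℕ}

theorem contDiff_partialDeriv {φ : Pt d → ℝ} (hφ : ContDiff ℝ ∞ φ) (i : Fin d) :
    ContDiff ℝ ∞ (partialDeriv i φ) :=
  (hφ.fderiv_right (m := ∞) (by simp)).clm_apply contDiff_const

theorem partialDeriv_comm {φ : Pt d → ℝ} (hφ : ContDiff ℝ ∞ φ) (i j : Fin d) :
    partialDeriv i (partialDeriv j φ) = partialDeriv j (partialDeriv i φ) := by
  have hd : Differentiable ℝ (fderiv ℝ φ) :=
    (hφ.fderiv_right (m := ∞) (by simp)).differentiable (by simp)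
  have key : ∀ (a b : Fin d) (x : Pt d), partialDeriv a (partialDeriv b φ) x =
      fderiv ℝ (fderiv ℝ φ) x (EuclideanSpace.single a 1) (EuclideanSpace.single b 1) := by
    intro a b x
    unfold partialDeriv
    rw [fderiv_clm_apply (hd x) (differentiableAt_const _)]
    simp
  ext x
  rw [key, key]
  exact second_derivative_symmetric (𝕜 := ℝ) (f := φ) (f' := fderiv ℝ φ)
    (fun y => ((hφ.differentiable (by simp)) y).hasFDerivAt) (hd x).hasFDerivAt _ _

/-- Induction along the partial derivatives that make up `D^α`, applied to two functions. -/
theorem multiDeriv_induction (P : ℕ → (Pt d → ℝ) → (Pt d → ℝ) → Prop)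
    (hP : ∀ k φ ψ i, P k φ ψ → P (k + 1) (partialDeriv i φ) (partialDeriv i ψ))
    (α : Fin d → ℕ) {φ ψ : Pt d → ℝ} (h : P 0 φ ψ) :
    P (∑ i, α i) (multiDeriv α φ) (multiDeriv α ψ) := by
  rw [Fin.sum_univ_def, multiDeriv, multiDeriv]
  induction List.finRange d with
  | nil => simpa using h
  | cons i l ih =>
    simp only [List.map_cons, List.sum_cons, List.foldr_cons]
    generalize (l.map α).sum = k at *
    generalize l.foldr (fun i ψ => (partialDeriv i)^[α i] ψ) φ = φ' at *
    generalize l.foldr (fun i ψ => (partialDeriv i)^[α i] ψ) ψ = ψ' at *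
    induction α i with
    | zero => simpa using ih
    | succ m ihm =>
      rw [Function.iterate_succ_apply', Function.iterate_succ_apply', add_right_comm]
      exact hP _ _ _ _ ihm

theorem multiDeriv_partialDeriv {φ : Pt d → ℝ} (hφ : ContDiff ℝ ∞ φ) (α : Fin d → ℕ) (i : Fin d) :
    multiDeriv α (partialDeriv i φ) = partialDeriv i (multiDeriv α φ) :=
  (multiDeriv_induction (fun _ φ ψ => ContDiff ℝ ∞ ψ ∧ φ = partialDeriv i ψ)
    (fun _ φ ψ j h => ⟨contDiff_partialDeriv h.1 j, by rw [h.2, partialDeriv_comm h.1]⟩) α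
    (ψ := φ) ⟨hφ, rfl⟩).2

theorem iterate_partialDeriv_comm {φ : Pt d → ℝ} (hφ : ContDiff ℝ ∞ φ) (i j : Fin d) (m : ℕ) :
    ContDiff ℝ ∞ ((partialDeriv j)^[m] φ) ∧
    (partialDeriv j)^[m] (partialDeriv i φ) = partialDeriv i ((partialDeriv j)^[m] φ) := by
  induction m with
  | zero => exact ⟨hφ, rfl⟩
  | succ m ih =>
    rw [Function.iterate_succ_apply', Function.iterate_succ_apply', ih.2,
      partialDeriv_comm ih.1]
    exact ⟨contDiff_partialDeriv ih.1 _, rfl⟩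

/-- `multiDeriv` differentiates in a fixed order, so the additional derivative has to be commuted
past the others. In a list without repetitions it enters exactly once. -/
theorem multiDeriv_add_single {φ : Pt d → ℝ} (hφ : ContDiff ℝ ∞ φ) (α : Fin d → ℕ) (i : Fin d) :
    multiDeriv (α + Pi.single i 1) φ = partialDeriv i (multiDeriv α φ) := by
  have key : ∀ l : List (Fin d), l.Nodup →
      ContDiff ℝ ∞ (l.foldr (fun i ψ => (partialDeriv i)^[α i] ψ) φ) ∧
      l.foldr (fun j ψ => (partialDeriv j)^[(α + Pi.single i 1 : Fin d → ℕ) j] ψ) φ =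
        if i ∈ l then partialDeriv i (l.foldr (fun i ψ => (partialDeriv i)^[α i] ψ) φ)
        else l.foldr (fun i ψ => (partialDeriv i)^[α i] ψ) φ := by
    intro l hl
    induction l with
    | nil => simpa using hφ
    | cons j l ih =>
      obtain ⟨hj, hl⟩ := List.nodup_cons.1 hl
      obtain ⟨ih1, ih2⟩ := ih hl
      simp only [List.foldr_cons, ih2]
      generalize l.foldr (fun i ψ => (partialDeriv i)^[α i] ψ) φ = φ' at *
      refine ⟨(iterate_partialDeriv_comm ih1 i j _).1, ?_⟩
      by_cases hij : i = j
      · subst hij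
        simp only [hj, if_false, List.mem_cons, true_or, if_true, Pi.add_apply, Pi.single_eq_same]
        rw [Function.iterate_succ_apply']
      · simp only [List.mem_cons, hij, false_or, Pi.add_apply, Pi.single_eq_of_ne' hij, add_zero]
        split_ifs with h
        · exact (iterate_partialDeriv_comm ih1 i j _).2
        · rfl
  have h := (key (List.finRange d) (List.nodup_finRange d)).2
  rw [if_pos (List.mem_finRange i)] at h
  exact h

/-- All partial derivatives of `F` of order at most `n` are bounded by `B` on `K`. -/
def DerivBdd (K : Set (Pt d)) (B : ℝ) : ℕ → (Pt d → ℝ) → Prop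
  | 0, F => ∀ x ∈ K, |F x| ≤ B
  | n + 1, F => (∀ x ∈ K, |F x| ≤ B) ∧ ∀ i, DerivBdd K B n (partialDeriv i F)

theorem DerivBdd.abs_le {K : Set (Pt d)} {B : ℝ} {n : ℕ} {F : Pt d → ℝ} (h : DerivBdd K B n F)
    {x : Pt d} (hx : x ∈ K) : |F x| ≤ B := by
  cases n with
  | zero => exact h x hx
  | succ n => exact h.1 x hx

theorem multiDeriv_zero (F : Pt d → ℝ) : multiDeriv (0 : Fin d → ℕ) F = F := by
  unfold multiDeriv
  induction List.finRange d with
  | nil => rfl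
  | cons i l ih => rw [List.foldr_cons, ih]; rfl

/-- Multi-indices suit weak derivatives; the recursive form suits inductions on the order, where `F`
is replaced by its partial derivatives. -/
theorem derivBdd_of_multiDeriv {K : Set (Pt d)} {B : ℝ} {n : ℕ} {F : Pt d → ℝ}
    (hF : ContDiff ℝ ∞ F) (h : ∀ α : Fin d → ℕ, ∑ i, α i ≤ n → ∀ x ∈ K, |multiDeriv α F x| ≤ B) :
    DerivBdd K B n F := by
  have h0 : ∀ x ∈ K, |F x| ≤ B := fun x hx => by
    simpa only [multiDeriv_zero] using h 0 (by simp) x hx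
  induction n generalizing F with
  | zero => exact h0
  | succ n ih =>
    have h1 : ∀ i, ∀ α : Fin d → ℕ, ∑ i, α i ≤ n → ∀ x ∈ K,
        |multiDeriv α (partialDeriv i F) x| ≤ B := fun i α hα x hx => by
      rw [multiDeriv_partialDeriv hF, ← multiDeriv_add_single hF]
      refine h _ ?_ x hx
      simp only [Pi.add_apply, Finset.sum_add_distrib, Finset.sum_pi_single', Finset.mem_univ,
        if_true]
      omega
    exact ⟨h0, fun i => ih (contDiff_partialDeriv hF i) (h1 i) fun x hx => by
      simpa only [multiDeriv_zero] using h1 i 0 (by simp) x hx⟩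

theorem norm_fderiv_le {F : Pt d → ℝ} {x : Pt d} {b : ℝ} (h : ∀ i, |partialDeriv i F x| ≤ b)
    (hb : 0 ≤ b) : ‖fderiv ℝ F x‖ ≤ d * b := by
  refine ContinuousLinearMap.opNorm_le_bound _ (by positivity) fun v => ?_
  have hv : v = ∑ i, v i • EuclideanSpace.single i (1 : ℝ) := by
    ext j
    simp [Finset.sum_apply, Pi.single_apply]
  conv_lhs => rw [hv, map_sum]
  refine (norm_sum_le _ _).trans ?_
  calc ∑ i, ‖fderiv ℝ F x (v i • EuclideanSpace.single i (1 : ℝ))‖ ≤ ∑ _i : Fin d, b * ‖v‖ := by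
        refine Finset.sum_le_sum fun i _ => ?_
        rw [map_smul, norm_smul, mul_comm]
        exact mul_le_mul (h i) (PiLp.norm_apply_le v i) (norm_nonneg _) hb
    _ = d * b * ‖v‖ := by simp [mul_assoc]

theorem abs_sub_le_of_partialDeriv {K : Set (Pt d)} (hK : Convex ℝ K) {F : Pt d → ℝ}
    (hF : ContDiff ℝ ∞ F) {b : ℝ} (hb : 0 ≤ b) (h : ∀ i, ∀ x ∈ K, |partialDeriv i F x| ≤ b)
    {x y : Pt d} (hx : x ∈ K) (hy : y ∈ K) : |F x - F y| ≤ d * b * ‖x - y‖ :=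
  hK.norm_image_sub_le_of_norm_fderiv_le (𝕜 := ℝ)
    (fun z _ => (hF.differentiable (by simp)) z)
    (fun z hz => norm_fderiv_le (fun i => h i z hz) hb) hy hx

end Smooth

/-! ### Mollification of functions with bounded weak derivatives -/

section Mollify

open Convolution ContinuousLinearMap Filter Topology

variable {d : ℕ}

/-- The cube `(t, 1 - t)^d`. -/
def shrunkCube (d : ℕ) (t : ℝ) : Set (Pt d) := {x | ∀ i, t < x i ∧ x i < 1 - t}

theorem convex_shrunkCube (d : ℕ) (t : ℝ) : Convex ℝ (shrunkCube d t) := by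
  have : shrunkCube d t = ⋂ i, {x : Pt d | x i ∈ Set.Ioo t (1 - t)} := by
    ext x; simp [shrunkCube]
  rw [this]
  exact convex_iInter fun i => (convex_Ioo t (1 - t)).is_linear_preimage
    ⟨fun _ _ => rfl, fun _ _ => rfl⟩

theorem isOpen_cube (d : ℕ) : IsOpen (cube d) := by
  have : cube d = ⋂ i, {x : Pt d | x i ∈ Set.Ioo (0 : ℝ) 1} := by
    ext x; simp [cube]
  rw [this]
  exact isOpen_iInter_of_finite fun i =>
    isOpen_Ioo.preimage (by fun_prop : Continuous fun x : Pt d => x i)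

theorem abs_apply_sub_le (x y : Pt d) (i : Fin d) : |x i - y i| ≤ ‖x - y‖ :=
  PiLp.norm_apply_le (x - y) i

theorem closedBall_subset_cube {t r : ℝ} (hr : r ≤ t) {x : Pt d} (hx : x ∈ shrunkCube d t) :
    Metric.closedBall x r ⊆ cube d := by
  intro y hy i
  have h1 := abs_le.1 ((abs_apply_sub_le y x i).trans (mem_closedBall_iff_norm.1 hy))
  have h2 := hx i
  constructor <;> linarith

theorem partialDeriv_convolution {h ρ : Pt d → ℝ} (hh : LocallyIntegrable h)
    (hρ : ContDiff ℝ ∞ ρ) (hc : HasCompactSupport ρ) (i : Fin d) :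
    partialDeriv i (h ⋆[lsmul ℝ ℝ, volume] ρ) = h ⋆[lsmul ℝ ℝ, volume] partialDeriv i ρ := by
  ext x
  have hρ1 : ContDiff ℝ 1 ρ := hρ.of_le (by simp)
  rw [partialDeriv, (hc.hasFDerivAt_convolution_right (lsmul ℝ ℝ) hh hρ1 x).fderiv,
    convolution_precompR_apply _ hh (hc.fderiv ℝ) (hρ1.continuous_fderiv one_ne_zero)]
  rfl

theorem tsupport_partialDeriv_subset (φ : Pt d → ℝ) (i : Fin d) :
    tsupport (partialDeriv i φ) ⊆ tsupport φ :=
  (closure_mono fun x hx => by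
    contrapose! hx
    rw [Function.notMem_support] at hx ⊢
    rw [partialDeriv, hx]; rfl).trans (tsupport_fderiv_subset ℝ)

theorem multiDeriv_convolution {h ρ : Pt d → ℝ} (hh : LocallyIntegrable h)
    (hρ : ContDiff ℝ ∞ ρ) (hc : HasCompactSupport ρ) (α : Fin d → ℕ) :
    multiDeriv α (h ⋆[lsmul ℝ ℝ, volume] ρ) = h ⋆[lsmul ℝ ℝ, volume] multiDeriv α ρ :=
  (multiDeriv_induction (fun _ φ ψ => ContDiff ℝ ∞ ψ ∧ HasCompactSupport ψ ∧
    φ = h ⋆[lsmul ℝ ℝ, volume] ψ) (fun _ φ ψ j g => ⟨contDiff_partialDeriv g.1 j,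
      g.2.1.mono' (subset_closure.trans (tsupport_partialDeriv_subset ψ j)), by
        rw [g.2.2, partialDeriv_convolution hh g.1 g.2.1]⟩) α ⟨hρ, hc, rfl⟩).2.2

theorem tsupport_multiDeriv_subset (φ : Pt d → ℝ) (α : Fin d → ℕ) :
    tsupport (multiDeriv α φ) ⊆ tsupport φ :=
  multiDeriv_induction (fun _ ψ _ => tsupport ψ ⊆ tsupport φ)
    (fun _ ψ _ i h => (tsupport_partialDeriv_subset ψ i).trans h) α (ψ := φ) subset_rfl

theorem partialDeriv_const_mul_comp_affine (F : Pt d → ℝ) (a c : ℝ) (v : Pt d) (i : Fin d)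
    (x : Pt d) : partialDeriv i (fun x => a * F (c • x + v)) x =
      a * c * partialDeriv i F (c • x + v) := by
  have e : (fun x => a * F (c • x + v)) = a • fun x => (fun z => F (z + v)) (c • x) := rfl
  have h : fderiv ℝ (fun x => (fun z => F (z + v)) (c • x)) x = c • fderiv ℝ F (c • x + v) := by
    rw [fderiv_comp_smul (f := fun z => F (z + v)), fderiv_comp_add_right]
  rw [partialDeriv, e, fderiv_const_smul_field, Pi.smul_apply, h]
  simp [partialDeriv, mul_assoc]

theorem multiDeriv_comp_sub (ρ : Pt d → ℝ) (x : Pt d) (α : Fin d → ℕ) (y : Pt d) :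
    multiDeriv α (fun y => ρ (x - y)) y = (-1) ^ (∑ i, α i) * multiDeriv α ρ (x - y) := by
  refine congrFun (multiDeriv_induction
    (fun k φ ψ => φ = fun y => (-1) ^ k * ψ (x - y)) (fun k φ ψ i h => ?_) α (ψ := ρ) ?_) y
  · ext y
    subst h
    have := partialDeriv_const_mul_comp_affine ψ ((-1) ^ k) (-1) x i y
    simp only [neg_smul, one_smul, neg_add_eq_sub] at this
    rw [this, pow_succ]
  · ext y; simp

/-- As the ball lies in the cube, the reflected and translated mollifier is an admissible test
function. The derivative therefore moves onto `h`, and the value is an average of `g` against a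
probability density. -/
theorem abs_multiDeriv_convolution_le {h g : Pt d → ℝ} (hh : LocallyIntegrable h) {α : Fin d → ℕ}
    (hg : IsWeakDeriv α h g) {B : ℝ} (hB : 0 ≤ B) (hgB : ∀ᵐ y ∂(cubeMeasure d), |g y| ≤ B)
    (b : ContDiffBump (0 : Pt d)) {x : Pt d} (hx : Metric.closedBall x b.rOut ⊆ cube d) :
    |multiDeriv α (h ⋆[lsmul ℝ ℝ, volume] b.normed volume) x| ≤ B := by
  have hρ : ContDiff ℝ ∞ (b.normed volume) := b.contDiff_normed
  have hts : ∀ ψ : Pt d → ℝ, tsupport ψ ⊆ tsupport (b.normed volume) → ∀ y, ψ (x - y) ≠ 0 →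
      y ∈ Metric.closedBall x b.rOut := by
    intro ψ hψ y hy
    have := hψ (subset_tsupport _ (Function.mem_support.2 hy))
    rw [b.tsupport_normed_eq] at this
    rw [Metric.mem_closedBall, dist_comm, dist_eq_norm]
    simpa using this
  have hsup : tsupport (fun y => b.normed volume (x - y)) ⊆ Metric.closedBall x b.rOut :=
    closure_minimal (fun y hy => hts _ subset_rfl y hy) Metric.isClosed_closedBall
  have hw := hg (fun y => b.normed volume (x - y)) (hρ.comp (contDiff_const.sub contDiff_id))
    ((isCompact_closedBall x b.rOut).of_isClosed_subset (isClosed_tsupport _) hsup)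
    (hsup.trans hx)
  have e : multiDeriv α (h ⋆[lsmul ℝ ℝ, volume] b.normed volume) x =
      ∫ y, g y * b.normed volume (x - y) ∂(cubeMeasure d) := by
    rw [multiDeriv_convolution hh hρ b.hasCompactSupport_normed, convolution_def]
    have h1 : ∫ t, lsmul ℝ ℝ (h t) (multiDeriv α (b.normed volume) (x - t)) =
        ∫ t, lsmul ℝ ℝ (h t) (multiDeriv α (b.normed volume) (x - t)) ∂(cubeMeasure d) := by
      refine (setIntegral_eq_integral_of_forall_compl_eq_zero fun y hy => ?_).symm
      have : multiDeriv α (b.normed volume) (x - y) = 0 := by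
        by_contra hne
        exact hy (hx (hts _ (tsupport_multiDeriv_subset _ α) y hne))
      simp [this]
    rw [h1]
    simp only [multiDeriv_comp_sub, lsmul_apply, smul_eq_mul] at hw ⊢
    simp only [mul_left_comm (h _), integral_const_mul] at hw
    -- The sign from differentiating `ρ (x - ·)` cancels the one in the definition of the weak
    -- derivative.
    have hs : ((-1 : ℝ) ^ (∑ i, α i)) ≠ 0 := by positivity
    exact mul_left_cancel₀ hs hw
  have hInt : Integrable (fun y => b.normed volume (x - y)) :=
    b.integrable_normed.comp_sub_left x
  rw [e]
  calc |∫ y, g y * b.normed volume (x - y) ∂(cubeMeasure d)|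
      ≤ ∫ y, B * b.normed volume (x - y) ∂(cubeMeasure d) := by
        rw [← Real.norm_eq_abs]
        refine norm_integral_le_of_norm_le (hInt.restrict.const_mul B) ?_
        filter_upwards [hgB] with y hy
        rw [Real.norm_eq_abs, abs_mul, abs_of_nonneg (b.nonneg_normed _)]
        exact mul_le_mul_of_nonneg_right hy (b.nonneg_normed _)
    _ ≤ ∫ y, B * b.normed volume (x - y) :=
        setIntegral_le_integral (hInt.const_mul B)
          (Eventually.of_forall fun y => mul_nonneg hB (b.nonneg_normed _))
    _ = B := by
        rw [integral_const_mul, integral_sub_left_eq_self (b.normed volume) volume x,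
          b.integral_normed, mul_one]

/-- `f` has weak derivatives on the cube up to order `n`, bounded by `B`. -/
def WeakDerivBdd (n : ℕ) (B : ℝ) (f : Pt d → ℝ) : Prop :=
  ∀ α : Fin d → ℕ, ∑ i, α i ≤ n → ∃ g, IsWeakDeriv α f g ∧ ∀ᵐ y ∂(cubeMeasure d), |g y| ≤ B

/-- Membership excludes the default value 0 of `weakDeriv`, so the norm does bound a genuine weak
derivative. -/
theorem weakDerivBdd_of_memSobolev {n : ℕ} {B : ℝ} (hB : 0 ≤ B) {f : Pt d → ℝ}
    (h : MemSobolev n ∞ f) (hf : sobolevNorm n f ≤ ENNReal.ofReal B) : WeakDerivBdd n B f := by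
  intro α hα
  have hex := h.2 α hα
  have hw : IsWeakDeriv α f (weakDeriv α f) := by
    rw [weakDeriv, dif_pos hex]
    exact hex.choose_spec.2
  refine ⟨weakDeriv α f, hw, ?_⟩
  have hle : eLpNorm (weakDeriv α f) ∞ (cubeMeasure d) ≤ ENNReal.ofReal B :=
    (le_iSup₂ (f := fun (α : Fin d → ℕ) (_ : ∑ i, α i ≤ n) =>
      eLpNorm (weakDeriv α f) ∞ (cubeMeasure d)) α hα).trans hf
  rw [eLpNorm_exponent_top] at hle
  filter_upwards [ae_le_eLpNormEssSup (f := weakDeriv α f) (μ := cubeMeasure d)] with y hy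
  have := hy.trans hle
  rw [← ofReal_norm, ENNReal.ofReal_le_ofReal_iff hB] at this
  exact this

theorem WeakDerivBdd.congr {n : ℕ} {B : ℝ} {f f' : Pt d → ℝ} (h : WeakDerivBdd n B f)
    (hff' : f =ᵐ[cubeMeasure d] f') : WeakDerivBdd n B f' := by
  intro α hα
  obtain ⟨g, hg, hgB⟩ := h α hα
  refine ⟨g, fun φ h1 h2 h3 => ?_, hgB⟩
  rw [← hg φ h1 h2 h3]
  refine integral_congr_ae ?_
  filter_upwards [hff'] with x hx
  rw [hx]

theorem WeakDerivBdd.derivBdd_convolution {n : ℕ} {B : ℝ} (hB : 0 ≤ B) {f : Pt d → ℝ}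
    (h : WeakDerivBdd n B f) (hf : LocallyIntegrable f) (b : ContDiffBump (0 : Pt d)) {t : ℝ}
    (ht : b.rOut ≤ t) :
    DerivBdd (shrunkCube d t) B n (f ⋆[lsmul ℝ ℝ, volume] b.normed volume) := by
  refine derivBdd_of_multiDeriv
    (b.hasCompactSupport_normed.contDiff_convolution_right _ hf b.contDiff_normed)
    fun α hα x hx => ?_
  obtain ⟨g, hg, hgB⟩ := h α hα
  exact abs_multiDeriv_convolution_le hf hg hB hgB b (closedBall_subset_cube ht hx)

theorem convolution_lsmul_comm (f ρ : Pt d → ℝ) :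
    ρ ⋆[lsmul ℝ ℝ, volume] f = f ⋆[lsmul ℝ ℝ, volume] ρ := by
  ext x
  rw [convolution_lsmul_swap, convolution_def]
  simp [mul_comm]

instance isFiniteMeasure_cubeMeasure : IsFiniteMeasure (cubeMeasure d) := by
  refine ⟨?_⟩
  rw [cubeMeasure, Measure.restrict_apply_univ]
  refine (measure_mono (t := Metric.closedBall (0 : Pt d) (√d)) fun x hx => ?_).trans_lt
    measure_closedBall_lt_top
  rw [mem_closedBall_zero_iff, EuclideanSpace.norm_eq]
  refine Real.sqrt_le_sqrt ?_
  calc ∑ i, ‖x i‖ ^ 2 ≤ ∑ _i : Fin d, (1 : ℝ) := Finset.sum_le_sum fun i _ => by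
        have := hx i
        rw [Real.norm_eq_abs, abs_of_pos this.1]
        exact pow_le_one₀ this.1.le this.2.le
    _ = d := by simp

theorem measurableSet_cube : MeasurableSet (cube d) := (isOpen_cube d).measurableSet

/-- A function with bounded weak derivatives of first order is almost everywhere on the cube equal
to a bounded Lipschitz function. -/
theorem WeakDerivBdd.exists_lipschitz {n : ℕ} (hn : 0 < n) {B : ℝ} (hB : 0 ≤ B) {f : Pt d → ℝ}
    (hf : MemLp f ∞ (cubeMeasure d)) (h : WeakDerivBdd n B f) :
    ∃ f' : Pt d → ℝ, f =ᵐ[cubeMeasure d] f' ∧ (∀ x y, |f' x - f' y| ≤ d * B * ‖x - y‖) := by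
  set f₀ : Pt d → ℝ := (cube d).indicator f with hf₀
  have hff₀ : f =ᵐ[cubeMeasure d] f₀ := (indicator_ae_eq_restrict measurableSet_cube).symm
  have hInt : Integrable f₀ := by
    rw [hf₀, integrable_indicator_iff measurableSet_cube]
    exact hf.integrable le_top
  have h₀ := h.congr hff₀
  let b : ℕ → ContDiffBump (0 : Pt d) := fun k =>
    -- A bounded ratio of the radii is required for almost everywhere convergence.
    ⟨1 / (k + 1) / 2, 1 / (k + 1), by positivity, half_lt_self (by positivity)⟩
  have hb : Tendsto (fun k => (b k).rOut) atTop (𝓝 0) := tendsto_one_div_add_atTop_nhds_zero_nat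
  have hae := ContDiffBump.ae_convolution_tendsto_right_of_locallyIntegrable (K := 2) hb
    (Eventually.of_forall fun k => by simp only [b]; linarith) hInt.locallyIntegrable
  -- On the points of convergence the Lipschitz bound of the mollifications, uniform in `k`, passes
  -- to the limit. `T` is of full measure in the cube, and the function is then extended from it.
  set T : Set (Pt d) := {x | x ∈ cube d ∧ Tendsto (fun k =>
    ((b k).normed volume ⋆[lsmul ℝ ℝ, volume] f₀) x) atTop (𝓝 (f₀ x))} with hT
  have hshr : ∀ x ∈ cube d, ∀ᶠ k in atTop, x ∈ shrunkCube d (b k).rOut := by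
    intro x hx
    simp only [shrunkCube, Set.mem_ofPred_eq, eventually_all]
    intro i
    filter_upwards [hb.eventually (gt_mem_nhds (hx i).1),
      hb.eventually (gt_mem_nhds (sub_pos.2 (hx i).2))] with k h1 h2
    exact ⟨h1, by linarith⟩
  have hLip : LipschitzOnWith (d * B).toNNReal f₀ T := by
    refine LipschitzOnWith.of_dist_le_mul fun x hx y hy => ?_
    rw [Real.coe_toNNReal _ (by positivity), dist_eq_norm x y]
    refine le_of_tendsto (hx.2.dist hy.2) ?_
    filter_upwards [hshr x hx.1, hshr y hy.1] with k hxk hyk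
    rw [Real.dist_eq, convolution_lsmul_comm]
    have hD := h₀.derivBdd_convolution hB hInt.locallyIntegrable (b k) le_rfl
    obtain ⟨m, rfl⟩ := Nat.exists_eq_succ_of_ne_zero hn.ne'
    exact abs_sub_le_of_partialDeriv (convex_shrunkCube d _)
      ((b k).hasCompactSupport_normed.contDiff_convolution_right _ hInt.locallyIntegrable
        (b k).contDiff_normed) hB (fun i z hz => (hD.2 i).abs_le hz) hxk hyk
  obtain ⟨f', hf', heq⟩ := hLip.extend_real
  refine ⟨f', hff₀.trans ?_, fun x y => ?_⟩
  · rw [EventuallyEq, cubeMeasure, ae_restrict_iff' measurableSet_cube]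
    filter_upwards [hae] with x hx hxc
    exact heq ⟨hxc, hx⟩
  · have := hf'.dist_le_mul x y
    rwa [Real.coe_toNNReal _ (by positivity), dist_eq_norm x y, Real.dist_eq] at this

/-- The chain rule only produces powers of `c`, of modulus at most 1; the prefactor `a` collects
them during the induction. -/
theorem DerivBdd.const_mul_comp_affine {K K' : Set (Pt d)} {B : ℝ} {n : ℕ} {F : Pt d → ℝ}
    (h : DerivBdd K B n F) {a c : ℝ} (ha : |a| ≤ 1) (hc : |c| ≤ 1) {v : Pt d}
    (hv : ∀ x ∈ K', c • x + v ∈ K) : DerivBdd K' B n fun x => a * F (c • x + v) := by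
  have h0 : ∀ x ∈ K', |a * F (c • x + v)| ≤ B := fun x hx => by
    rw [abs_mul]
    exact (mul_le_of_le_one_left (abs_nonneg _) ha).trans (h.abs_le (hv x hx))
  induction n generalizing F a with
  | zero => exact h0
  | succ n ih =>
    refine ⟨h0, fun i => ?_⟩
    have hac : |a * c| ≤ 1 := by
      rw [abs_mul]; exact mul_le_one₀ ha (abs_nonneg _) hc
    rw [funext (partialDeriv_const_mul_comp_affine F a c v i)]
    refine ih (h.2 i) hac fun x hx => ?_
    rw [abs_mul]
    exact (mul_le_of_le_one_left (abs_nonneg _) hac).trans ((h.2 i).abs_le (hv x hx))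

/-- The closed unit cube. -/
def closedCube (d : ℕ) : Set (Pt d) := {x | ∀ i, 0 ≤ x i ∧ x i ≤ 1}

theorem convex_closedCube (d : ℕ) : Convex ℝ (closedCube d) := by
  have : closedCube d = ⋂ i, {x : Pt d | x i ∈ Set.Icc (0 : ℝ) 1} := by
    ext x; simp [closedCube]
  rw [this]
  exact convex_iInter fun i => (convex_Icc (0 : ℝ) 1).is_linear_preimage
    ⟨fun _ _ => rfl, fun _ _ => rfl⟩

theorem norm_le_of_abs_apply_le {v : Pt d} {b : ℝ} (hv : ∀ i, |v i| ≤ b) : ‖v‖ ≤ d * b := by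
  have e : v = ∑ i, v i • EuclideanSpace.single i (1 : ℝ) := by
    ext j
    simp [Finset.sum_apply, Pi.single_apply]
  rw [e]
  refine (norm_sum_le _ _).trans ?_
  calc ∑ i, ‖v i • EuclideanSpace.single i (1 : ℝ)‖ ≤ ∑ _i : Fin d, b :=
        Finset.sum_le_sum fun i _ => by simpa [norm_smul] using hv i
    _ = d * b := by simp

/-- A Lipschitz function with bounded weak derivatives is on the cube uniformly close to smooth
functions with the same bounds of the derivatives. -/
theorem WeakDerivBdd.exists_smooth_approx {n : ℕ} {B Λ : ℝ} (hB : 0 ≤ B) (hΛ : 0 ≤ Λ)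
    {f : Pt d → ℝ} (h : WeakDerivBdd n B f) (hf : ∀ x y, |f x - f y| ≤ Λ * ‖x - y‖) {δ : ℝ}
    (hδ : 0 < δ) : ∃ F : Pt d → ℝ, ContDiff ℝ ∞ F ∧ DerivBdd (closedCube d) B n F ∧
      ∀ x ∈ closedCube d, |F x - f x| ≤ δ := by
  have hcont : Continuous f := by
    refine (LipschitzWith.of_dist_le_mul (K := Λ.toNNReal) fun x y => ?_).continuous
    rw [Real.coe_toNNReal _ hΛ, Real.dist_eq, dist_eq_norm x y]
    exact hf x y
  -- Mollification at radius `t` costs `Λ t`. It keeps the derivative bounds only at distance `t`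
  -- from the boundary, so it is composed with the contraction `x ↦ (1 - 4 t) x + 2 t` of the closed
  -- cube into the shrunken one. This moves each coordinate by at most `2 t` and costs `2 d Λ t`.
  obtain ⟨t, ht, ht8, htδ⟩ : ∃ t : ℝ, 0 < t ∧ t ≤ 1 / 8 ∧ Λ * (1 + 2 * d) * t ≤ δ := by
    have hp : 0 < Λ * (1 + 2 * d) + 1 := by positivity
    refine ⟨min (1 / 8) (δ / (Λ * (1 + 2 * d) + 1)), by positivity, min_le_left _ _, ?_⟩
    calc Λ * (1 + 2 * d) * min (1 / 8) (δ / (Λ * (1 + 2 * d) + 1))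
        ≤ (Λ * (1 + 2 * d) + 1) * (δ / (Λ * (1 + 2 * d) + 1)) :=
          mul_le_mul (by linarith) (min_le_right _ _) (by positivity) hp.le
      _ = δ := by field_simp
  let b : ContDiffBump (0 : Pt d) := ⟨t / 2, t, by positivity, half_lt_self ht⟩
  let v : Pt d := WithLp.toLp 2 fun _ => 2 * t
  have hsm : ContDiff ℝ ∞ (f ⋆[lsmul ℝ ℝ, volume] b.normed volume) :=
    b.hasCompactSupport_normed.contDiff_convolution_right _ hcont.locallyIntegrable
      b.contDiff_normed
  have hmap : ∀ x ∈ closedCube d, (1 - 4 * t) • x + v ∈ shrunkCube d t := by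
    intro x hx i
    obtain ⟨h0, h1⟩ := hx i
    have e : ((1 - 4 * t) • x + v) i = (1 - 4 * t) * x i + 2 * t := rfl
    rw [e]
    constructor <;> nlinarith
  refine ⟨fun x => 1 * (f ⋆[lsmul ℝ ℝ, volume] b.normed volume) ((1 - 4 * t) • x + v), ?_, ?_, ?_⟩
  · exact contDiff_const.mul
      (hsm.comp ((contDiff_id.const_smul (1 - 4 * t)).add contDiff_const))
  · refine (h.derivBdd_convolution hB hcont.locallyIntegrable b (t := t) le_rfl).const_mul_comp_affine
      (by simp) ?_ hmap
    rw [abs_le]; constructor <;> linarith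
  · intro x hx
    set z := (1 - 4 * t) • x + v with hz
    have h1 : |(f ⋆[lsmul ℝ ℝ, volume] b.normed volume) z - f z| ≤ Λ * t := by
      rw [← convolution_lsmul_comm, ← Real.dist_eq]
      refine ContDiffBump.dist_normed_convolution_le hcont.aestronglyMeasurable fun y hy => ?_
      rw [Real.dist_eq]
      refine (hf y z).trans (mul_le_mul_of_nonneg_left ?_ hΛ)
      rw [← dist_eq_norm]
      exact (Metric.mem_ball.1 hy).le
    have h2 : |f z - f x| ≤ Λ * (d * (2 * t)) := by
      refine (hf z x).trans (mul_le_mul_of_nonneg_left (norm_le_of_abs_apply_le fun i => ?_) hΛ)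
      have e : (z - x) i = (1 - 4 * t) * x i + 2 * t - x i := rfl
      obtain ⟨h0, h1⟩ := hx i
      rw [e, abs_le]
      constructor <;> nlinarith
    simp only [one_mul, ← hz]
    calc _ ≤ |(f ⋆[lsmul ℝ ℝ, volume] b.normed volume) z - f z| + |f z - f x| :=
          abs_sub_le _ _ _
      _ ≤ Λ * (1 + 2 * d) * t := by linarith
      _ ≤ δ := htδ

end Mollify

/-! ### Taylor polynomials -/

section Taylor

variable {d : ℕ}

/-- The form `v ↦ (v · ∇)^k F (x₀)`. -/
def taylorForm (x₀ : Pt d) : ℕ → (Pt d → ℝ) → Pt d → ℝ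
  | 0, F, _ => F x₀
  | k + 1, F, v => ∑ i, v i * taylorForm x₀ k (partialDeriv i F) v

/-- The Taylor polynomial of degree less than `n` at `x₀`, as a function of the increment. -/
def taylorPoly (x₀ : Pt d) (n : ℕ) (F : Pt d → ℝ) (v : Pt d) : ℝ :=
  ∑ k ∈ Finset.range n, taylorForm x₀ k F v / k.factorial

/-- The remainder of the Taylor expansion at `x₀`. -/
def taylorRem (x₀ : Pt d) (n : ℕ) (F : Pt d → ℝ) (x : Pt d) : ℝ :=
  F x - taylorPoly x₀ n F (x - x₀)

theorem contDiff_taylorForm (x₀ : Pt d) (k : ℕ) (F : Pt d → ℝ) :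
    ContDiff ℝ ∞ (taylorForm x₀ k F) := by
  induction k generalizing F with
  | zero => exact contDiff_const
  | succ k ih =>
    refine ContDiff.sum fun i _ => ContDiff.mul ?_ (ih _)
    exact (EuclideanSpace.proj (𝕜 := ℝ) i).contDiff

theorem partialDeriv_sum_coord_mul {g : Fin d → Pt d → ℝ} (hg : ∀ j, ContDiff ℝ ∞ (g j))
    (i : Fin d) (v : Pt d) : partialDeriv i (fun v => ∑ j, v j * g j v) v =
      g i v + ∑ j, v j * partialDeriv i (g j) v := by
  have h : HasFDerivAt (fun v : Pt d => ∑ j, v j * g j v)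
      (∑ j, (v j • fderiv ℝ (g j) v + g j v • EuclideanSpace.proj (𝕜 := ℝ) j)) v := by
    refine HasFDerivAt.fun_sum fun j _ => ?_
    exact (EuclideanSpace.proj (𝕜 := ℝ) j).hasFDerivAt.mul
      (((hg j).differentiable (by simp)) v).hasFDerivAt
  rw [partialDeriv, h.fderiv]
  simp [Finset.sum_add_distrib, partialDeriv, add_comm]

/-- By the product rule, one copy comes from the outer coordinate and the others from the induction
hypothesis, after exchanging two partial derivatives. -/
theorem partialDeriv_taylorForm (x₀ : Pt d) (k : ℕ) {F : Pt d → ℝ} (hF : ContDiff ℝ ∞ F)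
    (i : Fin d) (v : Pt d) : partialDeriv i (taylorForm x₀ (k + 1) F) v =
      (k + 1) * taylorForm x₀ k (partialDeriv i F) v := by
  induction k generalizing F with
  | zero =>
    refine (partialDeriv_sum_coord_mul (fun j => contDiff_taylorForm x₀ 0 _) i v).trans ?_
    simp [taylorForm, partialDeriv]
  | succ k ih =>
    refine (partialDeriv_sum_coord_mul (fun j => contDiff_taylorForm x₀ (k + 1) _) i v).trans ?_
    have : ∀ j, v j * partialDeriv i (taylorForm x₀ (k + 1) (partialDeriv j F)) v =
        (k + 1) * (v j * taylorForm x₀ k (partialDeriv j (partialDeriv i F)) v) := fun j => by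
      rw [ih (contDiff_partialDeriv hF j), partialDeriv_comm hF i j]; ring
    rw [Finset.sum_congr rfl fun j _ => this j, ← Finset.mul_sum]
    change _ + _ * taylorForm x₀ (k + 1) (partialDeriv i F) v = _
    push_cast; ring

theorem contDiff_taylorPoly (x₀ : Pt d) (n : ℕ) (F : Pt d → ℝ) :
    ContDiff ℝ ∞ (taylorPoly x₀ n F) :=
  ContDiff.sum fun k _ => (contDiff_taylorForm x₀ k F).div_const _

theorem contDiff_taylorRem (x₀ : Pt d) (n : ℕ) {F : Pt d → ℝ} (hF : ContDiff ℝ ∞ F) :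
    ContDiff ℝ ∞ (taylorRem x₀ n F) :=
  hF.sub ((contDiff_taylorPoly x₀ n F).comp (contDiff_id.sub contDiff_const))

theorem partialDeriv_taylorPoly (x₀ : Pt d) (n : ℕ) {F : Pt d → ℝ} (hF : ContDiff ℝ ∞ F)
    (i : Fin d) (v : Pt d) : partialDeriv i (taylorPoly x₀ (n + 1) F) v =
      taylorPoly x₀ n (partialDeriv i F) v := by
  have e : taylorPoly x₀ (n + 1) F = fun v =>
      ∑ k ∈ Finset.range n, taylorForm x₀ (k + 1) F v / (k + 1).factorial + F x₀ := by
    ext v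
    simp [taylorPoly, Finset.sum_range_succ', taylorForm]
  have h : HasFDerivAt (fun v : Pt d =>
      ∑ k ∈ Finset.range n, taylorForm x₀ (k + 1) F v / (k + 1).factorial + F x₀)
      (∑ k ∈ Finset.range n, ((k + 1).factorial : ℝ)⁻¹ • fderiv ℝ (taylorForm x₀ (k + 1) F) v)
      v := by
    refine (HasFDerivAt.fun_sum fun k _ => ?_).add_const _
    simp only [div_eq_inv_mul]
    exact ((((contDiff_taylorForm x₀ (k + 1) F).differentiable (by simp)) v).hasFDerivAt).const_mul _
  rw [partialDeriv, e, h.fderiv, taylorPoly, _root_.sum_apply]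
  refine Finset.sum_congr rfl fun k _ => ?_
  have := partialDeriv_taylorForm x₀ k hF i v
  rw [partialDeriv] at this
  rw [_root_.smul_apply, this, Nat.factorial_succ, smul_eq_mul]
  push_cast
  field_simp

/-- This reduces remainder estimates to the mean value inequality and induction on the order; no
integral form of the remainder is needed. -/
theorem partialDeriv_taylorRem (x₀ : Pt d) (n : ℕ) {F : Pt d → ℝ} (hF : ContDiff ℝ ∞ F)
    (i : Fin d) (x : Pt d) : partialDeriv i (taylorRem x₀ (n + 1) F) x =
      taylorRem x₀ n (partialDeriv i F) x := by
  have h : HasFDerivAt (taylorRem x₀ (n + 1) F)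
      (fderiv ℝ F x - fderiv ℝ (taylorPoly x₀ (n + 1) F) (x - x₀)) x := by
    refine ((hF.differentiable (by simp)) x).hasFDerivAt.sub ?_
    exact (((contDiff_taylorPoly x₀ (n + 1) F).differentiable (by simp))
      (x - x₀)).hasFDerivAt.comp x ((hasFDerivAt_id x).sub_const x₀)
  rw [partialDeriv, h.fderiv, _root_.sub_apply, taylorRem,
    ← partialDeriv_taylorPoly x₀ n hF]
  rfl

theorem taylorRem_self (x₀ : Pt d) (n : ℕ) (F : Pt d → ℝ) : taylorRem x₀ (n + 1) F x₀ = 0 := by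
  simp [taylorRem, taylorPoly, Finset.sum_range_succ', taylorForm]

theorem abs_taylorRem_le {K : Set (Pt d)} (hK : Convex ℝ K) {B : ℝ} (hB : 0 ≤ B) {x₀ : Pt d}
    (hx₀ : x₀ ∈ K) (n : ℕ) {F : Pt d → ℝ} (hF : ContDiff ℝ ∞ F) (h : DerivBdd K B n F) {x : Pt d}
    (hx : x ∈ K) : |taylorRem x₀ n F x| ≤ B * (d * ‖x - x₀‖) ^ n := by
  induction n generalizing F x with
  | zero => simpa [taylorRem, taylorPoly] using h x hx
  | succ n ih =>
    -- Intersecting with the ball keeps convexity and makes the inductive bound uniform between `x₀`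
    -- and `x`.
    have hle := abs_sub_le_of_partialDeriv (hK.inter (convex_closedBall x₀ ‖x - x₀‖))
      (contDiff_taylorRem x₀ (n + 1) hF) (b := B * (d * ‖x - x₀‖) ^ n) (by positivity)
      (fun i z hz => by
        rw [partialDeriv_taylorRem x₀ n hF]
        refine (ih (contDiff_partialDeriv hF i) (h.2 i) hz.1).trans ?_
        have := mem_closedBall_iff_norm.1 hz.2
        gcongr)
      ⟨hx, mem_closedBall_iff_norm.2 le_rfl⟩ ⟨hx₀, by simp⟩
    rw [taylorRem_self, sub_zero] at hle
    exact hle.trans (le_of_eq (by ring))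

theorem abs_taylorRem_sub_le {K : Set (Pt d)} (hK : Convex ℝ K) {B : ℝ} (hB : 0 ≤ B) {x₀ : Pt d}
    (hx₀ : x₀ ∈ K) (n : ℕ) {F : Pt d → ℝ} (hF : ContDiff ℝ ∞ F) (h : DerivBdd K B (n + 1) F)
    {x y : Pt d} (hx : x ∈ K) (hy : y ∈ K) {r : ℝ} (hxr : ‖x - x₀‖ ≤ r) (hyr : ‖y - x₀‖ ≤ r) :
    |taylorRem x₀ (n + 1) F x - taylorRem x₀ (n + 1) F y| ≤ d * (B * (d * r) ^ n) * ‖x - y‖ := by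
  have hr : 0 ≤ r := (norm_nonneg _).trans hxr
  refine abs_sub_le_of_partialDeriv (hK.inter (convex_closedBall x₀ r))
    (contDiff_taylorRem x₀ (n + 1) hF) (by positivity) (fun i z hz => ?_)
    ⟨hx, mem_closedBall_iff_norm.2 hxr⟩ ⟨hy, mem_closedBall_iff_norm.2 hyr⟩
  rw [partialDeriv_taylorRem x₀ n hF]
  refine (abs_taylorRem_le hK hB hx₀ n (contDiff_partialDeriv hF i) (h.2 i) hz.1).trans ?_
  have := mem_closedBall_iff_norm.1 hz.2
  gcongr

/-! ### Polynomials as sums of products with a fixed number of factors -/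

/-- The factors of monomials: a coordinate, or the constant `1`. -/
def optCoord (v : Pt d) : Option (Fin d) → ℝ
  | none => 1
  | some i => v i

/-- `p` is a polynomial of degree at most `k` with coefficients at most `C`, in the sense that it is
a combination of products of `k` factors that are coordinates or `1`. -/
def IsPoly (k : ℕ) (C : ℝ) (p : Pt d → ℝ) : Prop :=
  ∃ c : (Fin k → Option (Fin d)) → ℝ, (∀ τ, |c τ| ≤ C) ∧
    ∀ v, p v = ∑ τ, c τ * ∏ j, optCoord v (τ j)

/-- Padding by the factor `1` gives all monomials equally many factors, so that their product
networks have equal depth and can be added. -/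
theorem IsPoly.cons {k : ℕ} {C : ℝ} {p : Option (Fin d) → Pt d → ℝ} (hp : ∀ o, IsPoly k C (p o)) :
    IsPoly (k + 1) C fun v => ∑ o, optCoord v o * p o v := by
  choose c hc hp using hp
  refine ⟨fun τ => c (τ 0) (Fin.tail τ), fun τ => hc _ _, fun v => ?_⟩
  rw [← (Fin.consEquiv fun _ => Option (Fin d)).sum_comp, Fintype.sum_prod_type]
  refine Finset.sum_congr rfl fun o _ => ?_
  rw [hp, Finset.mul_sum]
  refine Finset.sum_congr rfl fun τ _ => ?_
  simp only [Fin.consEquiv_apply, Fin.cons_zero, Fin.prod_univ_succ, Fin.cons_succ]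
  rw [show Fin.tail ((Fin.consEquiv fun _ => Option (Fin d)) (o, τ)) = τ from rfl]
  ring

theorem isPoly_zero (k : ℕ) {C : ℝ} (hC : 0 ≤ C) : IsPoly (d := d) k C fun _ => 0 :=
  ⟨0, by simpa using hC, by simp⟩

theorem IsPoly.succ {k : ℕ} {C : ℝ} (hC : 0 ≤ C) {p : Pt d → ℝ} (hp : IsPoly k C p) :
    IsPoly (k + 1) C p := by
  have := IsPoly.cons (p := fun o v => if o = none then p v else 0) fun o => by
    by_cases h : o = none
    · simpa [h] using hp
    · simpa [h] using isPoly_zero k hC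
  convert this using 2 with v
  simp [optCoord]

theorem IsPoly.mono {k l : ℕ} (hkl : k ≤ l) {C : ℝ} (hC : 0 ≤ C) {p : Pt d → ℝ}
    (hp : IsPoly k C p) : IsPoly l C p := by
  induction l, hkl using Nat.le_induction with
  | base => exact hp
  | succ l _ ih => exact ih.succ hC

theorem IsPoly.add {k : ℕ} {C C' : ℝ} {p q : Pt d → ℝ} (hp : IsPoly k C p) (hq : IsPoly k C' q) :
    IsPoly k (C + C') fun v => p v + q v := by
  obtain ⟨c, hc, hp⟩ := hp
  obtain ⟨c', hc', hq⟩ := hq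
  refine ⟨c + c', fun τ => (abs_add_le _ _).trans (add_le_add (hc τ) (hc' τ)), fun v => ?_⟩
  simp [hp, hq, add_mul, Finset.sum_add_distrib]

theorem IsPoly.div {k : ℕ} {C a : ℝ} (ha : 1 ≤ a) {p : Pt d → ℝ} (hp : IsPoly k C p) :
    IsPoly k C fun v => p v / a := by
  obtain ⟨c, hc, hp⟩ := hp
  refine ⟨fun τ => c τ / a, fun τ => ?_, fun v => ?_⟩
  · rw [abs_div, abs_of_pos (by linarith : 0 < a)]
    exact (div_le_self (abs_nonneg _) ha).trans (hc τ)
  · simp only [hp, Finset.sum_div]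
    exact Finset.sum_congr rfl fun τ _ => by ring

theorem isPoly_taylorForm {K : Set (Pt d)} {B : ℝ} (hB : 0 ≤ B) {x₀ : Pt d} (hx₀ : x₀ ∈ K) {k n : ℕ}
    (hkn : k ≤ n) {F : Pt d → ℝ} (h : DerivBdd K B n F) : IsPoly k B (taylorForm x₀ k F) := by
  induction k generalizing F n with
  | zero => exact ⟨fun _ => F x₀, fun _ => h.abs_le hx₀, fun v => by simp [taylorForm]⟩
  | succ k ih =>
    obtain ⟨n, rfl⟩ := Nat.exists_eq_succ_of_ne_zero (by omega : n ≠ 0)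
    have := IsPoly.cons (k := k) (C := B) (p := fun o v => match o with
      | none => 0
      | some i => taylorForm x₀ k (partialDeriv i F) v) fun o => by
        cases o with
        | none => exact isPoly_zero k hB
        | some i => exact ih (by omega) (h.2 i)
    convert this using 2 with v
    simp [taylorForm, optCoord]

theorem isPoly_taylorPoly {K : Set (Pt d)} {B : ℝ} (hB : 0 ≤ B) {x₀ : Pt d} (hx₀ : x₀ ∈ K) {n : ℕ}
    {F : Pt d → ℝ} (h : DerivBdd K B (n + 1) F) :
    IsPoly n ((n + 1) * B) (taylorPoly x₀ (n + 1) F) := by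
  have key : ∀ m ≤ n + 1, IsPoly n (m * B) (taylorPoly x₀ m F) := by
    intro m hm
    induction m with
    | zero => exact ⟨0, by simp, by simp [taylorPoly]⟩
    | succ m ih =>
      have h1 := (isPoly_taylorForm hB hx₀ (k := m) (by omega) h).div
        (a := (m.factorial : ℝ)) (by exact_mod_cast Nat.one_le_iff_ne_zero.2 (Nat.factorial_ne_zero m))
      have h2 := (ih (by omega)).add (h1.mono (l := n) (by omega) hB)
      convert h2 using 1
      · push_cast; ring
      · ext v
        simp [taylorPoly, Finset.sum_range_succ]
  simpa using key (n + 1) le_rfl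

end Taylor

/-! ### A partition of unity of hat functions, and local Taylor polynomials -/

/-- The hat function. -/
def hat (u : ℝ) : ℝ := max (1 - |u|) 0

theorem hat_eq_relu (u : ℝ) : hat u = max (u + 1) 0 - 2 * max u 0 + max (u - 1) 0 := by
  unfold hat
  rcases le_total u 0 with h | h
  · rw [abs_of_nonpos h, max_eq_right h, max_eq_right (by linarith : u - 1 ≤ 0)]
    ring_nf
  · rw [abs_of_nonneg h, max_eq_left h, max_eq_left (by linarith : 0 ≤ u + 1)]
    rcases le_total u 1 with h1 | h1
    · rw [max_eq_left (by linarith), max_eq_right (by linarith)]; ring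
    · rw [max_eq_right (by linarith), max_eq_left (by linarith)]; ring

theorem hat_nonneg (u : ℝ) : 0 ≤ hat u := le_max_right _ _

theorem hat_le_one (u : ℝ) : hat u ≤ 1 :=
  max_le (by linarith [abs_nonneg u]) zero_le_one

theorem abs_hat_le_one (u : ℝ) : |hat u| ≤ 1 := by
  rw [abs_of_nonneg (hat_nonneg u)]; exact hat_le_one u

theorem abs_lt_one_of_hat_ne_zero {u : ℝ} (h : hat u ≠ 0) : |u| < 1 := by
  by_contra hu
  exact h (max_eq_right (by linarith))

theorem abs_hat_sub_le (u v : ℝ) : |hat u - hat v| ≤ |u - v| := by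
  refine (abs_relu_sub_le _ _).trans ?_
  rw [show 1 - |u| - (1 - |v|) = -(|u| - |v|) by ring, abs_neg]
  exact abs_abs_sub_abs_le_abs_sub u v

/-- Hats are second differences of rectifiers, so the sum telescopes to boundary terms, which on
`[0, N]` reduce to `(u + 1) - u`. -/
theorem sum_hat {N : ℕ} {u : ℝ} (h0 : 0 ≤ u) (hN : u ≤ N) :
    ∑ m : Fin (N + 1), hat (u - (m : ℕ)) = 1 := by
  have key : ∀ N : ℕ, ∑ m ∈ Finset.range (N + 1), hat (u - m) =
      max (u + 1) 0 - max u 0 - max (u - N) 0 + max (u - N - 1) 0 := by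
    intro N
    induction N with
    | zero => simp [hat_eq_relu]; ring
    | succ N ih =>
      rw [Finset.sum_range_succ, ih, hat_eq_relu]
      push_cast
      ring_nf
  rw [Fin.sum_univ_eq_sum_range fun m => hat (u - m), key, max_eq_left (by linarith),
    max_eq_left h0, max_eq_right (by linarith), max_eq_right (by linarith)]
  ring

section Partition

variable {d : ℕ}

/-- The grid points of the unit cube with mesh size `1 / N`. -/
def gridPoint (N : ℕ) (m : Fin d → Fin (N + 1)) : Pt d := WithLp.toLp 2 fun i => (m i : ℕ) / (N : ℝ)

/-- The partition of unity of products of hat functions around the grid points. -/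
def bumpAt (N : ℕ) (m : Fin d → Fin (N + 1)) (x : Pt d) : ℝ := ∏ i, hat (N * x i - (m i : ℕ))

/-- Local Taylor polynomials, glued by the partition of unity. -/
def quasiInterp (N n : ℕ) (F : Pt d → ℝ) (x : Pt d) : ℝ :=
  ∑ m : Fin d → Fin (N + 1), bumpAt N m x * taylorPoly (gridPoint N m) n F (x - gridPoint N m)

theorem gridPoint_mem {N : ℕ} (hN : 0 < N) (m : Fin d → Fin (N + 1)) :
    gridPoint N m ∈ closedCube d := by
  intro i
  have e : gridPoint N m i = (m i : ℕ) / (N : ℝ) := rfl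
  have h : ((m i : ℕ) : ℝ) ≤ N := by exact_mod_cast Nat.lt_succ_iff.1 (m i).2
  rw [e]
  exact ⟨by positivity, div_le_one_of_le₀ h (by positivity)⟩

theorem sum_bumpAt {N : ℕ} {x : Pt d} (hx : x ∈ closedCube d) :
    ∑ m : Fin d → Fin (N + 1), bumpAt N m x = 1 := by
  have h := Finset.prod_univ_sum (fun _ : Fin d => (Finset.univ : Finset (Fin (N + 1))))
    fun i j => hat (N * x i - (j : ℕ))
  rw [Fintype.piFinset_univ] at h
  simp only [bumpAt]
  rw [← h]
  refine Finset.prod_eq_one fun i _ => sum_hat ?_ ?_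
  · have := (hx i).1; positivity
  · exact mul_le_of_le_one_right (by positivity) (hx i).2

theorem bumpAt_nonneg (N : ℕ) (m : Fin d → Fin (N + 1)) (x : Pt d) : 0 ≤ bumpAt N m x :=
  Finset.prod_nonneg fun _ _ => hat_nonneg _

theorem bumpAt_le_one (N : ℕ) (m : Fin d → Fin (N + 1)) (x : Pt d) : bumpAt N m x ≤ 1 :=
  Finset.prod_le_one (fun _ _ => hat_nonneg _) fun _ _ => hat_le_one _

theorem abs_hat_scaled_sub_le (N : ℕ) (c : ℝ) (x y : Pt d) (i : Fin d) :
    |hat (N * x i - c) - hat (N * y i - c)| ≤ N * ‖x - y‖ := by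
  refine (abs_hat_sub_le _ _).trans ?_
  rw [show N * x i - c - (N * y i - c) = N * (x i - y i) by ring, abs_mul, Nat.abs_cast]
  exact mul_le_mul_of_nonneg_left (abs_apply_sub_le x y i) (by positivity)

theorem abs_bumpAt_sub_le (N : ℕ) (m : Fin d → Fin (N + 1)) (x y : Pt d) :
    |bumpAt N m x - bumpAt N m y| ≤ d * (N * ‖x - y‖) := by
  have h := abs_list_prod_sub_le (r := N * ‖x - y‖)
    ((List.finRange d).map fun i (x : Pt d) => hat (N * x i - (m i : ℕ))) x y
    (by simp [abs_hat_le_one]) (by simp [abs_hat_le_one])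
    (by simpa using fun i => abs_hat_scaled_sub_le N _ x y i)
  simpa [bumpAt, Fin.prod_univ_def, Function.comp_def] using h

/-- The grid points near `x`. -/
def nearby (N : ℕ) (x : Pt d) : Finset (Fin d → Fin (N + 1)) :=
  Fintype.piFinset fun i => {j : Fin (N + 1) | |N * x i - (j : ℕ)| ≤ 2}

theorem card_nearby_le (N : ℕ) (x : Pt d) : (nearby N x).card ≤ 5 ^ d := by
  rw [nearby, Fintype.card_piFinset]
  refine (Finset.prod_le_pow_card _ _ 5 fun i _ => ?_).trans (by simp)
  generalize N * x i = u
  have hle : ({j : Fin (N + 1) | |u - (j : ℕ)| ≤ 2} : Finset (Fin (N + 1))).card ≤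
      (Finset.Icc ⌈u - 2⌉ ⌊u + 2⌋).card := by
    refine Finset.card_le_card_of_injOn (fun j => ((j : ℕ) : ℤ)) (fun j hj => ?_)
      fun a _ b _ hab => Fin.ext (Int.ofNat_inj.1 hab)
    have hj' := abs_le.1 (Finset.mem_filter.1 hj).2
    rw [Finset.mem_coe, Finset.mem_Icc, Int.ceil_le, Int.le_floor]
    push_cast
    constructor <;> linarith
  refine hle.trans ?_
  rw [Int.card_Icc, show u - 2 = u - (2 : ℤ) by simp, show u + 2 = u + (2 : ℤ) by simp,
    Int.ceil_sub_intCast, Int.floor_add_intCast]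
  have := Int.floor_le_ceil u
  omega

/-- The reason for distance 2 in `nearby`: one set of grid points serves `x` and all `y` within one
mesh width. -/
theorem bumpAt_eq_zero_of_notMem {N : ℕ} {x y : Pt d} (hxy : N * ‖x - y‖ ≤ 1)
    {m : Fin d → Fin (N + 1)} (hm : m ∉ nearby N x) : bumpAt N m y = 0 := by
  by_contra hne
  refine hm ?_
  rw [nearby, Fintype.mem_piFinset]
  intro i
  have h1 := abs_lt_one_of_hat_ne_zero (Finset.prod_ne_zero_iff.1 hne i (Finset.mem_univ i))
  have h2 : |N * x i - N * y i| ≤ 1 := by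
    rw [← mul_sub, abs_mul, Nat.abs_cast]
    exact (mul_le_mul_of_nonneg_left (abs_apply_sub_le x y i) (by positivity)).trans hxy
  rw [Finset.mem_filter]
  refine ⟨Finset.mem_univ _, ?_⟩
  rw [abs_lt] at h1
  rw [abs_le] at h2 ⊢
  constructor <;> linarith

theorem norm_sub_gridPoint_le {N : ℕ} (hN : 0 < N) {x : Pt d} {m : Fin d → Fin (N + 1)}
    (hm : m ∈ nearby N x) : ‖x - gridPoint N m‖ ≤ d * (2 * (1 / N)) := by
  refine norm_le_of_abs_apply_le fun i => ?_
  have hN' : (0 : ℝ) < N := by exact_mod_cast hN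
  have e : (x - gridPoint N m) i = (N * x i - (m i : ℕ)) * (1 / N) := by
    change x i - (m i : ℕ) / (N : ℝ) = _
    field_simp
  rw [nearby, Fintype.mem_piFinset] at hm
  have := (Finset.mem_filter.1 (hm i)).2
  rw [e, abs_mul, abs_of_pos (by positivity : (0 : ℝ) < 1 / N)]
  exact mul_le_mul_of_nonneg_right this (by positivity)

/-- The bumps sum to 1, so the error is an average of local Taylor remainders, with at most `5 ^ d`
terms left. -/
theorem sub_quasiInterp_eq {N n : ℕ} {F : Pt d → ℝ} {x y : Pt d} (hy : y ∈ closedCube d)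
    (hxy : N * ‖x - y‖ ≤ 1) : F y - quasiInterp N n F y =
      ∑ m ∈ nearby N x, bumpAt N m y * taylorRem (gridPoint N m) n F y := by
  have h1 : F y - quasiInterp N n F y =
      ∑ m, bumpAt N m y * taylorRem (gridPoint N m) n F y := by
    simp only [taylorRem, mul_sub, Finset.sum_sub_distrib, ← Finset.sum_mul, sum_bumpAt hy, one_mul,
      quasiInterp]
  rw [h1]
  symm
  refine Finset.sum_subset (Finset.subset_univ _) fun m _ hm => ?_
  rw [bumpAt_eq_zero_of_notMem hxy hm, zero_mul]

/-- The error of quasi-interpolation, in the uniform norm and in the Lipschitz seminorm. -/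
theorem quasiInterp_error (hd : 0 < d) {N : ℕ} (hN : 0 < N) (n : ℕ) {B : ℝ} (hB : 0 ≤ B)
    {F : Pt d → ℝ} (hF : ContDiff ℝ ∞ F) (h : DerivBdd (closedCube d) B (n + 1) F) :
    (∀ x ∈ closedCube d, |F x - quasiInterp N (n + 1) F x| ≤
      5 ^ d * (2 * d * B * (3 * d ^ 2) ^ (n + 1)) * (1 / N) ^ (n + 1)) ∧
    ∀ x ∈ closedCube d, ∀ y ∈ closedCube d,
      |(F x - quasiInterp N (n + 1) F x) - (F y - quasiInterp N (n + 1) F y)| ≤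
        2 * (5 ^ d * (2 * d * B * (3 * d ^ 2) ^ (n + 1))) * (1 / N) ^ n * ‖x - y‖ := by
  have hN' : (0 : ℝ) < N := by exact_mod_cast hN
  have hd' : (1 : ℝ) ≤ d := by exact_mod_cast hd
  have hcard : ∀ x : Pt d, ((nearby N x).card : ℝ) ≤ 5 ^ d := fun x => by
    exact_mod_cast card_nearby_le N x
  set η : ℝ := 1 / N with hη
  have hη0 : 0 < η := by positivity
  set ρ : ℝ := 3 * d * η with hρ
  have hnear : ∀ x : Pt d, ∀ m ∈ nearby N x, ∀ y : Pt d, ‖x - y‖ ≤ η → ‖y - gridPoint N m‖ ≤ ρ := by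
    intro x m hm y hxy
    have h1 := norm_sub_gridPoint_le hN hm
    have h2 : ‖y - gridPoint N m‖ ≤ ‖x - y‖ + ‖x - gridPoint N m‖ := by
      rw [norm_sub_rev x y]
      exact norm_sub_le_norm_sub_add_norm_sub _ _ _
    rw [← hη] at h1
    nlinarith
  have hrem : ∀ x : Pt d, ∀ m ∈ nearby N x, ∀ y ∈ closedCube d, ‖x - y‖ ≤ η →
      |taylorRem (gridPoint N m) (n + 1) F y| ≤ B * (d * ρ) ^ (n + 1) := by
    intro x m hm y hy hxy
    refine (abs_taylorRem_le (convex_closedCube d) hB (gridPoint_mem hN m) (n + 1) hF h hy).trans ?_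
    have := hnear x m hm y hxy
    gcongr
  have hsup : ∀ x ∈ closedCube d, |F x - quasiInterp N (n + 1) F x| ≤
      5 ^ d * (2 * d * B * (3 * d ^ 2) ^ (n + 1)) * η ^ (n + 1) := by
    intro x hx
    rw [sub_quasiInterp_eq (x := x) hx (by simp)]
    calc _ ≤ ∑ m ∈ nearby N x, B * (d * ρ) ^ (n + 1) := by
          refine (Finset.abs_sum_le_sum_abs _ _).trans (Finset.sum_le_sum fun m hm => ?_)
          rw [abs_mul, abs_of_nonneg (bumpAt_nonneg N m x)]
          exact (mul_le_of_le_one_left (abs_nonneg _) (bumpAt_le_one N m x)).trans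
            (hrem x m hm x hx (by simpa using hη0.le))
      _ ≤ 5 ^ d * (B * (d * ρ) ^ (n + 1)) := by
          rw [Finset.sum_const, nsmul_eq_mul]
          exact mul_le_mul_of_nonneg_right (hcard x) (by positivity)
      _ = 5 ^ d * (1 * B * (3 * d ^ 2) ^ (n + 1)) * η ^ (n + 1) := by
          rw [hρ, show (d : ℝ) * (3 * d * η) = 3 * d ^ 2 * η by ring, mul_pow]; ring
      _ ≤ _ := by
          gcongr
          linarith
  refine ⟨hsup, fun x hx y hy => ?_⟩
  -- For close points the product rule is applied to each term; the slope `N` of a bump is paid for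
  -- by the extra power of `η` in the remainder. For distant points the uniform bound suffices, as
  -- `η ≤ ‖x - y‖`.
  rcases le_total ‖x - y‖ η with hxy | hxy
  · have hxy' : N * ‖x - y‖ ≤ 1 := by
      calc N * ‖x - y‖ ≤ N * η := by gcongr
        _ = 1 := by rw [hη]; field_simp
    rw [sub_quasiInterp_eq (x := x) hx (by simp), sub_quasiInterp_eq (x := x) hy hxy',
      ← Finset.sum_sub_distrib]
    have hterm : ∀ m ∈ nearby N x, |bumpAt N m x * taylorRem (gridPoint N m) (n + 1) F x -
        bumpAt N m y * taylorRem (gridPoint N m) (n + 1) F y| ≤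
        d * (B * (d * ρ) ^ n) * ‖x - y‖ + d * (N * ‖x - y‖) * (B * (d * ρ) ^ (n + 1)) := by
      intro m hm
      have h1 := abs_taylorRem_sub_le (convex_closedCube d) hB (gridPoint_mem hN m) n hF h hx hy
        (hnear x m hm x (by simpa using hη0.le)) (hnear x m hm y hxy)
      have h2 := abs_bumpAt_sub_le N m x y
      have h3 := hrem x m hm y hy hxy
      generalize taylorRem (gridPoint N m) (n + 1) F x = R at *
      generalize taylorRem (gridPoint N m) (n + 1) F y = R' at *
      rw [show bumpAt N m x * R - bumpAt N m y * R' =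
        bumpAt N m x * (R - R') + (bumpAt N m x - bumpAt N m y) * R' by ring]
      refine (abs_add_le _ _).trans (add_le_add ?_ ?_)
      · rw [abs_mul, abs_of_nonneg (bumpAt_nonneg N m x)]
        exact (mul_le_of_le_one_left (abs_nonneg _) (bumpAt_le_one N m x)).trans h1
      · rw [abs_mul]
        exact mul_le_mul h2 h3 (abs_nonneg _) (by positivity)
    calc _ ≤ ∑ m ∈ nearby N x,
          (d * (B * (d * ρ) ^ n) * ‖x - y‖ + d * (N * ‖x - y‖) * (B * (d * ρ) ^ (n + 1))) :=
          (Finset.abs_sum_le_sum_abs _ _).trans (Finset.sum_le_sum hterm)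
      _ ≤ 5 ^ d * (d * (B * (d * ρ) ^ n) * ‖x - y‖ +
            d * (N * ‖x - y‖) * (B * (d * ρ) ^ (n + 1))) := by
          rw [Finset.sum_const, nsmul_eq_mul]
          exact mul_le_mul_of_nonneg_right (hcard x) (by positivity)
      _ = 5 ^ d * (d * B * ((3 * d ^ 2) ^ n + (3 * d ^ 2) ^ (n + 1))) * η ^ n * ‖x - y‖ := by
          have e : (N : ℝ) * η = 1 := by rw [hη]; field_simp
          rw [hρ, show (d : ℝ) * (3 * d * η) = 3 * d ^ 2 * η by ring, mul_pow _ η,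
            mul_pow _ η, pow_succ η]
          linear_combination 5 ^ d * (d * ‖x - y‖ * (B * (3 * d ^ 2) ^ (n + 1) * η ^ n)) * e
      _ ≤ 5 ^ d * (d * B * ((3 * d ^ 2) ^ (n + 1) + (3 * d ^ 2) ^ (n + 1))) * η ^ n * ‖x - y‖ := by
          have : (1 : ℝ) ≤ 3 * d ^ 2 := by nlinarith
          gcongr
          omega
      _ = 1 * (5 ^ d * (2 * d * B * (3 * d ^ 2) ^ (n + 1))) * η ^ n * ‖x - y‖ := by ring
      _ ≤ _ := by
          gcongr
          norm_num
  · calc _ ≤ |F x - quasiInterp N (n + 1) F x| + |F y - quasiInterp N (n + 1) F y| := abs_sub _ _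
      _ ≤ 2 * (5 ^ d * (2 * d * B * (3 * d ^ 2) ^ (n + 1))) * η ^ n * η := by
          have h1 := hsup x hx
          have h2 := hsup y hy
          rw [pow_succ η] at h1 h2
          linarith
      _ ≤ _ := by gcongr

end Partition

/-! ### Bounds in the Hölder norm -/

section Holder

variable {d : ℕ}

/-- The function `e` is bounded by `δ` and Hölder continuous with exponent `s` and constant `δ` on
the set `T`. -/
def HolderBdd (T : Set (Pt d)) (s δ : ℝ) (e : Pt d → ℝ) : Prop :=
  (∀ x ∈ T, |e x| ≤ δ) ∧ ∀ x ∈ T, ∀ y ∈ T, |e x - e y| ≤ δ * ‖x - y‖ ^ s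

variable {T : Set (Pt d)} {s a b δ : ℝ} {e g : Pt d → ℝ}

theorem HolderBdd.mono (h : HolderBdd T s a e) (hab : a ≤ b) : HolderBdd T s b e :=
  ⟨fun x hx => (h.1 x hx).trans hab, fun x hx y hy => (h.2 x hx y hy).trans (by gcongr)⟩

theorem HolderBdd.subset {T' : Set (Pt d)} (h : HolderBdd T s a e) (hT : T' ⊆ T) :
    HolderBdd T' s a e :=
  ⟨fun x hx => h.1 x (hT hx), fun x hx y hy => h.2 x (hT hx) y (hT hy)⟩

theorem HolderBdd.congr (h : HolderBdd T s a e) (heg : ∀ x ∈ T, e x = g x) :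
    HolderBdd T s a g :=
  ⟨fun x hx => by rw [← heg x hx]; exact h.1 x hx,
    fun x hx y hy => by rw [← heg x hx, ← heg y hy]; exact h.2 x hx y hy⟩

theorem HolderBdd.add (he : HolderBdd T s a e) (hg : HolderBdd T s b g) :
    HolderBdd T s (a + b) fun x => e x + g x := by
  refine ⟨fun x hx => (abs_add_le _ _).trans (add_le_add (he.1 x hx) (hg.1 x hx)),
    fun x hx y hy => ?_⟩
  rw [show e x + g x - (e y + g y) = (e x - e y) + (g x - g y) by ring, add_mul]
  exact (abs_add_le _ _).trans (add_le_add (he.2 x hx y hy) (hg.2 x hx y hy))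

theorem HolderBdd.const_mul (he : HolderBdd T s a e) (c : ℝ) :
    HolderBdd T s (|c| * a) fun x => c * e x := by
  refine ⟨fun x hx => ?_, fun x hx y hy => ?_⟩
  · rw [abs_mul]; exact mul_le_mul_of_nonneg_left (he.1 x hx) (abs_nonneg _)
  · rw [← mul_sub, abs_mul, mul_assoc]
    exact mul_le_mul_of_nonneg_left (he.2 x hx y hy) (abs_nonneg _)

theorem HolderBdd.mul (ha : 0 ≤ a) (hb : 0 ≤ b) (he : HolderBdd T s a e) (hg : HolderBdd T s b g) :
    HolderBdd T s (2 * (a * b)) fun x => e x * g x := by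
  refine ⟨fun x hx => ?_, fun x hx y hy => ?_⟩
  · rw [abs_mul]
    have := mul_le_mul (he.1 x hx) (hg.1 x hx) (abs_nonneg _) ha
    have : 0 ≤ a * b := by positivity
    linarith
  · rw [show e x * g x - e y * g y = (e x - e y) * g x + e y * (g x - g y) by ring]
    refine (abs_add_le _ _).trans ?_
    rw [abs_mul, abs_mul]
    have h1 := mul_le_mul (he.2 x hx y hy) (hg.1 x hx) (abs_nonneg _) (by positivity)
    have h2 := mul_le_mul (he.1 y hy) (hg.2 x hx y hy) (abs_nonneg _) ha
    linarith

theorem HolderBdd.sum {ι : Type*} (t : Finset ι) {e : ι → Pt d → ℝ} {a : ι → ℝ}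
    (h : ∀ i ∈ t, HolderBdd T s (a i) (e i)) :
    HolderBdd T s (∑ i ∈ t, a i) fun x => ∑ i ∈ t, e i x := by
  classical
  induction t using Finset.induction_on with
  | empty => exact ⟨by simp, by simp⟩
  | insert i t hi ih =>
    simp only [Finset.sum_insert hi]
    exact (h i (Finset.mem_insert_self _ _)).add
      (ih fun j hj => h j (Finset.mem_insert_of_mem hj))

theorem rpow_interpolation {t A Λ r : ℝ} (ht : 0 ≤ t) (hΛ : 0 ≤ Λ) (hr : 0 ≤ r)
    (hs : 0 ≤ s) (hs1 : s ≤ 1) (htA : t ≤ A) (htr : t ≤ Λ * r) :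
    t ≤ A ^ (1 - s) * Λ ^ s * r ^ s := by
  rcases ht.eq_or_lt with rfl | ht
  · positivity
  calc t = t ^ (1 - s) * t ^ s := by rw [← Real.rpow_add ht]; simp
    _ ≤ A ^ (1 - s) * (Λ * r) ^ s := by
        have : 0 ≤ 1 - s := by linarith
        have : 0 ≤ A := ht.le.trans htA
        gcongr
    _ = _ := by rw [Real.mul_rpow hΛ hr]; ring

/-- Interpolation between the uniform norm and the Lipschitz seminorm; `2 * A` bounds any difference
of two values. -/
theorem holderBdd_of_lipschitz {A Λ : ℝ} (hΛ : 0 ≤ Λ) (hs : 0 ≤ s) (hs1 : s ≤ 1)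
    (hA : ∀ x ∈ T, |e x| ≤ A) (hL : ∀ x ∈ T, ∀ y ∈ T, |e x - e y| ≤ Λ * ‖x - y‖)
    (h1 : A ≤ δ) (h2 : (2 * A) ^ (1 - s) * Λ ^ s ≤ δ) : HolderBdd T s δ e := by
  refine ⟨fun x hx => (hA x hx).trans h1, fun x hx y hy => ?_⟩
  refine (rpow_interpolation (abs_nonneg _) hΛ (norm_nonneg (x - y)) hs hs1
    (((abs_sub _ _).trans (add_le_add (hA x hx) (hA y hy))).trans (le_of_eq (two_mul A).symm))
    (hL x hx y hy)).trans ?_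
  gcongr

/-- Supplies the smoothing tolerance: with a fixed Lipschitz constant, a small uniform error is
small in the Hölder norm too, because `1 - s > 0`. -/
theorem exists_small_rpow {Λ ε : ℝ} (hΛ : 0 ≤ Λ) (hε : 0 < ε) (hs1 : s < 1) :
    ∃ δ > 0, δ ≤ ε ∧ (2 * δ) ^ (1 - s) * Λ ^ s ≤ ε := by
  have hp : 0 < 1 - s := by linarith
  have hK : 0 < Λ ^ s + 1 := by positivity
  refine ⟨min ε ((ε / (Λ ^ s + 1)) ^ (1 / (1 - s)) / 2), by positivity, min_le_left _ _, ?_⟩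
  have h1 : 2 * min ε ((ε / (Λ ^ s + 1)) ^ (1 / (1 - s)) / 2) ≤
      (ε / (Λ ^ s + 1)) ^ (1 / (1 - s)) := by
    have := min_le_right ε ((ε / (Λ ^ s + 1)) ^ (1 / (1 - s)) / 2)
    linarith
  calc _ ≤ ((ε / (Λ ^ s + 1)) ^ (1 / (1 - s))) ^ (1 - s) * (Λ ^ s + 1) := by
        gcongr
        linarith
    _ = ε := by
        rw [← Real.rpow_mul (by positivity), one_div_mul_cancel hp.ne', Real.rpow_one]
        field_simp

end Holder

/-! ### Approximation of a function with bounded weak derivatives -/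

section Approx

variable {d : ℕ}

/-- The factors of a monomial times a function of the partition of unity. -/
def factors (N : ℕ) {n : ℕ} (m : Fin d → Fin (N + 1)) (τ : Fin n → Option (Fin d)) :
    List ((Fin d → ℝ) → ℝ) :=
  ((List.finRange d).map fun i z => hat (N * z i - (m i : ℕ))) ++
    (List.finRange n).map fun j z => (τ j).elim 1 fun i => z i - (m i : ℕ) / (N : ℝ)

theorem length_factors (N : ℕ) {n : ℕ} (m : Fin d → Fin (N + 1)) (τ : Fin n → Option (Fin d)) :
    (factors N m τ).length = d + n := by
  simp [factors]

theorem mem_factors {N n : ℕ} {m : Fin d → Fin (N + 1)} {τ : Fin n → Option (Fin d)}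
    {P : ((Fin d → ℝ) → ℝ) → Prop} (h1 : ∀ i, P fun z => hat (N * z i - (m i : ℕ)))
    (h2 : P fun _ => 1) (h3 : ∀ i, P fun z => z i - (m i : ℕ) / (N : ℝ)) :
    ∀ u ∈ factors N m τ, P u := by
  intro u hu
  rcases List.mem_append.1 hu with hu | hu
  · obtain ⟨i, -, rfl⟩ := List.mem_map.1 hu
    exact h1 i
  · obtain ⟨j, -, rfl⟩ := List.mem_map.1 hu
    cases h : τ j with
    | none => exact h2
    | some i => exact h3 i

theorem prod_factors (N : ℕ) {n : ℕ} (m : Fin d → Fin (N + 1)) (τ : Fin n → Option (Fin d))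
    (x : Pt d) : ((factors N m τ).map fun u => u fun i => x i).prod =
      bumpAt N m x * ∏ j, optCoord (x - gridPoint N m) (τ j) := by
  rw [factors, List.map_append, List.prod_append, List.map_map, List.map_map, bumpAt,
    Fin.prod_univ_def, Fin.prod_univ_def]
  congr 3
  funext j
  simp only [Function.comp_apply]
  cases τ j <;> rfl

theorem isNet_factors (N : ℕ) {n : ℕ} (m : Fin d → Fin (N + 1)) (τ : Fin n → Option (Fin d)) :
    ∀ u ∈ factors N m τ, IsNet d 2 (3 * d + 2) u := by
  refine mem_factors (fun i => ?_) ?_ fun i => ?_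
  · have h0 := (IsNet.coord i).affine N (-(m i : ℕ))
    have h1 := ((h0.affine 1 1).relu.add (h0.relu.affine (-2) 0)).add (h0.affine 1 (-1)).relu
    refine IsNet.mono (w := d + d + d) ?_ (by omega)
    convert h1 using 2 with z
    rw [hat_eq_relu]
    ring_nf
  · exact ((IsNet.const d 1).pad 1).mono (by omega)
  · have := (((IsNet.coord i).affine 1 (-((m i : ℕ) / (N : ℝ)))).pad 1).mono
      (w' := 3 * d + 2) (by omega)
    convert this using 2 with z
    ring

theorem abs_factors_le {N n : ℕ} (hN : 0 < N) (m : Fin d → Fin (N + 1))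
    (τ : Fin n → Option (Fin d)) {x : Pt d} (hx : x ∈ closedCube d) :
    ∀ u ∈ factors N m τ, |u fun i => x i| ≤ 1 := by
  refine mem_factors (fun i => abs_hat_le_one _) (by simp) fun i => ?_
  have h1 := hx i
  have h2 : 0 ≤ (m i : ℕ) / (N : ℝ) ∧ (m i : ℕ) / (N : ℝ) ≤ 1 := gridPoint_mem hN m i
  rw [abs_le]
  constructor <;> linarith

theorem abs_factors_sub_le {N n : ℕ} (hN : 0 < N) (m : Fin d → Fin (N + 1))
    (τ : Fin n → Option (Fin d)) (x y : Pt d) :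
    ∀ u ∈ factors N m τ, |(u fun i => x i) - u fun i => y i| ≤ N * ‖x - y‖ := by
  have hN' : (1 : ℝ) ≤ N := by exact_mod_cast hN
  refine mem_factors (fun i => abs_hat_scaled_sub_le N _ x y i) (by simp; positivity) fun i => ?_
  rw [sub_sub_sub_cancel_right]
  exact (abs_apply_sub_le x y i).trans (le_mul_of_one_le_left (norm_nonneg _) hN')

/-- The error of the network approximation of the terms of a quasi-interpolant. -/
theorem prodApprox_factors_error {N n : ℕ} (hN : 0 < N) (M : ℕ)
    (c : (Fin d → Fin (N + 1)) × (Fin n → Option (Fin d)) → ℝ) {C : ℝ} (hC : ∀ i, |c i| ≤ C) :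
    (∀ x ∈ closedCube d,
      |∑ i, c i * (((factors N i.1 i.2).map fun u => u fun j => x j).prod -
        prodApprox M ((factors N i.1 i.2).map fun u => u fun j => x j))| ≤
      ((N + 1) ^ d * (d + 1) ^ n) * (C * (4 ^ (d + n + 1) * (1 / 4 ^ M)))) ∧
    ∀ x ∈ closedCube d, ∀ y ∈ closedCube d,
      |∑ i, c i * (((factors N i.1 i.2).map fun u => u fun j => x j).prod -
        prodApprox M ((factors N i.1 i.2).map fun u => u fun j => x j)) -
      ∑ i, c i * (((factors N i.1 i.2).map fun u => u fun j => y j).prod -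
        prodApprox M ((factors N i.1 i.2).map fun u => u fun j => y j))| ≤
      ((N + 1) ^ d * (d + 1) ^ n) * (C * (4 ^ (d + n + 1) * (N * ‖x - y‖))) := by
  have hcard : (Fintype.card ((Fin d → Fin (N + 1)) × (Fin n → Option (Fin d))) : ℝ) =
      (N + 1) ^ d * (d + 1) ^ n := by
    simp
  have hC0 : 0 ≤ C := (abs_nonneg _).trans (hC (fun _ => 0, fun _ => none))
  constructor
  · intro x hx
    rw [← hcard, ← Finset.card_univ, ← nsmul_eq_mul, ← Finset.sum_const]
    refine (Finset.abs_sum_le_sum_abs _ _).trans (Finset.sum_le_sum fun i _ => ?_)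
    rw [abs_mul, abs_sub_comm]
    refine mul_le_mul (hC i) ?_ (abs_nonneg _) hC0
    have h := abs_prodApprox_sub_prod_le M (l := (factors N i.1 i.2).map fun u => u fun j => x j)
      (by
        intro v hv
        obtain ⟨u, hu, rfl⟩ := List.mem_map.1 hv
        exact abs_factors_le hN _ _ hx u hu)
    rw [List.length_map, length_factors] at h
    refine h.trans ?_
    rw [div_eq_mul_one_div]
    gcongr
    calc (2 : ℝ) ^ (d + n + 1) - 2 ≤ 2 ^ (d + n + 1) := by linarith
      _ ≤ 4 ^ (d + n + 1) := by gcongr; norm_num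
  · intro x hx y hy
    rw [← Finset.sum_sub_distrib, ← hcard, ← Finset.card_univ, ← nsmul_eq_mul, ← Finset.sum_const]
    refine (Finset.abs_sum_le_sum_abs _ _).trans (Finset.sum_le_sum fun i _ => ?_)
    rw [← mul_sub, abs_mul]
    refine mul_le_mul (hC i) ?_ (abs_nonneg _) hC0
    have h1 := abs_prodApprox_sub_le M (factors N i.1 i.2) (fun j => x j) (fun j => y j)
      (by positivity) (abs_factors_sub_le hN i.1 i.2 x y)
    have h2 := abs_list_prod_sub_le (factors N i.1 i.2) (fun j => x j) (fun j => y j)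
      (abs_factors_le hN _ _ hx) (abs_factors_le hN _ _ hy) (abs_factors_sub_le hN i.1 i.2 x y)
    rw [length_factors] at h1 h2
    -- The Lipschitz constants of the product and of its approximation are simply added, without
    -- using any cancellation.
    rw [sub_sub_sub_comm]
    refine (abs_sub _ _).trans ((add_le_add h2 h1).trans ?_)
    rw [← add_mul]
    gcongr
    have : ((d + n : ℕ) : ℝ) ≤ 4 ^ (d + n) := by
      exact_mod_cast (Nat.lt_pow_self (by norm_num : 1 < 4)).le
    rw [pow_succ]
    linarith [show (0 : ℝ) ≤ 4 ^ (d + n) by positivity]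

theorem quasiInterp_eq_sum {N n : ℕ} (hN : 0 < N) {B : ℝ} (hB : 0 ≤ B) {F : Pt d → ℝ}
    (h : DerivBdd (closedCube d) B (n + 1) F) :
    ∃ c : (Fin d → Fin (N + 1)) × (Fin n → Option (Fin d)) → ℝ,
      (∀ i, |c i| ≤ (n + 1) * B) ∧ ∀ x, quasiInterp N (n + 1) F x =
        ∑ i, c i * ((factors N i.1 i.2).map fun u => u fun j => x j).prod := by
  choose c hc hp using fun m => isPoly_taylorPoly hB (gridPoint_mem hN m) h
  refine ⟨fun i => c i.1 i.2, fun i => hc _ _, fun x => ?_⟩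
  rw [Fintype.sum_prod_type, quasiInterp]
  refine Finset.sum_congr rfl fun m _ => ?_
  rw [hp, Finset.mul_sum]
  refine Finset.sum_congr rfl fun τ _ => ?_
  rw [prod_factors]
  ring

end Approx

/-! ### Hölder error rates for a single component -/

section Component

variable {d : ℕ}

theorem DerivBdd.abs_sub_le {K : Set (Pt d)} (hK : Convex ℝ K) {B : ℝ} (hB : 0 ≤ B) {n : ℕ}
    {F : Pt d → ℝ} (hF : ContDiff ℝ ∞ F) (h : DerivBdd K B (n + 1) F) {x y : Pt d} (hx : x ∈ K)
    (hy : y ∈ K) : |F x - F y| ≤ d * B * ‖x - y‖ :=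
  abs_sub_le_of_partialDeriv hK hF hB (fun i _ hz => (h.2 i).abs_le hz) hx hy

/-- The exponents interpolate to `(n + 1)(1 - s) + n s = n + 1 - s`. -/
theorem holderBdd_quasiInterp (hd : 0 < d) {s : ℝ} (hs : 0 ≤ s) (hs1 : s < 1) {N : ℕ} (hN : 0 < N)
    (n : ℕ) {B : ℝ} (hB : 0 ≤ B) {F : Pt d → ℝ} (hF : ContDiff ℝ ∞ F)
    (h : DerivBdd (closedCube d) B (n + 1) F) :
    HolderBdd (closedCube d) s (2 * (5 ^ d * (2 * d * B * (3 * d ^ 2) ^ (n + 1))) *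
      (1 / N : ℝ) ^ ((n : ℝ) + 1 - s)) fun x => F x - quasiInterp N (n + 1) F x := by
  have hN' : (1 : ℝ) ≤ N := by exact_mod_cast hN
  obtain ⟨h1, h2⟩ := quasiInterp_error hd hN n hB hF h
  set C : ℝ := 5 ^ d * (2 * d * B * (3 * d ^ 2) ^ (n + 1)) with hC
  have hC0 : 0 ≤ C := by positivity
  set η : ℝ := 1 / N
  have hη : 0 < η := by positivity
  have hη1 : η ≤ 1 := div_le_one_of_le₀ hN' (by positivity)
  refine holderBdd_of_lipschitz (by positivity) hs hs1.le h1 h2 ?_ ?_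
  · calc C * η ^ (n + 1) ≤ 2 * C * η ^ (n + 1) := by gcongr; linarith
      _ = 2 * C * η ^ ((n : ℝ) + 1) := by
          rw [← Real.rpow_natCast]; push_cast; rfl
      _ ≤ 2 * C * η ^ ((n : ℝ) + 1 - s) := by
          gcongr 2 * C * ?_
          exact Real.rpow_le_rpow_of_exponent_ge hη hη1 (by linarith)
  · rw [← mul_assoc, Real.mul_rpow (by positivity) (by positivity),
      Real.mul_rpow (x := 2 * C) (by positivity) (by positivity)]
    -- Adding exponents needs a positive base, so `C = 0` is treated separately.
    rcases hC0.eq_or_lt with hz | hpos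
    · rw [← hz]
      rw [mul_zero, Real.zero_rpow (by linarith)]
      simp
    · refine le_of_eq ?_
      have e1 : (2 * C) ^ (1 - s) * (2 * C) ^ s = 2 * C := by
        rw [← Real.rpow_add (by positivity)]; simp
      have e2 : (η ^ (n + 1)) ^ (1 - s) * (η ^ n) ^ s = η ^ ((n : ℝ) + 1 - s) := by
        rw [← Real.rpow_natCast, ← Real.rpow_natCast, ← Real.rpow_mul hη.le, ← Real.rpow_mul hη.le,
          ← Real.rpow_add hη]
        congr 1; push_cast; ring
      rw [mul_mul_mul_comm, e1, e2]

/-- With `N = 2 ^ a`, the sum has uniform error of order `N^d 4^(-κ a)` and Lipschitz constant of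
order `N^(d+1)`. Interpolation gives order at most `N^(d + 1 - 2 κ (1 - s))`, which the choice of
`κ` brings below the rate of the quasi-interpolant. -/
theorem holderBdd_prodApprox {s : ℝ} (hs : 0 ≤ s) (hs1 : s < 1) (n κ a : ℕ)
    (hκ : (d + n + 2 : ℝ) ≤ κ * (1 - s))
    (c : (Fin d → Fin (2 ^ a + 1)) × (Fin n → Option (Fin d)) → ℝ) {C : ℝ} (hC : ∀ i, |c i| ≤ C) :
    HolderBdd (closedCube d) s
      (2 * (2 ^ d * (d + 1) ^ n * (C * 4 ^ (d + n + 1))) * (1 / (2 ^ a : ℕ) : ℝ) ^ ((n : ℝ) + 1 - s))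
      fun x => ∑ i, c i * (((factors (2 ^ a) i.1 i.2).map fun u => u fun j => x j).prod -
        prodApprox (κ * a) ((factors (2 ^ a) i.1 i.2).map fun u => u fun j => x j)) := by
  have hN : 0 < 2 ^ a := by positivity
  obtain ⟨h1, h2⟩ := prodApprox_factors_error hN (κ * a) c hC
  have hC0 : 0 ≤ C := (abs_nonneg _).trans (hC (fun _ => 0, fun _ => none))
  have hN' : (1 : ℝ) ≤ (2 ^ a : ℕ) := by exact_mod_cast hN
  have hNa : ((2 ^ a : ℕ) : ℝ) = 2 ^ (a : ℝ) := by simp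
  set N : ℝ := ((2 ^ a : ℕ) : ℝ) with hNdef
  set A : ℝ := (N + 1) ^ d * (d + 1) ^ n * (C * 4 ^ (d + n + 1)) with hA
  have hA0 : 0 ≤ A := by positivity
  set q : ℝ := 1 / 4 ^ (κ * a) with hq
  have hq0 : 0 < q := by positivity
  have hq1 : q ≤ 1 := div_le_one_of_le₀ (one_le_pow₀ (by norm_num)) (by positivity)
  have key : 2 * A * N * q ^ (1 - s) ≤
      2 * (2 ^ d * (d + 1) ^ n * (C * 4 ^ (d + n + 1))) * (1 / N) ^ ((n : ℝ) + 1 - s) := by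
    have e1 : q ^ (1 - s) = 2 ^ (-(2 * a * (κ * (1 - s)))) := by
      have : q = (2 : ℝ) ^ (-(2 * (κ * a) : ℝ)) := by
        rw [hq, Real.rpow_neg (by norm_num), Real.rpow_mul (by norm_num), one_div]
        norm_cast
      rw [this, ← Real.rpow_mul (by norm_num)]
      congr 1; ring
    have e2 : (1 / N) ^ ((n : ℝ) + 1 - s) = 2 ^ (-(a * ((n : ℝ) + 1 - s))) := by
      rw [hNa, one_div, ← Real.rpow_neg (by norm_num), ← Real.rpow_mul (by norm_num)]
      congr 1; ring
    have e3 : N ^ d * N = 2 ^ (a * (d + 1) : ℝ) := by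
      rw [← pow_succ, hNa, ← Real.rpow_natCast, ← Real.rpow_mul (by norm_num)]
      push_cast; rfl
    have h4 : (N + 1) ^ d ≤ 2 ^ d * N ^ d := by
      rw [← mul_pow]; gcongr; linarith
    calc 2 * A * N * q ^ (1 - s)
        ≤ 2 * (2 ^ d * N ^ d * (d + 1) ^ n * (C * 4 ^ (d + n + 1))) * N * q ^ (1 - s) := by
          rw [hA]; gcongr
      _ = 2 * (2 ^ d * (d + 1) ^ n * (C * 4 ^ (d + n + 1))) * ((N ^ d * N) * q ^ (1 - s)) := by ring
      _ ≤ _ := by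
          gcongr 2 * (2 ^ d * (d + 1) ^ n * (C * 4 ^ (d + n + 1))) * ?_
          rw [e1, e2, e3, ← Real.rpow_add (by norm_num)]
          refine Real.rpow_le_rpow_of_exponent_le (by norm_num) ?_
          have ha : (0 : ℝ) ≤ a := by positivity
          have hm := mul_le_mul_of_nonneg_left hκ ha
          have hm0 : 0 ≤ (a : ℝ) * (d + n + 2) := by positivity
          nlinarith
  refine (holderBdd_of_lipschitz (A := A * q) (Λ := A * N) (δ := 2 * A * N * q ^ (1 - s))
    (by positivity) hs hs1.le (fun x hx => (h1 x hx).trans (le_of_eq ?_))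
    (fun x hx y hy => (h2 x hx y hy).trans (le_of_eq ?_)) ?_ ?_).mono key
  · rw [hA]; ring
  · rw [hA]; ring
  · have : q ≤ q ^ (1 - s) := by
      conv_lhs => rw [← Real.rpow_one q]
      exact Real.rpow_le_rpow_of_exponent_ge hq0 hq1 (by linarith)
    calc A * q = A * 1 * q := by ring
      _ ≤ (2 * A) * N * q ^ (1 - s) := by gcongr; linarith
  · have hp : 0 < 1 - s := by linarith
    rw [← mul_assoc, Real.mul_rpow (by positivity) (by positivity), Real.mul_rpow hA0 (by positivity)]
    have hNs : N ^ s ≤ N := by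
      conv_rhs => rw [← Real.rpow_one N]
      exact Real.rpow_le_rpow_of_exponent_le hN' hs1.le
    have hAs : (2 * A) ^ (1 - s) * A ^ s ≤ 2 * A := by
      rcases hA0.eq_or_lt with hz | hpos
      · rw [← hz, mul_zero, Real.zero_rpow hp.ne']; simp
      · calc (2 * A) ^ (1 - s) * A ^ s ≤ (2 * A) ^ (1 - s) * (2 * A) ^ s := by
              gcongr; linarith
          _ = 2 * A := by rw [← Real.rpow_add (by positivity)]; simp
    calc (2 * A) ^ (1 - s) * q ^ (1 - s) * (A ^ s * N ^ s)
        = ((2 * A) ^ (1 - s) * A ^ s) * N ^ s * q ^ (1 - s) := by ring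
      _ ≤ _ := by gcongr

/-- Lipschitz functions with bounded weak derivatives of order `n + 1` are approximated by sums of
networks of constant width. -/
theorem exists_terms (hd : 0 < d) (n : ℕ) {s : ℝ} (hs : 0 ≤ s) (hs1 : s < 1) {B : ℝ} (hB : 0 ≤ B) :
    ∃ C > (0 : ℝ), ∃ κ W : ℕ, ∀ (a : ℕ) (f : Pt d → ℝ), WeakDerivBdd (n + 1) B f →
      (∀ x y, |f x - f y| ≤ d * B * ‖x - y‖) →
      ∃ u : (Fin d → Fin (2 ^ a + 1)) × (Fin n → Option (Fin d)) → (Fin d → ℝ) → ℝ,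
        (∀ i, IsNet d (2 + (d + n) * (κ * a + 2)) W (u i)) ∧
        HolderBdd (closedCube d) s (C * (1 / (2 ^ a : ℕ) : ℝ) ^ ((n : ℝ) + 1 - s))
          fun x => f x - ∑ i, u i fun j => x j := by
  obtain ⟨κ, hκ⟩ : ∃ κ : ℕ, (d + n + 2 : ℝ) ≤ κ * (1 - s) := by
    obtain ⟨κ, hκ⟩ := exists_nat_ge ((d + n + 2 : ℝ) / (1 - s))
    exact ⟨κ, (div_le_iff₀ (by linarith)).1 hκ⟩
  obtain ⟨W, hW⟩ := exists_isNet_prodApprox d (3 * d + 2) (d + n)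
  set C₁ : ℝ := 2 * (5 ^ d * (2 * d * B * (3 * d ^ 2) ^ (n + 1)))
  set C₂ : ℝ := 2 * (2 ^ d * (d + 1) ^ n * ((n + 1) * B * 4 ^ (d + n + 1)))
  refine ⟨1 + C₁ + C₂, by positivity, κ, W, fun a f hf hL => ?_⟩
  have hN : 0 < 2 ^ a := by positivity
  have hη : (0 : ℝ) < 1 / (2 ^ a : ℕ) := by positivity
  set ε : ℝ := (1 / (2 ^ a : ℕ) : ℝ) ^ ((n : ℝ) + 1 - s)
  have hε : 0 < ε := Real.rpow_pos_of_pos hη _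
  -- The tolerance may depend on the mesh, since the derivative bounds of `F` do not depend on `δ`.
  -- The Lipschitz constants of `f` and `F` add up to `Λ`.
  obtain ⟨δ, hδ, hδε, hδs⟩ := exists_small_rpow (s := s) (Λ := d * B + d * B) (by positivity) hε hs1
  obtain ⟨F, hF, hFB, hFf⟩ := hf.exists_smooth_approx hB (by positivity) hL hδ
  obtain ⟨c, hc, hq⟩ := quasiInterp_eq_sum hN hB hFB
  refine ⟨fun i z => c i * prodApprox (κ * a) ((factors (2 ^ a) i.1 i.2).map fun u => u z),
    fun i => ?_, ?_⟩
  · simpa using (hW (κ * a) _ (length_factors _ _ _) (isNet_factors _ i.1 i.2)).affine (c i) 0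
  · have h1 : HolderBdd (closedCube d) s ε fun x => f x - F x := by
      refine holderBdd_of_lipschitz (A := δ) (Λ := d * B + d * B) (by positivity) hs hs1.le
        (fun x hx => by rw [abs_sub_comm]; exact hFf x hx) (fun x hx y hy => ?_) hδε hδs
      rw [sub_sub_sub_comm, add_mul]
      exact (abs_sub _ _).trans (add_le_add (hL x y)
        (hFB.abs_sub_le (convex_closedCube d) hB hF hx hy))
    have h2 := holderBdd_quasiInterp hd hs hs1 hN n hB hF hFB
    have h3 := holderBdd_prodApprox hs hs1 n κ a hκ c hc
    refine (((h1.add h2).add h3).mono (le_of_eq ?_)).congr fun x _ => ?_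
    · simp only [C₁, C₂, ε]; ring
    · simp only [hq, mul_sub, Finset.sum_sub_distrib]
      ring

end Component

/-! ### Construction of the emulator -/

section Emulator

variable {d D : ℕ}

/-- All terms of all components are placed in their output coordinates and added as one family of
networks of equal depth. There are of the order of `(2 ^ a) ^ d` of them, each of constant width and
depth linear in `a`. -/
theorem exists_emulator (hd : 0 < d) (D n : ℕ) {s : ℝ} (hs : 0 ≤ s) (hs1 : s < 1) {B : ℝ}
    (hB : 0 ≤ B) :
    ∃ C > (0 : ℝ), ∃ K : ℕ, ∀ (a : ℕ) (f : Fin D → Pt d → ℝ), (∀ j, WeakDerivBdd (n + 1) B (f j)) →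
      (∀ j x y, |f j x - f j y| ≤ d * B * ‖x - y‖) →
      ∃ N : Net d D,
        (∀ j, HolderBdd (closedCube d) s (C * (1 / (2 ^ a : ℕ) : ℝ) ^ ((n : ℝ) + 1 - s))
          fun x => f j x - N.emulator x j) ∧
        N.depth ≤ K * (a + 1) ∧ N.numWeights ≤ K * ((2 ^ a) ^ d * (a + 1)) ∧
        N.numUnits ≤ K * ((2 ^ a) ^ d * (a + 1)) := by
  obtain ⟨C, hC, κ, W, hterms⟩ := exists_terms hd n hs hs1 hB
  set L₀ : ℕ := 2 + (d + n) * (κ + 2) with hL₀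
  set W' : ℕ := max W (max 1 D) with hW'
  set K₀ : ℕ := D * (2 ^ d * (d + 1) ^ n) with hK₀
  refine ⟨C, hC, L₀ + K₀ * (L₀ * (W' * W' + W')) + (K₀ * ((L₀ + 1) * W') + (d + D)),
    fun a f hf hL => ?_⟩
  choose u hu hfu using fun j => hterms a (f j) (hf j) (hL j)
  choose N hN1 hN2 hN3 using hu
  set L : ℕ := 2 + (d + n) * (κ * a + 2) with hLdef
  -- The embedding of a scalar as the `j`-th coordinate; it merges with the last layer, leaving the
  -- depth unchanged.
  let E : Fin D → Net 1 D := fun j => .out (fun r _ => if r = j then 1 else 0) 0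
  have hdepth : ∀ j i, ((N j i).comp (E j)).depth = L := fun j i => by
    have h1 := (N j i).depth_comp (E j)
    have h2 := hN1 j i
    simp only [E, Net.depth] at h1 ⊢
    omega
  have hwidth : ∀ j i, ((N j i).comp (E j)).width ≤ W' := fun j i =>
    ((N j i).width_comp_le (E j)).trans (max_le_max (hN2 j i) le_rfl)
  obtain ⟨N', h1, h2, h3, h4⟩ := Net.exists_sum
    (Finset.univ : Finset (Fin D × ((Fin d → Fin (2 ^ a + 1)) × (Fin n → Option (Fin d)))))
    (L := L) (W := L * (W' * W' + W')) (U := (L + 1) * W') (by omega)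
    (fun q => (N q.1 q.2).comp (E q.1)) (fun q _ => by
      have hw := hwidth q.1 q.2
      have hdq := hdepth q.1 q.2
      refine ⟨hdq, (Net.numWeights_le _).trans ?_, (Net.numUnits_le _).trans ?_⟩
      · rw [hdq]; gcongr
      · rw [hdq]; gcongr)
  have hcard : (Finset.univ : Finset (Fin D × ((Fin d → Fin (2 ^ a + 1)) ×
      (Fin n → Option (Fin d))))).card ≤ K₀ * (2 ^ a) ^ d := by
    have : (2 ^ a + 1) ^ d ≤ 2 ^ d * (2 ^ a) ^ d := by
      rw [← mul_pow]
      gcongr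
      have : 0 < 2 ^ a := by positivity
      omega
    simp only [Finset.card_univ, Fintype.card_prod, Fintype.card_fin, Fintype.card_pi,
      Finset.prod_const, Fintype.card_option]
    calc D * ((2 ^ a + 1) ^ d * (d + 1) ^ n) ≤ D * (2 ^ d * (2 ^ a) ^ d * (d + 1) ^ n) := by gcongr
      _ = K₀ * (2 ^ a) ^ d := by rw [hK₀]; ring
  have hLa : L ≤ L₀ * (a + 1) := by
    rw [hLdef, hL₀]
    calc 2 + (d + n) * (κ * a + 2) ≤ 2 * (a + 1) + (d + n) * ((κ + 2) * (a + 1)) := by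
          gcongr
          · omega
          · nlinarith
      _ = _ := by ring
  have h2a : 1 ≤ (2 ^ a) ^ d := Nat.one_le_iff_ne_zero.2 (by positivity)
  refine ⟨N', fun j => (hfu j).congr fun x _ => ?_, ?_, ?_, ?_⟩
  · rw [Net.emulator, h1, Finset.sum_apply]
    congr 1
    symm
    rw [Fintype.sum_prod_type, Finset.sum_eq_single j]
    · refine Finset.sum_congr rfl fun i _ => ?_
      rw [Net.eval_comp]
      simp [E, Net.eval, Matrix.mulVec, dotProduct, hN3]
    · intro r _ hr
      refine Finset.sum_eq_zero fun i _ => ?_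
      rw [Net.eval_comp]
      simp [E, Net.eval, Matrix.mulVec, dotProduct, hr.symm]
    · simp
  · rw [h2]
    refine hLa.trans ?_
    gcongr
    omega
  · calc N'.numWeights ≤ K₀ * (2 ^ a) ^ d * (L₀ * (a + 1) * (W' * W' + W')) := by
          refine h3.trans ?_; gcongr
      _ = K₀ * (L₀ * (W' * W' + W')) * ((2 ^ a) ^ d * (a + 1)) := by ring
      _ ≤ _ := by gcongr; omega
  · calc N'.numUnits ≤ K₀ * (2 ^ a) ^ d * ((L₀ * (a + 1) + (a + 1)) * W') +
            (d + D) * ((2 ^ a) ^ d * (a + 1)) := by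
          refine h4.trans ?_
          gcongr
          · omega
          · exact Nat.le_mul_of_pos_right _ (by positivity)
      _ = (K₀ * ((L₀ + 1) * W') + (d + D)) * ((2 ^ a) ^ d * (a + 1)) := by ring
      _ ≤ _ := Nat.mul_le_mul_right _ (Nat.le_add_left _ _)

/-- Solve `Q N^(-p) = ε` and round `N` up to a power of two, which at most doubles it. Taking `Q ≥
1` keeps the logarithm of `N` nonnegative, and `ε < 1/2` lets `log (1/ε) ≥ log 2` absorb additive
constants. -/
theorem exists_mesh {R p : ℝ} (hp : 0 < p) : ∃ c > (0 : ℝ), ∀ ε : ℝ, 0 < ε → ε < 1 / 2 →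
    ∃ a : ℕ, R * (1 / (2 ^ a : ℕ) : ℝ) ^ p ≤ ε ∧ (2 : ℝ) ^ a ≤ c * ε ^ (-(1 / p)) ∧
      (a + 1 : ℝ) ≤ c * Real.log (1 / ε) := by
  set Q : ℝ := max R 1 with hQ
  have hQ1 : 1 ≤ Q := le_max_right _ _
  have hQ0 : 0 < Q := by linarith
  have hl2 : 0 < Real.log 2 := Real.log_pos (by norm_num)
  have hlQ : 0 ≤ Real.log Q := Real.log_nonneg hQ1
  set c₂ : ℝ := 1 / p * (Real.log Q / Real.log 2 + 1) / Real.log 2 + 2 / Real.log 2 with hc₂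
  have hc₂0 : 0 < c₂ := by positivity
  refine ⟨2 * Q ^ (1 / p) + c₂, by positivity, fun ε hε hε2 => ?_⟩
  set x : ℝ := (Q / ε) ^ (1 / p) with hx
  have hx1 : 1 ≤ x := Real.one_le_rpow ((one_le_div hε).2 (by linarith)) (by positivity)
  have hx0 : 0 < x := by linarith
  have hlx : 0 ≤ Real.logb 2 x := Real.logb_nonneg (by norm_num) hx1
  have hxe : (2 : ℝ) ^ Real.logb 2 x = x :=
    Real.rpow_logb (by norm_num) (by norm_num) hx0
  refine ⟨⌈Real.logb 2 x⌉₊, ?_, ?_, ?_⟩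
  · have h1 : x ≤ ((2 ^ ⌈Real.logb 2 x⌉₊ : ℕ) : ℝ) := by
      conv_lhs => rw [← hxe]
      push_cast
      rw [← Real.rpow_natCast]
      exact Real.rpow_le_rpow_of_exponent_le (by norm_num) (Nat.le_ceil _)
    calc R * (1 / (2 ^ ⌈Real.logb 2 x⌉₊ : ℕ) : ℝ) ^ p ≤ Q * (1 / x) ^ p := by
          have h3 : (1 / (2 ^ ⌈Real.logb 2 x⌉₊ : ℕ) : ℝ) ^ p ≤ (1 / x) ^ p := by gcongr
          exact mul_le_mul (le_max_left _ _) h3 (by positivity) hQ0.le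
      _ = ε := by
          rw [hx, one_div, Real.inv_rpow (by positivity), ← Real.rpow_mul (by positivity),
            one_div_mul_cancel hp.ne', Real.rpow_one]
          field_simp
  · calc (2 : ℝ) ^ ⌈Real.logb 2 x⌉₊ ≤ 2 ^ (Real.logb 2 x + 1) := by
          rw [← Real.rpow_natCast]
          exact Real.rpow_le_rpow_of_exponent_le (by norm_num) (Nat.ceil_lt_add_one hlx).le
      _ = 2 * Q ^ (1 / p) * ε ^ (-(1 / p)) := by
          rw [Real.rpow_add (by norm_num), hxe, hx, Real.div_rpow hQ0.le hε.le, Real.rpow_neg hε.le,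
            Real.rpow_one]
          ring
      _ ≤ _ := by
          gcongr
          linarith
  · have hlε : Real.log 2 ≤ Real.log (1 / ε) :=
      Real.log_le_log (by norm_num) ((le_div_iff₀ hε).2 (by linarith))
    have e : Real.logb 2 x = 1 / p * (Real.log Q + Real.log (1 / ε)) / Real.log 2 := by
      rw [Real.logb, hx, Real.log_rpow (by positivity), div_eq_mul_one_div Q,
        Real.log_mul hQ0.ne' (by positivity)]
    have h1 : Real.log Q ≤ Real.log Q / Real.log 2 * Real.log (1 / ε) := by
      calc Real.log Q = Real.log Q / Real.log 2 * Real.log 2 := by field_simp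
        _ ≤ _ := by gcongr
    have h2 : (2 : ℝ) ≤ 2 / Real.log 2 * Real.log (1 / ε) := by
      calc (2 : ℝ) = 2 / Real.log 2 * Real.log 2 := by field_simp
        _ ≤ _ := by gcongr
    have hℓ : 0 < Real.log (1 / ε) := by linarith
    calc (⌈Real.logb 2 x⌉₊ + 1 : ℝ) ≤ Real.logb 2 x + 2 := by
          linarith [Nat.ceil_lt_add_one hlx]
      _ ≤ 1 / p * (Real.log Q / Real.log 2 * Real.log (1 / ε) + Real.log (1 / ε)) / Real.log 2 +
            2 / Real.log 2 * Real.log (1 / ε) := by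
          rw [e]; gcongr
      _ = c₂ * Real.log (1 / ε) := by rw [hc₂]; ring
      _ ≤ _ := by
          gcongr
          have : 0 ≤ Q ^ (1 / p) := by positivity
          linarith

/-- A set of full measure is enough, since only essential suprema on the cube and on its square
occur. -/
theorem slobodeckijNorm_le_of_holderBdd {s δ : ℝ} {e : Pt d → ℝ} {T : Set (Pt d)}
    (hT : ∀ᵐ x ∂(cubeMeasure d), x ∈ T) (h : HolderBdd T s δ e) :
    slobodeckijNorm s e ≤ ENNReal.ofReal δ := by
  have h1 : eLpNorm e ∞ (cubeMeasure d) ≤ ENNReal.ofReal δ := by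
    rw [eLpNorm_exponent_top]
    exact eLpNormEssSup_le_of_ae_bound (by filter_upwards [hT] with x hx using h.1 x hx)
  unfold slobodeckijNorm
  split_ifs with hs
  · exact h1
  · refine max_le h1 ?_
    rw [eLpNorm_exponent_top]
    refine eLpNormEssSup_le_of_ae_bound ?_
    filter_upwards [Measure.quasiMeasurePreserving_fst.ae hT,
      Measure.quasiMeasurePreserving_snd.ae hT] with z hz1 hz2
    have hδ : 0 ≤ δ := (abs_nonneg _).trans (h.1 _ hz1)
    rw [Real.norm_eq_abs, abs_div, abs_of_nonneg (Real.rpow_nonneg (norm_nonneg _) s)]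
    exact div_le_of_le_mul₀ (Real.rpow_nonneg (norm_nonneg _) s) hδ (h.2 _ hz1 _ hz2)

/-- With residuals `r`, `r'` and `e = G - G'`, one has `r_j r_k - r'_j r'_k = -(e_j r_k + r'_j
e_k)`. The assumption `δ ≤ 1` bounds `r'` by `A + 1`. -/
theorem holderBdd_potential_sub (Γ : Matrix (Fin D) (Fin D) ℝ) (y : Fin D → ℝ)
    (G G' : Pt d → Fin D → ℝ) {T : Set (Pt d)} {s A δ : ℝ} (hA : 0 ≤ A) (hδ : 0 ≤ δ) (hδ1 : δ ≤ 1)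
    (hG : ∀ j, HolderBdd T s A fun x => y j - G x j)
    (he : ∀ j, HolderBdd T s δ fun x => G x j - G' x j) :
    HolderBdd T s ((∑ j, ∑ k, |Γ⁻¹ j k|) * (2 * A + 1) * δ)
      fun x => potential Γ y G x - potential Γ y G' x := by
  have hG' : ∀ j, HolderBdd T s (A + 1) fun x => y j - G' x j := fun j =>
    (((hG j).add (he j)).mono (by linarith)).congr fun x _ => by ring
  have h : ∀ j k, HolderBdd T s (|-(1 / 2) * Γ⁻¹ j k| * (2 * (δ * A) + 2 * ((A + 1) * δ)))
      fun x => -(1 / 2) * Γ⁻¹ j k *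
        ((G x j - G' x j) * (y k - G x k) + (y j - G' x j) * (G x k - G' x k)) := fun j k =>
    (((he j).mul hδ hA (hG k)).add ((hG' j).mul (by linarith) hδ (he k))).const_mul _
  have hsum := HolderBdd.sum Finset.univ fun j _ => HolderBdd.sum Finset.univ fun k _ => h j k
  refine (hsum.mono (le_of_eq ?_)).congr fun x _ => ?_
  · simp only [Finset.sum_mul, abs_mul, abs_neg]
    refine Finset.sum_congr rfl fun j _ => Finset.sum_congr rfl fun k _ => ?_
    rw [abs_of_pos (by norm_num : (0 : ℝ) < 1 / 2)]
    ring
  · simp only [potential, dotProduct, Matrix.mulVec, Finset.mul_sum, Pi.sub_apply,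
      ← Finset.sum_sub_distrib]
    refine Finset.sum_congr rfl fun j _ => Finset.sum_congr rfl fun k _ => ?_
    ring

end Emulator

/-! ### The Hellinger distance of posteriors -/

section Hellinger

variable {d D : ℕ}

theorem continuous_eval : {k m : ℕ} → (N : Net k m) → Continuous N.eval
  | _, _, .out A b => by
      simp only [Net.eval]
      fun_prop
  | _, _, .hidden A b rest => by
      have h := continuous_eval rest
      simp only [Net.eval]
      exact h.comp (by fun_prop)

theorem aemeasurable_potential (Γ : Matrix (Fin D) (Fin D) ℝ) (y : Fin D → ℝ)
    {G : Pt d → Fin D → ℝ} {μ : Measure (Pt d)} (hG : ∀ j, AEMeasurable (fun θ => G θ j) μ) :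
    AEMeasurable (potential Γ y G) μ := by
  have hc : Continuous fun v : Fin D → ℝ => 1 / 2 * ((y - v) ⬝ᵥ (Γ⁻¹ *ᵥ (y - v))) := by
    fun_prop
  exact hc.measurable.comp_aemeasurable (aemeasurable_pi_iff.2 hG)

theorem quadForm_inv_nonneg {S : Matrix (Fin D) (Fin D) ℝ} (hS : S.PosDef) (v : Fin D → ℝ) :
    0 ≤ v ⬝ᵥ (S⁻¹ *ᵥ v) := by
  simpa using hS.inv.posSemidef.dotProduct_mulVec_nonneg v

theorem potential_nonneg {Γ : Matrix (Fin D) (Fin D) ℝ} (hΓ : Γ.PosDef) (y : Fin D → ℝ)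
    (G : Pt d → Fin D → ℝ) (θ : Pt d) : 0 ≤ potential Γ y G θ :=
  mul_nonneg (by norm_num) (quadForm_inv_nonneg hΓ _)

theorem continuous_gaussianDensity (m : Fin d → ℝ) (S : Matrix (Fin d) (Fin d) ℝ) :
    Continuous (gaussianDensity m S) := by
  unfold gaussianDensity
  fun_prop

theorem gaussianDensity_pos (m : Fin d → ℝ) {S : Matrix (Fin d) (Fin d) ℝ} (hS : S.PosDef)
    (θ : Pt d) : 0 < gaussianDensity m S θ := by
  have := hS.det_pos
  unfold gaussianDensity
  positivity

theorem gaussianDensity_le (m : Fin d → ℝ) {S : Matrix (Fin d) (Fin d) ℝ} (hS : S.PosDef)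
    (θ : Pt d) : gaussianDensity m S θ ≤ (√((2 * Real.pi) ^ d * S.det))⁻¹ := by
  unfold gaussianDensity
  refine mul_le_of_le_one_right (by positivity) (Real.exp_le_one_iff.2 ?_)
  have := quadForm_inv_nonneg hS fun i => θ i - m i
  linarith

theorem cubeMeasure_univ_pos (d : ℕ) : 0 < cubeMeasure d Set.univ := by
  rw [cubeMeasure, Measure.restrict_apply_univ]
  refine (isOpen_cube d).measure_pos volume ⟨WithLp.toLp 2 fun _ => 1 / 2, fun i => ?_⟩
  change 0 < (1 / 2 : ℝ) ∧ (1 / 2 : ℝ) < 1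
  norm_num

theorem exp_sub_one_le {ε : ℝ} (hε : 0 ≤ ε) (hε2 : ε ≤ 1 / 2) : Real.exp ε - 1 ≤ 2 * ε := by
  have h := Real.one_sub_le_exp_neg ε
  rw [Real.exp_neg] at h
  have hp := Real.exp_pos ε
  have h1 : (1 - ε) * Real.exp ε ≤ 1 := by
    calc (1 - ε) * Real.exp ε ≤ (Real.exp ε)⁻¹ * Real.exp ε := by gcongr
      _ = 1 := inv_mul_cancel₀ hp.ne'
  nlinarith

/-- The square roots agree up to a factor `E`; on the lower side `1 - 1/E ≤ E - 1` is used. -/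
theorem sq_sqrt_sub_sqrt_le {p q E : ℝ} (hp : 0 ≤ p) (hE : 1 ≤ E) (hqp : q ≤ E ^ 2 * p)
    (hpq : p ≤ E ^ 2 * q) : (√p - √q) ^ 2 ≤ (E - 1) ^ 2 * p := by
  have h1 : √q ≤ E * √p := by
    calc √q ≤ √(E ^ 2 * p) := Real.sqrt_le_sqrt hqp
      _ = E * √p := by rw [Real.sqrt_mul (by positivity), Real.sqrt_sq (by linarith)]
  have h2 : √p ≤ E * √q := by
    calc √p ≤ √(E ^ 2 * q) := Real.sqrt_le_sqrt hpq
      _ = E * √q := by rw [Real.sqrt_mul (by positivity), Real.sqrt_sq (by linarith)]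
  have h3 : |√p - √q| ≤ (E - 1) * √p := by
    have := Real.sqrt_nonneg p
    have := Real.sqrt_nonneg q
    rw [abs_le]
    constructor <;> nlinarith
  calc (√p - √q) ^ 2 = |√p - √q| ^ 2 := (sq_abs _).symm
    _ ≤ ((E - 1) * √p) ^ 2 := by gcongr
    _ = (E - 1) ^ 2 * p := by rw [mul_pow, Real.sq_sqrt hp]

theorem integrable_unnormalized {Φ π₀ : Pt d → ℝ} (hΦ : AEMeasurable Φ (cubeMeasure d))
    (hΦ0 : ∀ θ, 0 ≤ Φ θ) (hπ : Continuous π₀) (hπ0 : ∀ θ, 0 < π₀ θ) {b : ℝ} (hb : ∀ θ, π₀ θ ≤ b) :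
    Integrable (fun θ => Real.exp (-Φ θ) * π₀ θ) (cubeMeasure d) := by
  refine Integrable.of_bound (C := b)
    ((Real.measurable_exp.comp_aemeasurable hΦ.neg).mul hπ.aemeasurable).aestronglyMeasurable
    (Filter.Eventually.of_forall fun θ => ?_)
  have h := hπ0 θ
  rw [Real.norm_eq_abs, abs_of_pos (by positivity)]
  exact (mul_le_of_le_one_left h.le (Real.exp_le_one_iff.2 (by linarith [hΦ0 θ]))).trans (hb θ)

theorem normalizer_pos {Φ π₀ : Pt d → ℝ} (hπ0 : ∀ θ, 0 < π₀ θ)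
    (h : Integrable (fun θ => Real.exp (-Φ θ) * π₀ θ) (cubeMeasure d)) : 0 < normalizer Φ π₀ := by
  have hpos : ∀ θ, 0 < Real.exp (-Φ θ) * π₀ θ := fun θ => mul_pos (Real.exp_pos _) (hπ0 θ)
  rw [normalizer, integral_pos_iff_support_of_nonneg_ae
    (Filter.Eventually.of_forall fun θ => (hpos θ).le) h]
  rw [show Function.support (fun θ => Real.exp (-Φ θ) * π₀ θ) = Set.univ from
    Set.eq_univ_of_forall fun θ => (hpos θ).ne']
  exact cubeMeasure_univ_pos d

theorem normalizer_le {Φ Ψ π₀ : Pt d → ℝ} {ε : ℝ} (hπ0 : ∀ θ, 0 < π₀ θ)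
    (hΦ : Integrable (fun θ => Real.exp (-Φ θ) * π₀ θ) (cubeMeasure d))
    (hΨ : Integrable (fun θ => Real.exp (-Ψ θ) * π₀ θ) (cubeMeasure d))
    (h : ∀ᵐ θ ∂(cubeMeasure d), |Φ θ - Ψ θ| ≤ ε) :
    normalizer Φ π₀ ≤ Real.exp ε * normalizer Ψ π₀ := by
  rw [normalizer, normalizer, ← integral_const_mul]
  refine integral_mono_ae hΦ (hΨ.const_mul _) ?_
  filter_upwards [h] with θ hθ
  rw [← mul_assoc, ← Real.exp_add]
  have := (hπ0 θ).le
  have := abs_le.1 hθ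
  gcongr
  linarith

/-- One factor `exp ε` comes from the likelihood, the other from the normalizer. -/
theorem posterior_le {Φ Ψ π₀ : Pt d → ℝ} {ε : ℝ} {θ : Pt d} (hπ0 : 0 < π₀ θ)
    (hZΦ : 0 < normalizer Φ π₀) (hZΨ : 0 < normalizer Ψ π₀)
    (hZ : normalizer Ψ π₀ ≤ Real.exp ε * normalizer Φ π₀) (hθ : |Φ θ - Ψ θ| ≤ ε) :
    posterior Φ π₀ θ ≤ Real.exp ε ^ 2 * posterior Ψ π₀ θ := by
  unfold posterior
  have h1 : (normalizer Φ π₀)⁻¹ ≤ Real.exp ε * (normalizer Ψ π₀)⁻¹ := by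
    rw [← div_eq_mul_inv, inv_eq_one_div, div_le_div_iff₀ hZΦ hZΨ]
    linarith
  have h2 : Real.exp (-Φ θ) * π₀ θ ≤ Real.exp ε * (Real.exp (-Ψ θ) * π₀ θ) := by
    rw [← mul_assoc, ← Real.exp_add]
    have := abs_le.1 hθ
    gcongr
    linarith
  calc _ ≤ (Real.exp ε * (normalizer Ψ π₀)⁻¹) * (Real.exp ε * (Real.exp (-Ψ θ) * π₀ θ)) := by
        gcongr
    _ = _ := by ring

/-- The integrand is at most `(2 ε)^2` times a density of total mass 1, so the prior leaves no trace
in the constant; its bound `b` only serves integrability. -/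
theorem hellinger_posterior_le {Φ Ψ π₀ : Pt d → ℝ} (hΦ : AEMeasurable Φ (cubeMeasure d))
    (hΨ : AEMeasurable Ψ (cubeMeasure d)) (hΦ0 : ∀ θ, 0 ≤ Φ θ) (hΨ0 : ∀ θ, 0 ≤ Ψ θ)
    (hπ : Continuous π₀) (hπ0 : ∀ θ, 0 < π₀ θ) {b : ℝ} (hb : ∀ θ, π₀ θ ≤ b) {ε : ℝ} (hε : 0 ≤ ε)
    (hε2 : ε ≤ 1 / 2) (h : ∀ᵐ θ ∂(cubeMeasure d), |Φ θ - Ψ θ| ≤ ε) :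
    hellinger (posterior Φ π₀) (posterior Ψ π₀) ≤ ENNReal.ofReal (2 * ε) := by
  have hI := integrable_unnormalized hΦ hΦ0 hπ hπ0 hb
  have hJ := integrable_unnormalized hΨ hΨ0 hπ hπ0 hb
  have hZ := normalizer_pos hπ0 hI
  have hW := normalizer_pos hπ0 hJ
  have h' : ∀ᵐ θ ∂(cubeMeasure d), |Ψ θ - Φ θ| ≤ ε := by
    filter_upwards [h] with θ hθ
    rwa [abs_sub_comm]
  have hZW := normalizer_le hπ0 hI hJ h
  have hWZ := normalizer_le hπ0 hJ hI h'
  have hpost0 : ∀ θ, 0 ≤ posterior Φ π₀ θ := fun θ => by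
    have := hπ0 θ
    unfold posterior
    positivity
  have hpostInt : Integrable (posterior Φ π₀) (cubeMeasure d) := hI.const_mul _
  have hone : ∫ θ, posterior Φ π₀ θ ∂(cubeMeasure d) = 1 := by
    simp only [posterior]
    rw [integral_const_mul]
    exact inv_mul_cancel₀ hZ.ne'
  have hInt : ∫⁻ θ, ENNReal.ofReal ((√(posterior Φ π₀ θ) - √(posterior Ψ π₀ θ)) ^ 2)
      ∂(cubeMeasure d) ≤ ENNReal.ofReal ((2 * ε) ^ 2) := by
    calc _ ≤ ∫⁻ θ, ENNReal.ofReal ((2 * ε) ^ 2 * posterior Φ π₀ θ) ∂(cubeMeasure d) := by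
          refine lintegral_mono_ae ?_
          filter_upwards [h] with θ hθ
          refine ENNReal.ofReal_le_ofReal ?_
          have hθ' := hθ
          rw [abs_sub_comm] at hθ'
          refine (sq_sqrt_sub_sqrt_le (hpost0 θ) (Real.one_le_exp hε)
            (posterior_le (hπ0 θ) hW hZ hZW hθ') (posterior_le (hπ0 θ) hZ hW hWZ hθ)).trans ?_
          have h1 := exp_sub_one_le hε hε2
          have h2 : 0 ≤ Real.exp ε - 1 := by linarith [Real.one_le_exp hε]
          have := hpost0 θ
          gcongr
      _ = ENNReal.ofReal ((2 * ε) ^ 2) := by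
          rw [← ofReal_integral_eq_lintegral_ofReal (hpostInt.const_mul _)
            (Filter.Eventually.of_forall fun θ => mul_nonneg (by positivity) (hpost0 θ)),
            integral_const_mul, hone, mul_one]
  calc hellinger (posterior Φ π₀) (posterior Ψ π₀)
      ≤ (ENNReal.ofReal ((2 * ε) ^ 2)) ^ (1 / 2 : ℝ) := by
        refine ENNReal.rpow_le_rpow ?_ (by norm_num)
        refine le_trans ?_ hInt
        exact mul_le_of_le_one_left' (ENNReal.inv_le_one.2 one_le_two)
    _ = ENNReal.ofReal (2 * ε) := by
        rw [ENNReal.ofReal_rpow_of_nonneg (by positivity) (by norm_num), ← Real.sqrt_eq_rpow,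
          Real.sqrt_sq (by linarith)]

theorem ae_abs_le_of_slobodeckijNorm_le {s ε : ℝ} (hε : 0 ≤ ε) {e : Pt d → ℝ}
    (h : slobodeckijNorm s e ≤ ENNReal.ofReal ε) : ∀ᵐ θ ∂(cubeMeasure d), |e θ| ≤ ε := by
  have h1 : eLpNorm e ∞ (cubeMeasure d) ≤ ENNReal.ofReal ε := by
    unfold slobodeckijNorm at h
    split_ifs at h with hs
    · exact h
    · exact (le_max_left _ _).trans h
  rw [eLpNorm_exponent_top] at h1
  filter_upwards [ae_le_eLpNormEssSup (f := e) (μ := cubeMeasure d)] with y hy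
  have := hy.trans h1
  rwa [← ofReal_norm, ENNReal.ofReal_le_ofReal_iff hε] at this

end Hellinger

/-! ### From emulated components to the emulated potential -/

section Main

variable {d : ℕ}

theorem WeakDerivBdd.holderBdd {n : ℕ} {B s : ℝ} (hB : 0 ≤ B) (hs : 0 ≤ s) (hs1 : s ≤ 1)
    {f : Pt d → ℝ} (h : WeakDerivBdd n B f) (hf : ∀ x y, |f x - f y| ≤ d * B * ‖x - y‖) :
    HolderBdd (closedCube d) s (max (B + 1) ((2 * (B + 1)) ^ (1 - s) * (d * B) ^ s)) f := by
  obtain ⟨F, -, hFB, hFf⟩ := h.exists_smooth_approx hB (by positivity) hf one_pos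
  refine holderBdd_of_lipschitz (A := B + 1) (Λ := d * B) (by positivity) hs hs1 (fun x hx => ?_)
    (fun x _ y _ => hf x y) (le_max_left _ _) (le_max_right _ _)
  have h1 := hFB.abs_le hx
  have h2 := hFf x hx
  rw [abs_sub_comm] at h2
  calc |f x| = |F x + (f x - F x)| := by ring_nf
    _ ≤ |F x| + |f x - F x| := abs_add_le _ _
    _ ≤ B + 1 := add_le_add h1 h2

theorem holderBdd_const {T : Set (Pt d)} {s b c : ℝ} (hc : |c| ≤ b) :
    HolderBdd T s b fun _ => c := by
  refine ⟨fun _ _ => hc, fun x _ y _ => ?_⟩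
  have := (abs_nonneg c).trans hc
  rw [sub_self, abs_zero]
  positivity

theorem cube_subset_closedCube : cube d ⊆ closedCube d :=
  fun _ hx i => ⟨(hx i).1.le, (hx i).2.le⟩

/-- The existence of accurate emulators, with their size in terms of the mesh size. -/
theorem exists_potential_emulator (hd : 0 < d) (D n : ℕ) {s : ℝ} (hs : 0 ≤ s) (hs1 : s < 1)
    (Γ : Matrix (Fin D) (Fin D) ℝ) {B : ℝ} (hB : 0 ≤ B) :
    ∃ R > (0 : ℝ), ∃ K : ℕ, ∀ (y : Fin D → ℝ) (_ : ∀ j, |y j| ≤ B) (G : Pt d → Fin D → ℝ)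
      (_ : ∀ j, MemLp (fun θ => G θ j) ∞ (cubeMeasure d))
      (_ : ∀ j, WeakDerivBdd (n + 1) B fun θ => G θ j) (ε : ℝ) (_ : ε ≤ 1) (a : ℕ)
      (_ : R * (1 / (2 ^ a : ℕ) : ℝ) ^ ((n : ℝ) + 1 - s) ≤ ε),
      ∃ N : Net d D,
        slobodeckijNorm s (fun θ => potential Γ y G θ - potential Γ y N.emulator θ) ≤
          ENNReal.ofReal ε ∧
        N.depth ≤ K * (a + 1) ∧ N.numWeights ≤ K * ((2 ^ a) ^ d * (a + 1)) ∧
        N.numUnits ≤ K * ((2 ^ a) ^ d * (a + 1)) := by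
  obtain ⟨C, hC, K, hem⟩ := exists_emulator hd D n hs hs1 hB
  set A : ℝ := B + max (B + 1) ((2 * (B + 1)) ^ (1 - s) * (d * B) ^ s) with hA
  have hA0 : 0 ≤ A := add_nonneg hB ((by linarith : 0 ≤ B + 1).trans (le_max_left _ _))
  set P : ℝ := (∑ j, ∑ k, |Γ⁻¹ j k|) * (2 * A + 1) with hP
  have hP0 : 0 ≤ P := by positivity
  -- With `P + 1` in place of `P` the mesh condition yields both `P δ ≤ ε` and `δ ≤ 1`, even if `P =
  -- 0`.
  refine ⟨C * (P + 1), by positivity, K, fun y hy G hG hGw ε hε1 a ha => ?_⟩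
  choose f hGf hfL using fun j => (hGw j).exists_lipschitz (Nat.succ_pos n) hB (hG j)
  have hfw : ∀ j, WeakDerivBdd (n + 1) B (f j) := fun j => (hGw j).congr (hGf j)
  obtain ⟨N, hN, hN'⟩ := hem a f hfw hfL
  refine ⟨N, ?_, hN'⟩
  set δ : ℝ := C * (1 / (2 ^ a : ℕ) : ℝ) ^ ((n : ℝ) + 1 - s) with hδ
  have hδ0 : 0 ≤ δ := by positivity
  have hδε : δ * (P + 1) ≤ ε := by rw [hδ]; linarith
  -- The network approximates the Lipschitz representatives, which agree with `G` only almost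
  -- everywhere.
  let T : Set (Pt d) := {x | x ∈ cube d ∧ ∀ j, G x j = f j x}
  have hT : ∀ᵐ x ∂(cubeMeasure d), x ∈ T := by
    filter_upwards [ae_restrict_mem measurableSet_cube, Filter.eventually_all.2 hGf] with x h1 h2
    exact ⟨h1, h2⟩
  have hTc : T ⊆ closedCube d := fun x hx => cube_subset_closedCube hx.1
  refine slobodeckijNorm_le_of_holderBdd hT ((holderBdd_potential_sub Γ y G N.emulator (A := A)
    (δ := δ) hA0 hδ0 (by nlinarith) (fun j => ?_) fun j => ?_).mono ?_)
  · have h1 := ((hfw j).holderBdd hB hs hs1.le (hfL j)).subset hTc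
    refine (((holderBdd_const (hy j)).add (h1.const_mul (-1))).mono ?_).congr fun x hx => ?_
    · rw [hA]; simp
    · rw [hx.2 j]; ring
  · exact ((hN j).subset hTc).congr fun x hx => by rw [hx.2 j]
  · rw [← hP]; nlinarith

end Main
end Emulation

end

/-! ### Choice of the mesh and conclusion -/

theorem theorem3 (d D n : ℕ) (hd : 0 < d) (hn : 0 < n) (s : ℝ) (hs : 0 ≤ s) (hs1 : s < 1)
    (Γ : Matrix (Fin D) (Fin D) ℝ) (hΓ : Γ.PosDef) (B : ℝ) (hB : 0 ≤ B) :
    ∃ c > (0 : ℝ), ∃ C > (0 : ℝ),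
      ∀ (y : Fin D → ℝ) (_ : ∀ j, |y j| ≤ B)
        (G : EuclideanSpace ℝ (Fin d) → Fin D → ℝ)
        (_ : ∀ j, Emulation.MemSobolev n ∞ (fun θ => G θ j))
        (_ : ∀ j, Emulation.sobolevNorm n (fun θ => G θ j) ≤ ENNReal.ofReal B)
        (ε : ℝ) (_ : 0 < ε) (_ : ε < 1 / 2),
        -- emulators of the claimed accuracy and size exist
        (∃ N : Emulation.Net d D,
          Emulation.slobodeckijNorm s
            (fun θ => Emulation.potential Γ y G θ - Emulation.potential Γ y N.emulator θ)
              ≤ ENNReal.ofReal ε ∧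
          (N.depth : ℝ) ≤ c * Real.log (ε ^ (-(n / (n - s) : ℝ))) ∧
          (N.numWeights : ℝ) ≤
            c * ε ^ (-(d / (n - s) : ℝ)) * Real.log (ε ^ (-(n / (n - s) : ℝ))) ^ 2 ∧
          (N.numUnits : ℝ) ≤
            c * ε ^ (-(d / (n - s) : ℝ)) * Real.log (ε ^ (-(n / (n - s) : ℝ))) ^ 2) ∧
        -- and each emulator of this accuracy gives a posterior within `C ε`, for every prior
        (∀ N : Emulation.Net d D,
          Emulation.slobodeckijNorm s
            (fun θ => Emulation.potential Γ y G θ - Emulation.potential Γ y N.emulator θ)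
              ≤ ENNReal.ofReal ε →
          ∀ (m : Fin d → ℝ) (S : Matrix (Fin d) (Fin d) ℝ), S.PosDef →
            Emulation.hellinger
              (Emulation.posterior (Emulation.potential Γ y G) (Emulation.gaussianDensity m S))
              (Emulation.posterior (Emulation.potential Γ y N.emulator)
                (Emulation.gaussianDensity m S)) ≤ ENNReal.ofReal (C * ε)) := by
  obtain ⟨k, rfl⟩ := Nat.exists_eq_succ_of_ne_zero hn.ne'
  obtain ⟨R, hR, K, hem⟩ := Emulation.exists_potential_emulator hd D k hs hs1 Γ hB
  have hp : (0 : ℝ) < (k : ℝ) + 1 - s := by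
    have : (0 : ℝ) ≤ k := by positivity
    linarith
  obtain ⟨c₀, hc₀, hmesh⟩ := Emulation.exists_mesh (R := R) hp
  have hl2 : 0 < Real.log 2 := Real.log_pos (by norm_num)
  refine ⟨K * c₀ + K * c₀ ^ (d + 1) / Real.log 2 + 1, by positivity, 2, two_pos,
    fun y hy G hG hGn ε hε hε2 => ⟨?_, fun N hN m S hS => ?_⟩⟩
  · obtain ⟨a, ha1, ha2, ha3⟩ := hmesh ε hε hε2
    obtain ⟨N, h1, h2, h3, h4⟩ := hem y hy G (fun j => (hG j).1)
      (fun j => Emulation.weakDerivBdd_of_memSobolev hB (hG j) (hGn j)) ε (by linarith) a ha1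
    have hcast : (((k + 1 : ℕ) : ℝ) - s) = (k : ℝ) + 1 - s := by push_cast; ring
    simp only [Nat.succ_eq_add_one, hcast]
    set p : ℝ := (k : ℝ) + 1 - s with hpdef
    set ℓ : ℝ := Real.log (1 / ε) with hℓ
    have hℓ2 : Real.log 2 ≤ ℓ :=
      Real.log_le_log (by norm_num) ((le_div_iff₀ hε).2 (by linarith))
    have hℓ0 : 0 < ℓ := by linarith
    set lg : ℝ := Real.log (ε ^ (-(((k + 1 : ℕ) : ℝ) / p))) with hlg
    -- The stated logarithm is `n / (n - s) ≥ 1` times `log (1/ε)`.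
    have hlgℓ : ℓ ≤ lg := by
      have e : lg = ((k + 1 : ℕ) : ℝ) / p * ℓ := by
        rw [hlg, Real.log_rpow hε, hℓ, one_div, Real.log_inv]; ring
      rw [e]
      refine le_mul_of_one_le_left hℓ0.le ((one_le_div hp).2 ?_)
      rw [hpdef]; push_cast; linarith
    have hsize : ((K * ((2 ^ a) ^ d * (a + 1)) : ℕ) : ℝ) ≤
        (K * c₀ + K * c₀ ^ (d + 1) / Real.log 2 + 1) * ε ^ (-(d / p)) * lg ^ 2 := by
      have e1 : (ε ^ (-(1 / p))) ^ d = ε ^ (-(d / p)) := by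
        rw [← Real.rpow_natCast, ← Real.rpow_mul hε.le]
        congr 1; ring
      -- The construction needs one logarithm only; as `lg ≥ ℓ ≥ log 2`, it is dominated by the
      -- squared one.
      have e2 : ℓ ≤ lg ^ 2 / Real.log 2 := by
        rw [le_div_iff₀ hl2]; nlinarith
      push_cast
      calc (K : ℝ) * ((2 ^ a) ^ d * (a + 1)) ≤ K * ((c₀ * ε ^ (-(1 / p))) ^ d * (c₀ * ℓ)) := by
            gcongr
        _ = K * c₀ ^ (d + 1) * ε ^ (-(d / p)) * ℓ := by rw [mul_pow, e1]; ring
        _ ≤ K * c₀ ^ (d + 1) * ε ^ (-(d / p)) * (lg ^ 2 / Real.log 2) := by gcongr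
        _ = (K * c₀ ^ (d + 1) / Real.log 2) * ε ^ (-(d / p)) * lg ^ 2 := by ring
        _ ≤ _ := by
            have : 0 ≤ K * c₀ := by positivity
            gcongr
            linarith
    refine ⟨N, h1, ?_, (Nat.cast_le.2 h3).trans hsize, (Nat.cast_le.2 h4).trans hsize⟩
    calc (N.depth : ℝ) ≤ ((K * (a + 1) : ℕ) : ℝ) := Nat.cast_le.2 h2
      _ = K * (a + 1) := by push_cast; ring
      _ ≤ K * (c₀ * ℓ) := by gcongr
      _ ≤ K * (c₀ * lg) := by gcongr
      _ = (K * c₀) * lg := by ring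
      _ ≤ _ := by
          have : 0 ≤ K * c₀ ^ (d + 1) / Real.log 2 := by positivity
          have : 0 ≤ lg := hℓ0.le.trans hlgℓ
          gcongr
          linarith
  · refine Emulation.hellinger_posterior_le
      (Emulation.aemeasurable_potential Γ y fun j => (hG j).1.1.aemeasurable)
      (Emulation.aemeasurable_potential Γ y fun j => ?_)
      (Emulation.potential_nonneg hΓ y _) (Emulation.potential_nonneg hΓ y _)
      (Emulation.continuous_gaussianDensity m S) (Emulation.gaussianDensity_pos m hS)
      (Emulation.gaussianDensity_le m hS) hε.le hε2.le
      (Emulation.ae_abs_le_of_slobodeckijNorm_le hε.le hN)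
    refine Continuous.aemeasurable ?_
    exact (continuous_apply j).comp ((Emulation.continuous_eval N).comp (by fun_prop))
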